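/- Let $\mathcal D$ be a triangulated category, $\Gamma$ a finitely generated free abelian group and $\mathrm{cl}\colon K(\mathcal D)\to\Gamma$ a group homomorphism; for a homomorphism $f$ on $\Gamma$ write $f(E)=f(\mathrm{cl}(E))$. For a subset $S\subset\Gamma$ let $[S]$ be the saturation of the subgroup generated by $S$. A *very weak pre-stability condition* is a pair $(Z,\mathcal A)$, where $\mathcal A\subset\mathcal D$ is the heart of a bounded t-structure and $Z\colon\Gamma\to\mathbb C$ is a homomorphism, such that $Z(E)\in\{\operatorname{Im}>0\}\cup\mathbb R_{\le 0}$ for all $E\in\mathcal A$ and such that the slope $\mu=-\operatorname{Re}Z/\operatorname{Im}Z$ (with $\mu(E)=\infty$ if $\operatorname{Im}Z(E)=0$) has the Harder–Narasimhan (HN) property: every $E\in\mathcal A$ has a filtration in $\mathcal A$ with $\mu$-semistable quotients of strictly decreasing slopes, where $E$ is $\mu$-semistable if $\mu(F)\le\mu(E/F)$ for all $0\ne F\subset E$ in $\mathcal A$. Put $\mathcal C=\{E\in\mathcal A: Z(E)=0\}$ and $\Gamma_0=[\mathrm{cl}(\mathcal C)]$, and let $\overline Z\colon(\Gamma/\Gamma_0)\otimes\mathbb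 R\to\mathbb C$ be the map induced by $Z$. The pair is a *very weak stability condition* if moreover it has the *support property*: there is a real quadratic form $Q$ on $(\Gamma/\Gamma_0)\otimes\mathbb R$ with $Q(E)\ge 0$ for all $\mu$-semistable $E\in\mathcal A$ and $Q$ negative definite on $\ker\overline Z$. The *associated slicing* $\{\mathcal P(\phi)\}_{\phi\in\mathbb R}$ is given, for $0<\phi\le 1$, by the zero objects and the $\mu$-semistable $E\in\mathcal A$ with $\mu(E)=-1/\tan(\pi\phi)$ (meaning $\infty$ for $\phi=1$), and by $\mathcal P(\phi+1)=\mathcal P(\phi)[1]$; $\mathcal P(I)$ is the extension closure of the $\mathcal P(\phi)$, $\phi\in I$. The set $\mathrm{Stab}^{\mathrm{vw}}_\Gamma(\mathcal D)$ of very weak stability conditions has the topology induced by the inclusion $(Z,\mathcal A)\mapsto(Z,\{\mathcal P(\phi)\})$ into $\operatorname{Hom}(\Gamma,\mathbb C)\times\mathrm{Slice}(\mathcal D)$, where the set $\mathrm{Slice}(\mathcal D)$ of slicings has the topology of Bridgeland's generalized metric $d(\mathcal P,\mathcal P')=\sup_{0\ne E\in\mathcal D}\max\{|\phi^+_{\mathcal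 P}(E)-\phi^+_{\mathcal P'}(E)|,|\phi^-_{\mathcal P}(E)-\phi^-_{\mathcal P'}(E)|\}\in[0,\infty]$, with $\phi^{\pm}$ the largest and smallest phases of the HN factors. Let $(Z,\mathcal A)$ be a very weak stability condition satisfying a *BG inequality* given by homomorphisms $\Delta_R,\Delta_I\colon\Gamma\to\mathbb Q$, that is: $\operatorname{Re}Z(E)\Delta_R(E)+\operatorname{Im}Z(E)\Delta_I(E)\ge0$ for every $\mu$-semistable $E\in\mathcal A$; $\Delta_R|_{\mathcal C}=0$; $\Delta_I|_{\mathcal C}\le 0$; and $\Delta_I|_{\mathcal C}\not\equiv0$. Put $\mathcal C^\dagger=\{F\in\mathcal C:\Delta_I(F)=0\}$. Suppose that $(Z,\mathcal A)$ is *good*, that is: 1. there are real $\zeta_1,\zeta_2>0$ with $Z(\Gamma)\subset\zeta_1\mathbb Q+\zeta_2\mathbb Q\,i$; 2. $\mathcal A$ is noetherian; 3. $[\mathrm{cl}(\mathcal C^\dagger)]=\Gamma_0\cap\ker\Delta_I$; 4. for every $\phi\in(0,1)$ and $U\in\mathcal P(\phi)$ there is an injection $U\hookrightarrow\widehat U$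 in $\mathcal A$ with $\operatorname{Hom}(\mathcal C^\dagger,\widehat U[1])=0$. For $t>0$ let $Z_t^\dagger=-iZ+t\Delta_I$ and $\mathcal A^\dagger=\mathcal P((1/2,3/2])$. Then for every $t>0$ the pair $(Z_t^\dagger,\mathcal A^\dagger)$ is a very weak stability condition (in particular $\mathcal A^\dagger$ is the heart of a bounded t-structure, and the HN property and the support property hold), and the map $\mathbb R_{>0}\to\mathrm{Stab}^{\mathrm{vw}}_\Gamma(\mathcal D)$, $t\mapsto(Z_t^\dagger,\mathcal A^\dagger)$, is continuous. -/

import Mathlib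

open CategoryTheory CategoryTheory.Limits CategoryTheory.Pretriangulated
open scoped TensorProduct

universe v u w

namespace VeryWeakStab

section Lattice

variable {Γ : Type w} [AddCommGroup Γ]

/-- The saturation `[S]` of the subgroup generated by a subset `S`: all `x` with a nonzero
integral multiple in the subgroup generated by `S`. -/
def saturation (S : Set Γ) : AddSubgroup Γ where
  carrier := {x | ∃ n : ℤ, n ≠ 0 ∧ n • x ∈ AddSubgroup.closure S}
  zero_mem' := ⟨1, one_ne_zero, by simp⟩
  add_mem' := by
    rintro x y ⟨m, hm, hx⟩ ⟨n, hn, hy⟩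
    refine ⟨m * n, mul_ne_zero hm hn, ?_⟩
    rw [smul_add, mul_comm m n, mul_smul, mul_comm n m, mul_smul]
    exact add_mem (AddSubgroup.zsmul_mem _ hx n) (AddSubgroup.zsmul_mem _ hy m)
  neg_mem' := by
    rintro x ⟨m, hm, hx⟩
    exact ⟨m, hm, by simpa using hx⟩

theorem saturation_le_ker (Z : Γ →+ ℂ) (S : Set Γ) (hS : ∀ x ∈ S, Z x = 0) :
    saturation S ≤ Z.ker := by
  rintro x ⟨n, hn, hx⟩
  have h1 : AddSubgroup.closure S ≤ Z.ker := by
    rw [AddSubgroup.closure_le]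
    exact hS
  have h2 : Z (n • x) = 0 := h1 hx
  rw [map_zsmul, smul_eq_zero] at h2
  exact h2.resolve_left hn

/-- The slope `-Re Z / Im Z`, with value `∞` when `Im Z = 0`. -/
noncomputable def slope (Z : Γ →+ ℂ) (x : Γ) : WithTop ℝ :=
  if (Z x).im = 0 then ⊤ else ((-(Z x).re / (Z x).im : ℝ) : WithTop ℝ)

end Lattice

section Categories

variable (D : Type u) [Category.{v} D] [Preadditive D] [HasZeroObject D] [HasShift D ℤ]
  [∀ n : ℤ, (shiftFunctor D n).Additive] [Pretriangulated D]

/-- The Grothendieck group `K(D)`: generators the objects of `D`, one relation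
`[E₂] = [E₁] + [E₃]` for each distinguished triangle `E₁ → E₂ → E₃ → E₁[1]`. -/
abbrev K0 : Type u :=
  FreeAbelianGroup D ⧸ AddSubgroup.closure
    {x : FreeAbelianGroup D | ∃ T ∈ distTriang D,
      x = FreeAbelianGroup.of T.obj₂ - FreeAbelianGroup.of T.obj₁ - FreeAbelianGroup.of T.obj₃}

variable {D}

/-- The class of an object in the Grothendieck group. -/
def K0.of (E : D) : K0 D := QuotientAddGroup.mk (FreeAbelianGroup.of E)

/-- `A` is the heart of a bounded t-structure. -/
def IsBoundedHeart (A : ObjectProperty D) : Prop :=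
  ∃ τ : Triangulated.TStructure D, (∀ E : D, τ.bounded E) ∧ τ.heart = A

/-- The extension closure `⟨S⟩` in `D`. -/
inductive extClosure (S : ObjectProperty D) : D → Prop
  | of_isZero (E : D) (h : IsZero E) : extClosure S E
  | of_mem (E : D) (h : S E) : extClosure S E
  | ext (T : Triangle D) (hT : T ∈ distTriang D) (h₁ : extClosure S T.obj₁)
      (h₃ : extClosure S T.obj₃) : extClosure S T.obj₂

/-! ### Slicings -/

/-- A Harder-Narasimhan filtration of `E` with respect to a family of subcategories `P φ`:
a tower of distinguished triangles `E_j → E_{j+1} → F_j → E_j[1]` for `j = 0, …, n`, from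
`E_0 = 0` to `E_{n+1} = E`, with nonzero `F_j ∈ P (φ_j)` and `φ_0 > ⋯ > φ_n`. -/
structure PhaseFiltration (P : ℝ → ObjectProperty D) (E : D) where
  n : ℕ
  obj : Fin (n + 2) → D
  factor : Fin (n + 1) → D
  phase : Fin (n + 1) → ℝ
  isZero_zero : IsZero (obj 0)
  lastIso : obj (Fin.last (n + 1)) ≅ E
  incl : ∀ j : Fin (n + 1), obj j.castSucc ⟶ obj j.succ
  proj : ∀ j : Fin (n + 1), obj j.succ ⟶ factor j
  conn : ∀ j : Fin (n + 1), factor j ⟶ (obj j.castSucc)⟦(1 : ℤ)⟧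
  distinguished : ∀ j, Triangle.mk (incl j) (proj j) (conn j) ∈ distTriang D
  factor_mem : ∀ j, P (phase j) (factor j)
  factor_ne_zero : ∀ j, ¬ IsZero (factor j)
  phase_anti : StrictAnti phase

/-- The largest phase occurring in a filtration. -/
def PhaseFiltration.phiPlus {P : ℝ → ObjectProperty D} {E : D} (h : PhaseFiltration P E) : ℝ :=
  h.phase 0

/-- The smallest phase occurring in a filtration. -/
def PhaseFiltration.phiMinus {P : ℝ → ObjectProperty D} {E : D} (h : PhaseFiltration P E) : ℝ :=
  h.phase (Fin.last h.n)

variable (D) in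
/-- A slicing of `D` in the sense of Bridgeland. -/
structure Slicing where
  P : ℝ → ObjectProperty D
  of_iso : ∀ (φ : ℝ) {X Y : D}, (X ≅ Y) → P φ X → P φ Y
  zero_mem : ∀ (φ : ℝ) (X : D), IsZero X → P φ X
  biprod_mem : ∀ (φ : ℝ) (X Y : D), P φ X → P φ Y → P φ (X ⊞ Y)
  shift_iff : ∀ (φ : ℝ) (X : D), P (φ + 1) (X⟦(1 : ℤ)⟧) ↔ P φ X
  hom_zero : ∀ (φ₁ φ₂ : ℝ), φ₂ < φ₁ → ∀ X Y : D, P φ₁ X → P φ₂ Y → ∀ f : X ⟶ Y, f = 0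
  exists_filtration : ∀ E : D, ¬ IsZero E → Nonempty (PhaseFiltration P E)

/-- Bridgeland's generalized metric
`d(P, Q) = sup_{E ≠ 0} max (|φ⁺_P(E) - φ⁺_Q(E)|, |φ⁻_P(E) - φ⁻_Q(E)|) ∈ [0, ∞]`.
The filtrations of a given object with respect to a slicing are unique up to isomorphism,
so the supremum over them adds nothing. -/
noncomputable def Slicing.dist (P Q : Slicing D) : ENNReal :=
  ⨆ (E : D) (_ : ¬ IsZero E) (h : PhaseFiltration P.P E) (h' : PhaseFiltration Q.P E),
    ENNReal.ofReal (max |h.phiPlus - h'.phiPlus| |h.phiMinus - h'.phiMinus|)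

/-- The topology of Bridgeland's generalized metric. -/
instance : TopologicalSpace (Slicing D) where
  IsOpen U := ∀ P ∈ U, ∃ ε : ENNReal, 0 < ε ∧ ∀ Q : Slicing D, P.dist Q < ε → Q ∈ U
  isOpen_univ := fun _ _ => ⟨1, one_pos, fun _ _ => trivial⟩
  isOpen_inter := by
    rintro U V hU hV P ⟨hPU, hPV⟩
    obtain ⟨ε, hε, h⟩ := hU P hPU
    obtain ⟨ε', hε', h'⟩ := hV P hPV
    exact ⟨min ε ε', lt_min hε hε', fun Q hQ =>
      ⟨h Q (hQ.trans_le (min_le_left _ _)), h' Q (hQ.trans_le (min_le_right _ _))⟩⟩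
  isOpen_sUnion := by
    rintro S hS P ⟨U, hUS, hPU⟩
    obtain ⟨ε, hε, h⟩ := hS U hUS P hPU
    exact ⟨ε, hε, fun Q hQ => ⟨U, hUS, h Q hQ⟩⟩

/-! ### Very weak stability conditions -/

variable {Γ : Type w} [AddCommGroup Γ] (cl : K0 D →+ Γ) (Z : Γ →+ ℂ) (A : ObjectProperty D)

/-- `E ∈ A` is `μ`-semistable: `μ(F) ≤ μ(E/F)` for every nonzero subobject `F ⊂ E` in `A`, i.e.
for every short exact sequence `0 → F → E → G → 0` in the category `A` with `F ≠ 0`. -/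
def IsSemistable (E : A.FullSubcategory) : Prop :=
  ∀ (F G : A.FullSubcategory) (i : F ⟶ E) (p : E ⟶ G) (w : i ≫ p = 0),
    (ShortComplex.mk i p w).ShortExact → ¬ IsZero F →
      slope Z (cl (K0.of F.obj)) ≤ slope Z (cl (K0.of G.obj))

/-- A Harder-Narasimhan filtration `0 = E_0 ⊂ E_1 ⊂ ⋯ ⊂ E_n = E` in the category `A`, with
nonzero `μ`-semistable quotients `F_j = E_{j+1}/E_j` of strictly decreasing slopes. -/
structure HNFiltration (E : A.FullSubcategory) where
  n : ℕ
  obj : Fin (n + 1) → A.FullSubcategory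
  factor : Fin n → A.FullSubcategory
  isZero_zero : IsZero (obj 0)
  lastIso : obj (Fin.last n) ≅ E
  incl : ∀ j : Fin n, obj j.castSucc ⟶ obj j.succ
  proj : ∀ j : Fin n, obj j.succ ⟶ factor j
  comp_zero : ∀ j, incl j ≫ proj j = 0
  shortExact : ∀ j, (ShortComplex.mk (incl j) (proj j) (comp_zero j)).ShortExact
  factor_ne_zero : ∀ j, ¬ IsZero (factor j)
  semistable : ∀ j, IsSemistable cl Z A (factor j)
  slope_anti : StrictAnti fun j => slope Z (cl (K0.of (factor j).obj))

/-- `(Z, A)` is a very weak pre-stability condition on `D` with respect to `cl : K(D) → Γ`. -/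
structure IsVeryWeakPreStability : Prop where
  isBoundedHeart : IsBoundedHeart A
  upper : ∀ E : D, A E → 0 < (Z (cl (K0.of E))).im ∨
    ((Z (cl (K0.of E))).im = 0 ∧ (Z (cl (K0.of E))).re ≤ 0)
  hn : ∀ E : A.FullSubcategory, Nonempty (HNFiltration cl Z A E)

/-- For `0 < φ ≤ 1`: zero objects, and `μ`-semistable objects `E ∈ A` with
`μ(E) = -1 / tan (π φ) = -cos (π φ) / sin (π φ)`, where `-1 / tan π` means `∞`. -/
def basicPhase (φ : ℝ) : ObjectProperty D := fun E =>
  IsZero E ∨ ∃ hE : A E, IsSemistable cl Z A ⟨E, hE⟩ ∧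
    slope Z (cl (K0.of E)) =
      if φ = 1 then ⊤ else ((-Real.cos (Real.pi * φ) / Real.sin (Real.pi * φ) : ℝ) : WithTop ℝ)

/-- The subcategories `P(φ)`, `φ ∈ ℝ`, associated with `(Z, A)`: if `φ = ψ + m` with `m ∈ ℤ` and
`0 < ψ ≤ 1`, then `P(φ) = P(ψ)[m]`. -/
def phase (φ : ℝ) : ObjectProperty D := fun E =>
  basicPhase cl Z A (φ - (⌈φ⌉ - 1 : ℤ)) (E⟦(-(⌈φ⌉ - 1) : ℤ)⟧)

/-- `P(I)`: the smallest extension closed subcategory containing `P(φ)` for all `φ ∈ I`. -/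
def phaseInterval (I : Set ℝ) : ObjectProperty D :=
  extClosure fun E => ∃ φ ∈ I, phase cl Z A φ E

/-- The subcategory `C` of objects `E ∈ A` with `Z(E) = 0`. -/
def kernelCat : ObjectProperty D := fun E => A E ∧ Z (cl (K0.of E)) = 0

/-- The set of classes `cl(E)` of objects `E` of a subcategory. -/
def classes (S : ObjectProperty D) : Set Γ := {x | ∃ E : D, S E ∧ cl (K0.of E) = x}

/-- The subgroup `Γ₀ = [cl(C)]`. -/
def Γ₀ : AddSubgroup Γ := saturation (classes cl (kernelCat cl Z A))

theorem Γ₀_le_ker : Γ₀ cl Z A ≤ Z.ker :=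
  saturation_le_ker Z _ (by rintro x ⟨E, hE, rfl⟩; exact hE.2)

/-- The homomorphism `Γ/Γ₀ → ℂ` induced by `Z`. -/
noncomputable def Zbar : (Γ ⧸ Γ₀ cl Z A) →+ ℂ := QuotientAddGroup.lift _ Z (Γ₀_le_ker cl Z A)

/-- Its `ℝ`-linear extension `(Γ/Γ₀) ⊗ ℝ → ℂ`. -/
noncomputable def ZbarReal : ℝ ⊗[ℤ] (Γ ⧸ Γ₀ cl Z A) →ₗ[ℝ] ℂ :=
  LinearMap.liftBaseChange ℝ (Zbar cl Z A).toIntLinearMap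

/-- The support property: there is a (real) quadratic form `Q` on `Γ/Γ₀`, i.e. a quadratic form on
the real vector space `(Γ/Γ₀) ⊗ ℝ`, which is nonnegative on the classes of `μ`-semistable objects
and negative definite on the kernel of `(Γ/Γ₀) ⊗ ℝ → ℂ`. -/
def SupportProperty : Prop :=
  ∃ Q : QuadraticForm ℝ (ℝ ⊗[ℤ] (Γ ⧸ Γ₀ cl Z A)),
    (∀ E : A.FullSubcategory, IsSemistable cl Z A E →
      0 ≤ Q ((1 : ℝ) ⊗ₜ[ℤ] (QuotientAddGroup.mk (cl (K0.of E.obj)) : Γ ⧸ Γ₀ cl Z A))) ∧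
    ∀ x, ZbarReal cl Z A x = 0 → x ≠ 0 → Q x < 0

/-- `(Z, A)` is a very weak stability condition. -/
structure IsVeryWeakStability : Prop extends IsVeryWeakPreStability cl Z A where
  support : SupportProperty cl Z A

/-- The set `Stab^vw_Γ(D)` of very weak stability conditions `(Z, A)`, seen inside
`Hom(Γ, ℂ) × Slice(D)`: the slicing recorded here is the one associated with `(Z, A)`. -/
structure Stab where
  Z : Γ →+ ℂ
  A : ObjectProperty D
  isVeryWeakStability : IsVeryWeakStability cl Z A
  slicing : Slicing D
  slicing_eq : slicing.P = phase cl Z A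

/-- The topology induced by the inclusion into `Hom(Γ, ℂ) × Slice(D)`, where `Hom(Γ, ℂ)` carries the
topology of pointwise convergence. -/
noncomputable instance : TopologicalSpace (Stab cl) :=
  TopologicalSpace.induced (fun σ : Stab cl => ((σ.Z : Γ → ℂ), σ.slicing)) inferInstance

/-! ### Tilting -/

/-- The linear maps `Δ_R, Δ_I : Γ → ℚ` provide a BG inequality for `(Z, A)`. -/
structure IsBGInequality (ΔR ΔI : Γ →+ ℚ) : Prop where
  nonneg : ∀ E : A.FullSubcategory, IsSemistable cl Z A E →
    0 ≤ (Z (cl (K0.of E.obj))).re * (ΔR (cl (K0.of E.obj)) : ℝ) +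
      (Z (cl (K0.of E.obj))).im * (ΔI (cl (K0.of E.obj)) : ℝ)
  ΔR_eq_zero : ∀ E, kernelCat cl Z A E → ΔR (cl (K0.of E)) = 0
  ΔI_nonpos : ∀ E, kernelCat cl Z A E → ΔI (cl (K0.of E)) ≤ 0
  ΔI_not_zero : ∃ E, kernelCat cl Z A E ∧ ΔI (cl (K0.of E)) ≠ 0

/-- `C†`: the objects `F ∈ C` with `Δ_I(F) = 0`. -/
def kernelCatDagger (ΔI : Γ →+ ℚ) : ObjectProperty D := fun F =>
  kernelCat cl Z A F ∧ ΔI (cl (K0.of F)) = 0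

/-- `(Z, A)` (with a BG inequality given by `Δ_R, Δ_I`) is good. -/
structure IsGood (ΔI : Γ →+ ℚ) : Prop where
  rational : ∃ ζ₁ ζ₂ : ℝ, 0 < ζ₁ ∧ 0 < ζ₂ ∧
    ∀ x : Γ, ∃ a b : ℚ, Z x = ((ζ₁ * a : ℝ) : ℂ) + ((ζ₂ * b : ℝ) : ℂ) * Complex.I
  noetherian : ∀ E : A.FullSubcategory, IsNoetherianObject E
  saturated : saturation (classes cl (kernelCatDagger cl Z A ΔI)) = Γ₀ cl Z A ⊓ ΔI.ker
  hull : ∀ φ ∈ Set.Ioo (0 : ℝ) 1, ∀ U : A.FullSubcategory, phase cl Z A φ U.obj →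
    ∃ (U' : A.FullSubcategory) (i : U ⟶ U'), Mono i ∧
      ∀ F : D, kernelCatDagger cl Z A ΔI F → ∀ g : F ⟶ U'.obj⟦(1 : ℤ)⟧, g = 0

/-- The tilted central charge `Z_t† = -i Z + t Δ_I`. -/
noncomputable def tiltCharge (Z : Γ →+ ℂ) (ΔI : Γ →+ ℚ) (t : ℝ) : Γ →+ ℂ where
  toFun x := -Complex.I * Z x + (t : ℂ) * (ΔI x : ℂ)
  map_zero' := by simp
  map_add' x y := by simp; ring

/-- The tilted heart `A† = P((1/2, 3/2])`. -/
def tiltHeart : ObjectProperty D := phaseInterval cl Z A (Set.Ioc (1 / 2) (3 / 2))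

end Categories

end VeryWeakStab

open scoped ZeroObject

namespace VeryWeakStab

/-! ### Hearts of bounded t-structures: abelian structure, short exact sequences and triangles. -/

section Heart

variable {D : Type u} [Category.{v} D] [Preadditive D] [HasZeroObject D] [HasShift D ℤ]
  [∀ n : ℤ, (shiftFunctor D n).Additive] [Pretriangulated D]

/-! The tilted heart is generated by the semistable objects of phase in `(1/2, 3/2]`. On these `Re Z
< 0`, except for objects of `C` and objects of phase `3/2`. On `C` the tilted charge is `t Δ_I ≤ 0`;
in phase `3/2` the BG inequality forces `Δ_I ≤ 0`, so the charge is a negative real number. Hence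
the tilted charge takes admissible values, and it vanishes exactly on `C†`
(`IsBGInequality.tilt_upper`).

HN filtrations: the tilted imaginary part is `-Re Z`, which is discrete by rationality. A weak
charge with discrete imaginary part has HN filtrations as soon as every object has a largest
subobject with `Im = 0` (`exists_hnTower`); the tilted heart need not be noetherian. The torsion
part comes from `exists_tilt_radical`, whose core is a radical with respect to `C`. In phases above
`1` that radical is found by embedding an object `V` of phase in `(0, 1/2]` into some `U` with
quotient in `C` and `Hom(C, U[1]) = 0` (`exists_kernelCat_injective`). Here the BG inequality bounds
`Δ_I` from below, noetherianity gives a maximal choice, and the hulls in the definition of good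
handle the extensions by `C†`.

Support property: the form is `q = Q + M (Re Z Δ_R + Im Z Δ_I)`. For `M` large it is negative
definite on the kernels of all `Z_s†` with `0 < s ≤ T`, and negative semidefinite on that of `Z_0† =
-iZ` (`exists_tilt_quadraticForm`). If `E` is semistable for `Z_t†`, its original HN factors have
decreasing slopes at `s = 0` and `q ≥ 0`. Let `s` move from `0` to `t`. Whenever two neighbouring
classes become aligned they are added, which keeps `q ≥ 0`; semistability at `t` rules out that two
or more classes remain strictly ordered. This wall-crossing is purely numerical
(`quadraticForm_sum_nonneg`), so no semistable objects at intermediate times are needed.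

Continuity: one `q` serves a whole interval of parameters, so `|Δ_I(E)| ≤ C |Z_s†(E)|` for all `E`
semistable at a nearby parameter (`exists_tilt_bound`). The phases of such objects therefore move
little, and since the heart is constant, the slicings are close
(`IsVeryWeakPreStability.interval_of_close`). -/

theorem distTriang_of_iso {X Y Z X' Y' Z' : D} {f : X ⟶ Y} {g : Y ⟶ Z} {h : Z ⟶ X⟦(1 : ℤ)⟧}
    (hT : Triangle.mk f g h ∈ distTriang D) (e₁ : X ≅ X') (e₂ : Y ≅ Y') (e₃ : Z ≅ Z')
    {f' : X' ⟶ Y'} {g' : Y' ⟶ Z'} {h' : Z' ⟶ X'⟦(1 : ℤ)⟧}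
    (c₁ : f ≫ e₂.hom = e₁.hom ≫ f') (c₂ : g ≫ e₃.hom = e₂.hom ≫ g')
    (c₃ : h ≫ e₁.hom⟦(1 : ℤ)⟧' = e₃.hom ≫ h') : Triangle.mk f' g' h' ∈ distTriang D :=
  isomorphic_distinguished _ hT _ (Triangle.isoMk _ _ e₁ e₂ e₃ c₁ c₂ c₃).symm

/-- The octahedral axiom read as the third isomorphism theorem: `W` plays the role of `Y / X'`. -/
theorem exists_octahedron [IsTriangulated D] {X Y Z X' X'' : D} {f : X ⟶ Y} {g : Y ⟶ Z}
    {h : Z ⟶ X⟦(1 : ℤ)⟧} (hT : Triangle.mk f g h ∈ distTriang D)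
    {f' : X' ⟶ X} {g' : X ⟶ X''} {h' : X'' ⟶ X'⟦(1 : ℤ)⟧}
    (hT' : Triangle.mk f' g' h' ∈ distTriang D) :
    ∃ (W : D) (p : Y ⟶ W) (δ : W ⟶ X'⟦(1 : ℤ)⟧) (a : X'' ⟶ W) (b : W ⟶ Z)
      (ε : Z ⟶ X''⟦(1 : ℤ)⟧), Triangle.mk (f' ≫ f) p δ ∈ distTriang D ∧
      Triangle.mk a b ε ∈ distTriang D ∧ g' ≫ a = f ≫ p ∧ p ≫ b = g := by
  obtain ⟨W, p, δ, hW⟩ := distinguished_cocone_triangle (f' ≫ f)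
  let o := Triangulated.someOctahedron rfl hT' hT hW
  exact ⟨W, p, δ, o.m₁, o.m₃, _, hW, o.mem, o.comm₁, o.comm₃⟩

/-- The dual reading: `W` plays the role of the preimage in `Y` of `Z' ⊂ Z`. -/
theorem exists_octahedron' [IsTriangulated D] {X Y Z Z' Z'' : D} {f : X ⟶ Y} {g : Y ⟶ Z}
    {h : Z ⟶ X⟦(1 : ℤ)⟧} (hT : Triangle.mk f g h ∈ distTriang D)
    {f' : Z' ⟶ Z} {g' : Z ⟶ Z''} {h' : Z'' ⟶ Z'⟦(1 : ℤ)⟧}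
    (hT' : Triangle.mk f' g' h' ∈ distTriang D) :
    ∃ (W : D) (i : W ⟶ Y) (δ : Z'' ⟶ W⟦(1 : ℤ)⟧) (a : X ⟶ W) (b : W ⟶ Z')
      (ε : Z' ⟶ X⟦(1 : ℤ)⟧), Triangle.mk i (g ≫ g') δ ∈ distTriang D ∧
      Triangle.mk a b ε ∈ distTriang D ∧ a ≫ i = f ∧ b ≫ f' = i ≫ g := by
  obtain ⟨W, i, δ, hW⟩ := distinguished_cocone_triangle₁ (g ≫ g')
  let o := Triangulated.someOctahedron' rfl hT hT' hW
  exact ⟨W, i, δ, o.m₁, o.m₃, _, hW, o.mem, o.comm₁, o.comm₄⟩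

theorem K0.of_triangle {X Y Z : D} {f : X ⟶ Y} {g : Y ⟶ Z} {h : Z ⟶ X⟦(1 : ℤ)⟧}
    (hT : Triangle.mk f g h ∈ distTriang D) : K0.of Y = K0.of X + K0.of Z := by
  have : (QuotientAddGroup.mk (FreeAbelianGroup.of Y - FreeAbelianGroup.of X -
      FreeAbelianGroup.of Z) : K0 D) = 0 :=
    (QuotientAddGroup.eq_zero_iff _).2 (AddSubgroup.subset_closure ⟨_, hT, rfl⟩)
  have h2 : K0.of Y - K0.of X - K0.of Z = 0 := this
  rw [← sub_eq_zero, ← h2]; abel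

theorem distTriang_of_hom_iso {X Y : D} (e : X ≅ Y) :
    Triangle.mk e.hom (0 : Y ⟶ (0 : D)) 0 ∈ distTriang D :=
  distTriang_of_iso (contractible_distinguished X) (Iso.refl _) e (Iso.refl _)
    (by simp) ((isZero_zero D).eq_of_tgt _ _) ((isZero_zero D).eq_of_src _ _)

theorem K0.of_isZero {X : D} (hX : IsZero X) : K0.of X = 0 := by
  have h0 := K0.of_triangle (contractible_distinguished (0 : D))
  have h1 := K0.of_triangle (distTriang_of_hom_iso hX.isoZero)
  have e0 : K0.of (0 : D) = 0 := by simpa using h0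
  rw [e0] at h1; simpa using h1.symm

theorem K0.of_iso {X Y : D} (e : X ≅ Y) : K0.of X = K0.of Y := by
  have h2 := K0.of_triangle (distTriang_of_hom_iso e)
  rw [K0.of_isZero (isZero_zero D), add_zero] at h2
  exact h2.symm

theorem K0.of_shift (X : D) : K0.of (X⟦(1 : ℤ)⟧) = -K0.of X := by
  have h := K0.of_triangle (rot_of_distTriang _ (contractible_distinguished X))
  have h' : K0.of (0 : D) = K0.of X + K0.of (X⟦(1 : ℤ)⟧) := h
  rw [K0.of_isZero (isZero_zero D)] at h'
  exact (neg_eq_of_add_eq_zero_right h'.symm).symm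

theorem shift_hom_eq_zero {X Y : D} {f : X ⟶ Y} (n : ℤ) (h : f⟦n⟧' = 0) : f = 0 :=
  (shiftFunctor D n).map_injective (by rw [h, Functor.map_zero])

variable {A : ObjectProperty D}

theorem IsBoundedHeart.of_iso (hA : IsBoundedHeart A) {X Y : D} (e : X ≅ Y) (hX : A X) : A Y := by
  obtain ⟨τ, -, rfl⟩ := hA
  exact τ.heart.prop_of_iso e hX

theorem IsBoundedHeart.of_isZero (hA : IsBoundedHeart A) {X : D} (hX : IsZero X) : A X := by
  obtain ⟨τ, -, rfl⟩ := hA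
  rw [τ.mem_heart_iff]
  exact ⟨τ.isLE_of_isZero hX 0, τ.isGE_of_isZero hX 0⟩

theorem IsBoundedHeart.ext (hA : IsBoundedHeart A) {X Y Z : D} {f : X ⟶ Y} {g : Y ⟶ Z}
    {h : Z ⟶ X⟦(1 : ℤ)⟧} (hT : Triangle.mk f g h ∈ distTriang D) (hX : A X) (hZ : A Z) : A Y := by
  obtain ⟨τ, -, rfl⟩ := hA
  rw [τ.mem_heart_iff] at *
  exact ⟨τ.isLE₂ _ hT 0 hX.1 hZ.1, τ.isGE₂ _ hT 0 hX.2 hZ.2⟩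

theorem IsBoundedHeart.hom_shift_zero (hA : IsBoundedHeart A) {X Y : D} (hX : A X) (hY : A Y)
    {n : ℤ} (hn : n < 0) (f : X ⟶ Y⟦n⟧) : f = 0 := by
  obtain ⟨τ, -, rfl⟩ := hA
  rw [τ.mem_heart_iff] at *
  have := hY.2
  exact τ.zero_of_isLE_of_isGE f 0 (-n) (by lia) hX.1 (τ.isGE_shift Y 0 n (-n))

/-- The cone of a map in the heart has cohomology only in degrees `-1` and `0`. Its truncation
triangle exhibits it as built from `K'` and `Q`, where `K'[-1]` is the kernel and `Q` the cokernel
of the map. -/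
theorem IsBoundedHeart.admissible (hA : IsBoundedHeart A) :
    Triangulated.AbelianSubcategory.admissibleMorphism A.ι = ⊤ := by
  obtain ⟨τ, -, rfl⟩ := hA
  rw [eq_top_iff]
  intro X₁ X₂ f₁ _ X₃ f₂ f₃ hT
  have h1 := (τ.mem_heart_iff _).1 X₁.property
  have h2 := (τ.mem_heart_iff _).1 X₂.property
  have := h1.1
  have := h1.2
  have h3 : τ.IsLE X₃ 0 ∧ τ.IsGE X₃ (-1) := by
    refine ⟨τ.isLE₂ _ (rot_of_distTriang _ hT) 0 h2.1 ?_,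
      τ.isGE₂ _ (rot_of_distTriang _ hT) (-1) ?_ ?_⟩
    · have := τ.isLE_shift X₁.obj 0 1 (-1)
      exact τ.isLE_of_le (X₁.obj⟦(1 : ℤ)⟧) (-1) 0
    · have := h2.2
      exact τ.isGE_of_ge X₂.obj (-1) 0
    · exact τ.isGE_shift X₁.obj 0 1 (-1)
  obtain ⟨K', Q, hK', hQ, α, β, γ, hT'⟩ := τ.exists_triangle X₃ (-1) 0 (by lia)
  rw [τ.le_iff_isLE] at hK'
  rw [τ.ge_iff_isGE] at hQ
  have hQ' : τ.IsLE Q 0 := by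
    refine τ.isLE₂ _ (rot_of_distTriang _ hT') 0 h3.1 ?_
    have := τ.isLE_shift K' (-1) 1 (-2)
    exact τ.isLE_of_le (K'⟦(1 : ℤ)⟧) (-2) 0
  have hK'' : τ.IsGE K' (-1) := by
    refine τ.isGE₂ _ (inv_rot_of_distTriang _ hT') (-1) ?_ h3.2
    have := τ.isGE_shift Q 0 (-1) 1
    exact τ.isGE_of_ge (Q⟦(-1 : ℤ)⟧) (-1) 1
  let e : K'⟦(-1 : ℤ)⟧⟦(1 : ℤ)⟧ ≅ K' := shiftNegShift K' 1
  refine ⟨⟨K'⟦(-1 : ℤ)⟧, (τ.mem_heart_iff _).2 ⟨τ.isLE_shift K' (-1) (-1) 0,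
    τ.isGE_shift K' (-1) (-1) 0⟩⟩, ⟨Q, (τ.mem_heart_iff _).2 ⟨hQ', hQ⟩⟩,
    e.hom ≫ α, β, γ ≫ e.inv⟦(1 : ℤ)⟧', ?_⟩
  exact distTriang_of_iso hT' e.symm (Iso.refl _) (Iso.refl _) (by simp) (by simp) (by simp)

theorem IsBoundedHeart.hasFiniteProducts (hA : IsBoundedHeart A) :
    HasFiniteProducts A.FullSubcategory := by
  have : A.ContainsZero := ⟨0, isZero_zero D, hA.of_isZero (isZero_zero D)⟩
  have : HasZeroObject A.FullSubcategory := inferInstance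
  have : A.IsClosedUnderBinaryProducts := ⟨by
    rintro X ⟨p⟩
    refine hA.of_iso ?_ (hA.ext (binaryProductTriangle_distinguished _ _)
      (p.prop_diag_obj (.mk .left)) (p.prop_diag_obj (.mk .right)))
    exact IsLimit.conePointUniqueUpToIso (prodIsProd _ _)
      ((IsLimit.postcomposeHomEquiv (diagramIsoPair p.diag) _).2 p.isLimit)⟩
  exact hasFiniteProducts_of_has_binary_and_terminal (C := A.FullSubcategory)

/-- The abelian category structure on the heart of a bounded t-structure. -/
@[reducible]
noncomputable def IsBoundedHeart.abelian [IsTriangulated D] (hA : IsBoundedHeart A) :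
    Abelian A.FullSubcategory :=
  letI := hA.hasFiniteProducts
  Triangulated.AbelianSubcategory.abelian A.ι
    (fun X Y _ f hn => hA.hom_shift_zero X.property Y.property hn f) hA.admissible

theorem IsBoundedHeart.shortExact_of_triangle [IsTriangulated D] (hA : IsBoundedHeart A)
    {X Y Z : A.FullSubcategory} (f : X ⟶ Y) (g : Y ⟶ Z) (h : Z.obj ⟶ X.obj⟦(1 : ℤ)⟧)
    (hT : Triangle.mk f.hom g.hom h ∈ distTriang D) :
    ∃ w : f ≫ g = 0, (ShortComplex.mk f g w).ShortExact := by
  letI := hA.abelian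
  have hι : ∀ ⦃X Y : A.FullSubcategory⦄ ⦃n : ℤ⦄ (f : A.ι.obj X ⟶ (A.ι.obj Y)⟦n⟧), n < 0 → f = 0 :=
    fun X Y n f hn => hA.hom_shift_zero X.property Y.property hn f
  have w : f ≫ g = 0 := ObjectProperty.hom_ext _ (comp_distTriang_mor_zero₁₂ _ hT)
  have hk := Triangulated.AbelianSubcategory.isLimitKernelForkOfDistTriang hι f g h hT
  have hc := Triangulated.AbelianSubcategory.isColimitCokernelCoforkOfDistTriang hι f g h hT
  have : Mono f := mono_of_isLimit_fork hk
  have : Epi g := epi_of_isColimit_cofork hc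
  exact ⟨w, ⟨ShortComplex.exact_of_f_is_kernel _ hk⟩⟩

/-- The epimorphism `S.g` sits in a triangle whose first vertex lies in the heart. That vertex is a
kernel of `S.g`, and so is `S.X₁`. -/
theorem IsBoundedHeart.triangle_of_shortExact [IsTriangulated D] (hA : IsBoundedHeart A)
    {S : ShortComplex A.FullSubcategory} (hS : S.ShortExact) :
    ∃ h : S.X₃.obj ⟶ S.X₁.obj⟦(1 : ℤ)⟧, Triangle.mk S.f.hom S.g.hom h ∈ distTriang D := by
  letI := hA.abelian
  have hι : ∀ ⦃X Y : A.FullSubcategory⦄ ⦃n : ℤ⦄ (f : A.ι.obj X ⟶ (A.ι.obj Y)⟦n⟧), n < 0 → f = 0 :=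
    fun X Y n f hn => hA.hom_shift_zero X.property Y.property hn f
  have := hS.epi_g
  obtain ⟨X₁, i, δ, hT⟩ := Triangulated.AbelianSubcategory.exists_distinguished_triangle_of_epi
    hι hA.admissible S.g
  have hk := Triangulated.AbelianSubcategory.isLimitKernelForkOfDistTriang hι i S.g δ hT
  have hk' := hS.fIsKernel
  let e : X₁ ≅ S.X₁ := IsLimit.conePointUniqueUpToIso hk hk'
  have he : e.hom ≫ S.f = i := IsLimit.conePointUniqueUpToIso_hom_comp hk hk' .zero
  refine ⟨δ ≫ (A.ι.mapIso e).hom⟦(1 : ℤ)⟧', distTriang_of_iso hT (A.ι.mapIso e) (Iso.refl _)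
    (Iso.refl _) ?_ ?_ ?_⟩
  · rw [← he]; exact (Category.comp_id _)
  · exact (Category.comp_id _).trans (Category.id_comp _).symm
  · exact (Category.id_comp _).symm

end Heart

/-! ### Short exact sequences in an abelian category. -/

section ShortExactSequences

/-- `0 → X → Y → Z → 0` is a short exact sequence. -/
def IsSES {𝒜 : Type u} [Category.{v} 𝒜] [HasZeroMorphisms 𝒜] {X Y Z : 𝒜} (i : X ⟶ Y)
    (p : Y ⟶ Z) : Prop :=
  ∃ w : i ≫ p = 0, (ShortComplex.mk i p w).ShortExact

/-- `Y` is an extension of `Z` by `X`. -/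
def HasSES {𝒜 : Type u} [Category.{v} 𝒜] [HasZeroMorphisms 𝒜] (X Y Z : 𝒜) : Prop :=
  ∃ (i : X ⟶ Y) (p : Y ⟶ Z), IsSES i p

variable {𝒜 : Type u} [Category.{v} 𝒜] [Abelian 𝒜] {X Y Z : 𝒜} {i : X ⟶ Y} {p : Y ⟶ Z}

theorem IsSES.mono (h : IsSES i p) : Mono i := h.2.mono_f

theorem IsSES.epi (h : IsSES i p) : Epi p := h.2.epi_g

theorem IsSES.exists_lift (h : IsSES i p) {T : 𝒜} (k : T ⟶ Y) (hk : k ≫ p = 0) :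
    ∃ l, l ≫ i = k :=
  let ⟨l, hl⟩ := KernelFork.IsLimit.lift' h.2.fIsKernel k hk
  ⟨l, hl⟩

theorem IsSES.exists_desc (h : IsSES i p) {T : 𝒜} (k : Y ⟶ T) (hk : i ≫ k = 0) :
    ∃ l, p ≫ l = k :=
  let ⟨l, hl⟩ := CokernelCofork.IsColimit.desc' h.2.gIsCokernel k hk
  ⟨l, hl⟩

theorem IsSES.of_mono (i : X ⟶ Y) [Mono i] : IsSES i (cokernel.π i) :=
  ⟨cokernel.condition i, ⟨ShortComplex.exact_cokernel i⟩⟩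

theorem IsSES.of_epi (p : X ⟶ Y) [Epi p] : IsSES (kernel.ι p) p :=
  ⟨kernel.condition p, ⟨ShortComplex.exact_kernel p⟩⟩

theorem IsSES.of_id (X : 𝒜) {Z : 𝒜} (hZ : IsZero Z) (p : X ⟶ Z) : IsSES (𝟙 X) p := by
  have : Epi p := hZ.epi p
  refine ⟨hZ.eq_of_tgt _ _, ⟨?_⟩⟩
  rw [ShortComplex.exact_iff_epi _ (hZ.eq_of_tgt _ _)]
  dsimp; infer_instance

theorem IsSES.isIso_of_isZero_left (h : IsSES i p) (hX : IsZero X) : IsIso p := by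
  have := h.epi
  have : Mono p := by
    rw [Preadditive.mono_iff_cancel_zero]
    intro T k hk
    obtain ⟨l, rfl⟩ := h.exists_lift k hk
    rw [hX.eq_of_tgt l 0, zero_comp]
  exact isIso_of_mono_of_epi p

/-- If `X' ⊂ X ⊂ Y`, then `0 → X/X' → Y/X' → Y/X → 0` is exact. -/
theorem IsSES.quotient (h : IsSES i p) {X' X'' : 𝒜} {i' : X' ⟶ X} {p' : X ⟶ X''}
    (h' : IsSES i' p') : ∃ (V : 𝒜) (π : Y ⟶ V) (a : X'' ⟶ V) (b : V ⟶ Z),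
      IsSES (i' ≫ i) π ∧ IsSES a b ∧ p' ≫ a = i ≫ π ∧ π ≫ b = p := by
  have := h.mono
  have := h.epi
  have := h'.mono
  have := h'.epi
  obtain ⟨a, ha⟩ := h'.exists_desc (i ≫ cokernel.π (i' ≫ i)) (by
    rw [← Category.assoc, cokernel.condition])
  obtain ⟨b, hb⟩ := (IsSES.of_mono (i' ≫ i)).exists_desc p (by
    rw [Category.assoc, h.1, comp_zero])
  refine ⟨_, _, a, b, IsSES.of_mono (i' ≫ i), ?_, ha, hb⟩
  have hab : a ≫ b = 0 := by
    rw [← cancel_epi p', ← Category.assoc, ha, Category.assoc, hb, h.1, comp_zero]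
  have : Epi b := by
    have : Epi (cokernel.π (i' ≫ i) ≫ b) := hb ▸ h.epi
    exact epi_of_epi (cokernel.π (i' ≫ i)) b
  have : Mono a := by
    rw [Preadditive.mono_iff_cancel_zero]
    intro T k hk
    obtain ⟨T', π, _, y, hy⟩ := surjective_up_to_refinements_of_epi p' k
    obtain ⟨l, hl⟩ := (IsSES.of_mono (i' ≫ i)).exists_lift (y ≫ i) (by
      rw [Category.assoc, ← ha, ← Category.assoc, ← hy, Category.assoc, hk, comp_zero])
    rw [← Category.assoc, cancel_mono] at hl
    rw [← cancel_epi π, hy, ← hl, Category.assoc, h'.1]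
    simp
  refine ⟨hab, ⟨?_⟩⟩
  rw [ShortComplex.exact_iff_exact_up_to_refinements]
  intro T k hk
  obtain ⟨T', π, _, y, hy⟩ := surjective_up_to_refinements_of_epi (cokernel.π (i' ≫ i)) k
  obtain ⟨l, hl⟩ := h.exists_lift y (by
    rw [← hb, ← Category.assoc, ← hy, Category.assoc]; dsimp at hk; rw [hk, comp_zero])
  refine ⟨T', π, inferInstance, l ≫ p', ?_⟩
  dsimp
  rw [hy, Category.assoc, ha, ← Category.assoc, hl]

end ShortExactSequences

/-! ### Weak central charges, slopes and semistability. -/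

section WeakCentralCharge

/-- The slope `-Re z / Im z`, with value `∞` when `Im z = 0`. -/
noncomputable def cslope (z : ℂ) : WithTop ℝ :=
  if z.im = 0 then ⊤ else ((-z.re / z.im : ℝ) : WithTop ℝ)

/-- The values allowed for a weak central charge. -/
def InUpper (z : ℂ) : Prop := 0 < z.im ∨ (z.im = 0 ∧ z.re ≤ 0)

theorem InUpper.im_nonneg {z : ℂ} (h : InUpper z) : 0 ≤ z.im := by
  rcases h with h | h
  · exact h.le
  · exact h.1.ge

theorem InUpper.re_nonpos {z : ℂ} (h : InUpper z) (h0 : z.im = 0) : z.re ≤ 0 := by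
  rcases h with h | h
  · exact absurd h0 h.ne'
  · exact h.2

theorem cslope_eq_top {z : ℂ} : cslope z = ⊤ ↔ z.im = 0 := by
  unfold cslope
  split_ifs with h <;> simp [h]

theorem cslope_of_im_ne {z : ℂ} (h : z.im ≠ 0) : cslope z = ((-z.re / z.im : ℝ) : WithTop ℝ) :=
  if_neg h

/-- Turns slope bounds into linear conditions, which add up in exact sequences. For `Im z = 0` the
condition reduces to `Re z ≤ 0`, which holds for admissible values. -/
theorem le_cslope_iff {z : ℂ} (hz : InUpper z) (a : ℝ) :
    (a : WithTop ℝ) ≤ cslope z ↔ z.re + a * z.im ≤ 0 := by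
  by_cases h : z.im = 0
  · simp [cslope_eq_top.2 h, h, hz.re_nonpos h]
  · have h' := lt_of_le_of_ne hz.im_nonneg (Ne.symm h)
    rw [cslope_of_im_ne h, WithTop.coe_le_coe, le_div_iff₀ h']
    constructor <;> intro <;> linarith

theorem cslope_le_iff {z : ℂ} (hz : InUpper z) (a : ℝ) :
    cslope z ≤ (a : WithTop ℝ) ↔ z.im ≠ 0 ∧ 0 ≤ z.re + a * z.im := by
  by_cases h : z.im = 0
  · simp [cslope_eq_top.2 h, h]
  · have h' := lt_of_le_of_ne hz.im_nonneg (Ne.symm h)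
    rw [cslope_of_im_ne h, WithTop.coe_le_coe, div_le_iff₀ h']
    simp only [ne_eq, h, not_false_eq_true, true_and]
    constructor <;> intro <;> linarith

theorem cslope_le_cslope_iff {z w : ℂ} (hz : 0 < z.im) (hw : 0 < w.im) :
    cslope z ≤ cslope w ↔ w.re * z.im ≤ z.re * w.im := by
  rw [cslope_of_im_ne hz.ne', cslope_of_im_ne hw.ne', WithTop.coe_le_coe, div_le_div_iff₀ hz hw]
  constructor <;> intro <;> linarith

variable {𝒜 : Type u} [Category.{v} 𝒜]

/-- Slope semistability with respect to `W`. -/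
def SS [HasZeroMorphisms 𝒜] (W : 𝒜 → ℂ) (E : 𝒜) : Prop :=
  ∀ (F G : 𝒜) (i : F ⟶ E) (p : E ⟶ G) (w : i ≫ p = 0),
    (ShortComplex.mk i p w).ShortExact → ¬ IsZero F → cslope (W F) ≤ cslope (W G)

theorem SS.of_iso [HasZeroMorphisms 𝒜] {W : 𝒜 → ℂ} {E E' : 𝒜} (e : E ≅ E') (hE : SS W E) :
    SS W E' := by
  intro F G i p w h
  exact hE F G (i ≫ e.inv) (e.hom ≫ p) (by simp [w]) (ShortComplex.shortExact_of_iso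
    (S₁ := ShortComplex.mk i p w) (S₂ := ShortComplex.mk (i ≫ e.inv) (e.hom ≫ p) (by simp [w]))
    (ShortComplex.isoMk (Iso.refl F) e.symm (Iso.refl G) (by simp) (by simp)) h)

/-- `W` is additive on short exact sequences with values in the closed upper half plane without
the positive real axis. -/
structure IsWeakCharge [HasZeroMorphisms 𝒜] (W : 𝒜 → ℂ) : Prop where
  add : ∀ {X Y Z : 𝒜} {i : X ⟶ Y} {p : Y ⟶ Z}, IsSES i p → W Y = W X + W Z
  upper : ∀ E, InUpper (W E)

variable [Abelian 𝒜] {W : 𝒜 → ℂ} (hW : IsWeakCharge W)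
include hW

theorem IsWeakCharge.zero {X : 𝒜} (hX : IsZero X) : W X = 0 := by
  simpa using hW.add (IsSES.of_id X hX (𝟙 X))

theorem IsWeakCharge.iso {X Y : 𝒜} (e : X ≅ Y) : W X = W Y := by
  have h := hW.add (IsSES.of_epi e.hom)
  rwa [hW.zero (isZero_kernel_of_mono e.hom), zero_add] at h

theorem IsWeakCharge.im_le_of_mono {X Y : 𝒜} (i : X ⟶ Y) [Mono i] : (W X).im ≤ (W Y).im := by
  rw [hW.add (IsSES.of_mono i), Complex.add_im]
  linarith [(hW.upper (cokernel i)).im_nonneg]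

theorem IsWeakCharge.im_le_of_epi {X Y : 𝒜} (p : X ⟶ Y) [Epi p] : (W Y).im ≤ (W X).im := by
  rw [hW.add (IsSES.of_epi p), Complex.add_im]
  linarith [(hW.upper (kernel p)).im_nonneg]

/-- See-saw: semistability bounds the slope of the kernel by that of `G`, and the slope of `E` lies
between the two. -/
theorem SS.le_of_epi {E G : 𝒜} (hE : SS W E) (p : E ⟶ G) [Epi p] :
    cslope (W E) ≤ cslope (W G) := by
  by_cases hK : IsZero (kernel p)
  · have := (IsSES.of_epi p).isIso_of_isZero_left hK
    rw [hW.iso (asIso p)]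
  · have h := hE _ _ _ _ _ (IsSES.of_epi p).2 hK
    have hadd := hW.add (IsSES.of_epi p)
    by_cases hG : (W G).im = 0
    · rw [cslope_eq_top.2 hG]; exact le_top
    · have hG' := lt_of_le_of_ne (hW.upper G).im_nonneg (Ne.symm hG)
      have hK' : 0 < (W (kernel p)).im := by
        refine lt_of_le_of_ne (hW.upper _).im_nonneg fun h0 => ?_
        rw [cslope_eq_top.2 h0.symm, top_le_iff, cslope_eq_top] at h
        exact hG h
      rw [cslope_le_cslope_iff hK' hG'] at h
      rw [hadd, cslope_le_cslope_iff (by simp; linarith) hG']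
      simp; linarith

theorem SS.le_of_mono {E F : 𝒜} (hE : SS W E) (i : F ⟶ E) [Mono i] (hF : ¬ IsZero F) :
    cslope (W F) ≤ cslope (W E) := by
  have h := hE _ _ _ _ _ (IsSES.of_mono i).2 hF
  have hadd := hW.add (IsSES.of_mono i)
  by_cases hG : (W F).im = 0
  · rw [cslope_eq_top.2 hG, top_le_iff, cslope_eq_top] at h
    rw [(cslope_eq_top (z := W E)).2 (by simp [hadd, hG, h])]
    exact le_top
  · have hG' := lt_of_le_of_ne (hW.upper F).im_nonneg (Ne.symm hG)
    by_cases h0 : (W (cokernel i)).im = 0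
    · have := (hW.upper (cokernel i)).re_nonpos h0
      rw [hadd, cslope_le_cslope_iff hG' (by simp [h0, hG'])]
      simp [h0]; nlinarith
    · have hK' := lt_of_le_of_ne (hW.upper (cokernel i)).im_nonneg (Ne.symm h0)
      rw [cslope_le_cslope_iff hG' hK'] at h
      rw [hadd, cslope_le_cslope_iff hG' (by simp; linarith)]
      simp; linarith

theorem SS.hom_eq_zero {E F : 𝒜} (hE : SS W E) (hF : SS W F)
    (h : cslope (W F) < cslope (W E)) (f : E ⟶ F) : f = 0 := by
  by_contra hf
  have h1 := SS.le_of_epi hW hE (Abelian.factorThruImage f)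
  have h2 := SS.le_of_mono hW hF (Abelian.image.ι f) (fun h0 => hf (by
    rw [← Abelian.image.fac f, h0.eq_of_tgt (Abelian.factorThruImage f) 0, zero_comp]))
  exact absurd (h1.trans h2) (not_le.2 h)

theorem SS.of_im_eq_zero {E : 𝒜} (hE : (W E).im = 0) : SS W E := by
  intro F G i p w h _
  have hadd := hW.add ⟨w, h⟩
  have h1 := (hW.upper F).im_nonneg
  have h2 := (hW.upper G).im_nonneg
  rw [hadd, Complex.add_im] at hE
  rw [(cslope_eq_top (z := W G)).2 (by linarith)]
  exact le_top

/-- No nonzero maps from objects with `Im W = 0`. -/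
def TorsionFree (W : 𝒜 → ℂ) (E : 𝒜) : Prop := ∀ X : 𝒜, (W X).im = 0 → ∀ f : X ⟶ E, f = 0

theorem SS.torsionFree {E : 𝒜} (hE : SS W E) (h : cslope (W E) ≠ ⊤) : TorsionFree W E :=
  fun X hX f => SS.hom_eq_zero hW (SS.of_im_eq_zero hW hX) hE
    (by rw [cslope_eq_top.2 hX]; exact lt_top_iff_ne_top.2 h) f

omit hW in
theorem TorsionFree.im_pos (hW : IsWeakCharge W) {E F : 𝒜} (hE : TorsionFree W E) (i : F ⟶ E)
    [Mono i] (hF : ¬ IsZero F) : 0 < (W F).im := by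
  refine lt_of_le_of_ne (hW.upper _).im_nonneg fun h0 => hF ?_
  rw [IsZero.iff_id_eq_zero, ← cancel_mono i, hE F h0.symm i]; simp

/-- All quotients of `E` have slope at least `a`. -/
def SlopesGE (W : 𝒜 → ℂ) (a : ℝ) (E : 𝒜) : Prop :=
  ∀ (G : 𝒜) (p : E ⟶ G) [Epi p], (W G).re + a * (W G).im ≤ 0

omit hW in
theorem SlopesGE.of_epi {a : ℝ} {E G : 𝒜} (hE : SlopesGE W a E) (p : E ⟶ G) [Epi p] :
    SlopesGE W a G := fun G' p' _ => hE G' (p ≫ p')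

theorem SlopesGE.ext {a : ℝ} {X Y Z : 𝒜} {i : X ⟶ Y} {p : Y ⟶ Z} (h : IsSES i p)
    (hX : SlopesGE W a X) (hZ : SlopesGE W a Z) : SlopesGE W a Y := by
  intro G q _
  let I := Abelian.image (i ≫ q)
  obtain ⟨l, hl⟩ := h.exists_desc (q ≫ cokernel.π (Abelian.image.ι (i ≫ q))) (by
    rw [← Category.assoc, ← Abelian.image.fac (i ≫ q), Category.assoc, Abelian.image.fac]
    simp)
  have : Epi (p ≫ l) := hl ▸ inferInstance
  have : Epi l := epi_of_epi p l
  have h1 := hX _ (Abelian.factorThruImage (i ≫ q))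
  have h2 := hZ _ l
  have hadd := hW.add (IsSES.of_mono (Abelian.image.ι (i ≫ q)))
  rw [hadd, Complex.add_re, Complex.add_im]
  linarith

theorem SlopesGE.of_im_eq_zero (a : ℝ) {E : 𝒜} (hE : (W E).im = 0) : SlopesGE W a E := by
  intro G p _
  have h := hW.im_le_of_epi p
  have h0 : (W G).im = 0 := le_antisymm (h.trans_eq hE) (hW.upper G).im_nonneg
  rw [h0, mul_zero, add_zero]
  exact (hW.upper G).re_nonpos h0

theorem SlopesGE.of_ss {a : ℝ} {E : 𝒜} (hE : SS W E) (h : (a : WithTop ℝ) ≤ cslope (W E)) :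
    SlopesGE W a E := fun G p _ =>
  (le_cslope_iff (hW.upper G) a).1 (h.trans (SS.le_of_epi hW hE p))

theorem TorsionFree.ext {X Y Z : 𝒜} {i : X ⟶ Y} {p : Y ⟶ Z} (h : IsSES i p)
    (hX : TorsionFree W X) (hZ : TorsionFree W Z) : TorsionFree W Y := by
  intro T hT f
  obtain ⟨l, rfl⟩ := h.exists_lift f (hZ T hT _)
  rw [hX T hT l, zero_comp]

/-- With `W F = W V - W G`, the bound for the quotient `G` becomes the opposite bound for the
subobject `F`. Torsion-freeness is needed to make the slope of `F` finite. -/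
theorem SS.of_slopesGE {a : ℝ} {V : 𝒜} (htf : TorsionFree W V) (hVa : SlopesGE W a V)
    (ha : cslope (W V) = a) : SS W V := by
  intro F G i q w h hF
  by_cases hG : (W G).im = 0
  · rw [cslope_eq_top.2 hG]; exact le_top
  have hq := h.epi_g
  have hi := h.mono_f
  have haddF := hW.add ⟨w, h⟩
  have hVa' := (cslope_le_iff (hW.upper V) a).1 ha.le
  have hle : cslope (W F) ≤ a := by
    refine (cslope_le_iff (hW.upper F) a).2 ⟨(htf.im_pos hW i hF).ne', ?_⟩
    have := hVa'.2
    rw [haddF, Complex.add_re, Complex.add_im] at this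
    linarith [hVa G q]
  exact hle.trans ((le_cslope_iff (hW.upper G) a).2 (hVa G q))

/-- Extensions of semistable objects of the same slope are semistable. -/
theorem SS.ext {X Y Z : 𝒜} {i : X ⟶ Y} {p : Y ⟶ Z} (h : IsSES i p) (hX : SS W X) (hZ : SS W Z)
    {s : WithTop ℝ} (hXs : cslope (W X) = s) (hZs : cslope (W Z) = s) :
    SS W Y ∧ cslope (W Y) = s := by
  have hadd := hW.add h
  induction s with
  | top =>
    rw [cslope_eq_top] at *
    have : (W Y).im = 0 := by rw [hadd, Complex.add_im, hXs, hZs, add_zero]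
    exact ⟨SS.of_im_eq_zero hW this, this⟩
  | coe a =>
    have e1 := (cslope_le_iff (hW.upper X) a).1 hXs.le
    have e2 := (cslope_le_iff (hW.upper Z) a).1 hZs.le
    have hY : SlopesGE W a Y :=
      SlopesGE.ext hW h (SlopesGE.of_ss hW hX hXs.ge) (SlopesGE.of_ss hW hZ hZs.ge)
    have hYa : cslope (W Y) = a := by
      refine le_antisymm ((cslope_le_iff (hW.upper Y) a).2 ⟨?_, ?_⟩)
        ((le_cslope_iff (hW.upper Y) a).2 (hY Y (𝟙 Y)))
      · have h1 := (hW.upper X).im_nonneg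
        have h2 := (hW.upper Z).im_nonneg
        have h3 := lt_of_le_of_ne h1 (Ne.symm e1.1)
        rw [hadd, Complex.add_im]; linarith
      · rw [hadd, Complex.add_re, Complex.add_im]; linarith [e1.2, e2.2]
    exact ⟨SS.of_slopesGE hW (TorsionFree.ext hW h (SS.torsionFree hW hX (by simp [hXs]))
      (SS.torsionFree hW hZ (by simp [hZs]))) hY hYa, hYa⟩

/-- Every torsion free object that is not semistable has a destabilizing semistable subobject. -/
theorem exists_semistable_destabilizing {c : ℝ} (hc : 0 < c)
    (hd : ∀ E, ∃ n : ℕ, (W E).im = c * n) {E : 𝒜} (hE : TorsionFree W E) (hss : ¬ SS W E) :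
    ∃ (F G : 𝒜) (i : F ⟶ E) (p : E ⟶ G), IsSES i p ∧ ¬ IsZero F ∧ SS W F ∧
      cslope (W G) < cslope (W F) := by
  classical
  -- A destabilizing subobject with minimal `Im W` is semistable: a subobject destabilizing it would
  -- also destabilize `E`, with smaller `Im W`.
  let P : ℕ → Prop := fun n => ∃ (F G : 𝒜) (i : F ⟶ E) (p : E ⟶ G), IsSES i p ∧ ¬ IsZero F ∧
      cslope (W G) < cslope (W F) ∧ (W F).im = c * n
  have hP : ∃ n, P n := by
    simp only [SS, not_forall, not_le] at hss
    obtain ⟨F, G, i, p, w, h, hF, hlt⟩ := hss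
    obtain ⟨n, hn⟩ := hd F
    exact ⟨n, F, G, i, p, ⟨w, h⟩, hF, hlt, hn⟩
  obtain ⟨F, G, i, p, h, hF, hlt, hn⟩ := Nat.find_spec hP
  refine ⟨F, G, i, p, h, hF, ?_, hlt⟩
  by_contra hFss
  simp only [SS, not_forall, not_le] at hFss
  obtain ⟨F', G', i', p', w', h', hF', hlt'⟩ := hFss
  have := h.mono
  have := h'.mono_f
  have hF'E := hE.im_pos hW (i' ≫ i) hF'
  have hFE := hE.im_pos hW i hF
  have hadd := hW.add h
  have hadd' := hW.add ⟨w', h'⟩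
  have hadd'' := hW.add (IsSES.of_mono (i' ≫ i))
  have hG : 0 < (W G).im := lt_of_le_of_ne (hW.upper _).im_nonneg fun h0 => by
    rw [cslope_eq_top.2 h0.symm] at hlt; exact absurd hlt not_top_lt
  have hG' : 0 < (W G').im := lt_of_le_of_ne (hW.upper _).im_nonneg fun h0 => by
    rw [cslope_eq_top.2 h0.symm] at hlt'; exact absurd hlt' not_top_lt
  obtain ⟨n', hn'⟩ := hd F'
  have hlt2 : n' < Nat.find hP := by
    have : c * n' < c * Nat.find hP := by
      rw [← hn, ← hn', hadd', Complex.add_im]; linarith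
    exact_mod_cast lt_of_mul_lt_mul_left this hc.le
  refine Nat.find_min hP hlt2 ⟨F', _, i' ≫ i, _, IsSES.of_mono _, hF', ?_, hn'⟩
  have e : W (cokernel (i' ≫ i)) = W G' + W G := by
    have : W F' + W G' + W G = W F' + W (cokernel (i' ≫ i)) := by rw [← hadd', ← hadd, hadd'']
    linear_combination -this
  have hC : 0 < (W (cokernel (i' ≫ i))).im := by rw [e, Complex.add_im]; linarith
  rw [← not_le, cslope_le_cslope_iff hF'E hC]
  rw [← not_le, cslope_le_cslope_iff hFE hG] at hlt
  rw [← not_le, cslope_le_cslope_iff hF'E hG'] at hlt'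
  rw [e]
  rw [hadd'] at hlt hFE
  simp only [Complex.add_re, Complex.add_im, not_le] at hlt hlt' hFE ⊢
  nlinarith
  
end WeakCentralCharge

/-! ### Existence of HN filtrations for discrete imaginary part. -/

section HarderNarasimhan

variable {𝒜 : Type u} [Category.{v} 𝒜] [Abelian 𝒜] {W : 𝒜 → ℂ} (hW : IsWeakCharge W)

include hW in
/-- Existence of a semistable quotient of minimal slope. -/
theorem exists_minimal_slope_quotient {c : ℝ} (hc : 0 < c)
    (hd : ∀ E, ∃ n : ℕ, (W E).im = c * n)
    (hrad : ∀ E : 𝒜, ∃ (L Q : 𝒜) (i : L ⟶ E) (p : E ⟶ Q), IsSES i p ∧ (W L).im = 0 ∧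
      TorsionFree W Q) (n : ℕ) :
    ∀ E : 𝒜, (W E).im = c * n → 0 < (W E).im → ∃ (Q : 𝒜) (p : E ⟶ Q) (a : ℝ), Epi p ∧ SS W Q ∧
      cslope (W Q) = a ∧ SlopesGE W a E := by
  induction n using Nat.strong_induction_on with
  | _ n ih =>
    intro E hn hpos
    obtain ⟨L, E₁, i, p, h, hL, hE₁⟩ := hrad E
    have := h.epi
    have hadd := hW.add h
    have him : (W E₁).im = (W E).im := by rw [hadd, Complex.add_im, hL, zero_add]
    -- All quotients of the torsion part `L` have `Im W = 0`, so `L` never lowers the slope of a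
    -- quotient.
    suffices ∃ (Q : 𝒜) (p : E₁ ⟶ Q) (a : ℝ), Epi p ∧ SS W Q ∧ cslope (W Q) = a ∧
        SlopesGE W a E₁ by
      obtain ⟨Q, q, a, _, hQ, ha, hE⟩ := this
      exact ⟨Q, p ≫ q, a, inferInstance, hQ, ha,
        SlopesGE.ext hW h (SlopesGE.of_im_eq_zero hW a hL) hE⟩
    by_cases hss : SS W E₁
    · have e := cslope_of_im_ne (z := W E₁) (by rw [him]; exact hpos.ne')
      exact ⟨E₁, 𝟙 E₁, _, inferInstance, hss, e, SlopesGE.of_ss hW hss e.ge⟩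
    · obtain ⟨F, G, j, q, hs, hF0, hF, hlt⟩ := exists_semistable_destabilizing hW hc hd hE₁ hss
      have := hs.mono
      have := hs.epi
      have hFpos := hE₁.im_pos hW j hF0
      have hGpos : 0 < (W G).im := lt_of_le_of_ne (hW.upper _).im_nonneg fun h0 => by
        rw [cslope_eq_top.2 h0.symm] at hlt; exact absurd hlt not_top_lt
      obtain ⟨m, hm⟩ := hd G
      have hmn : m < n := by
        have : c * m < c * n := by
          rw [← hm, ← hn, ← him, hW.add hs, Complex.add_im]; linarith
        exact_mod_cast lt_of_mul_lt_mul_left this hc.le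
      -- `G` has smaller `Im W`. Its quotient of minimal slope also works for `E₁`, because the
      -- slope of `F` exceeds that of `G`, which is at least `a`.
      obtain ⟨Q, r, a, _, hQ, ha, hG⟩ := ih m hmn G hm hGpos
      refine ⟨Q, q ≫ r, a, inferInstance, hQ, ha, SlopesGE.ext hW hs (SlopesGE.of_ss hW hF ?_) hG⟩
      have : (a : WithTop ℝ) ≤ cslope (W G) := (le_cslope_iff (hW.upper G) a).2 (hG G (𝟙 G))
      exact this.trans hlt.le

/-- Objects with a Harder-Narasimhan filtration whose smallest slope is given. -/
inductive HNTower (W : 𝒜 → ℂ) : 𝒜 → WithTop ℝ → Prop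
  | base (E : 𝒜) (hE : SS W E) (h0 : ¬ IsZero E) : HNTower W E (cslope (W E))
  | step {K E Q : 𝒜} (i : K ⟶ E) (p : E ⟶ Q) (h : IsSES i p) {b : WithTop ℝ}
      (hK : HNTower W K b) (hQ : SS W Q) (h0 : ¬ IsZero Q) (hb : cslope (W Q) < b) :
      HNTower W E (cslope (W Q))

theorem HNTower.exists_last {E : 𝒜} {b : WithTop ℝ} (h : HNTower W E b) :
    ∃ (Q : 𝒜) (p : E ⟶ Q), Epi p ∧ SS W Q ∧ ¬ IsZero Q ∧ cslope (W Q) = b := by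
  induction h with
  | base E hE h0 => exact ⟨E, 𝟙 E, inferInstance, hE, h0, rfl⟩
  | step i p h _ hQ h0 _ _ => exact ⟨_, p, h.epi, hQ, h0, rfl⟩

include hW in
-- The last factor is a semistable quotient `Q` of minimal slope `a` with the largest possible `Im
-- W`, and the kernel is treated by induction. If the last factor `Q'` of the kernel had slope at
-- most `a`, then the induced quotient of `E`, an extension of `Q` by `Q'`, would be semistable of
-- slope `a` with larger `Im W`.
theorem exists_hnTower {c : ℝ} (hc : 0 < c) (hd : ∀ E, ∃ n : ℕ, (W E).im = c * n)
    (hrad : ∀ E : 𝒜, ∃ (L Q : 𝒜) (i : L ⟶ E) (p : E ⟶ Q), IsSES i p ∧ (W L).im = 0 ∧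
      TorsionFree W Q) (n : ℕ) :
    ∀ E : 𝒜, (W E).im = c * n → ¬ IsZero E → ∃ b, HNTower W E b := by
  induction n using Nat.strong_induction_on with
  | _ n ih =>
    intro E hn h0
    by_cases him : (W E).im = 0
    · exact ⟨_, .base E (SS.of_im_eq_zero hW him) h0⟩
    have hpos : 0 < (W E).im := lt_of_le_of_ne (hW.upper E).im_nonneg (Ne.symm him)
    obtain ⟨Q₀, p₀, a, _, hQ₀, ha₀, hEa⟩ := exists_minimal_slope_quotient hW hc hd hrad n E hn hpos
    classical
    let P : ℕ → Prop := fun k => ∃ (Q : 𝒜) (p : E ⟶ Q), Epi p ∧ SS W Q ∧ cslope (W Q) = a ∧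
      (W Q).im = c * k
    have hbound : ∀ k, P k → k ≤ n := by
      rintro k ⟨Q, p, _, -, -, hk⟩
      have h := hW.im_le_of_epi p
      rw [hk, hn] at h
      exact_mod_cast le_of_mul_le_mul_left h hc
    have hP : ∃ k, P k := by
      obtain ⟨k, hk⟩ := hd Q₀
      exact ⟨k, Q₀, p₀, inferInstance, hQ₀, ha₀, hk⟩
    obtain ⟨k₀, hk₀⟩ := hP
    obtain ⟨Q, p, _, hQ, ha, hk⟩ := Nat.findGreatest_spec (hbound k₀ hk₀) hk₀
    have hQpos : 0 < (W Q).im := lt_of_le_of_ne (hW.upper _).im_nonneg fun h => by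
      rw [cslope_eq_top.2 h.symm] at ha; simp at ha
    have hQ0 : ¬ IsZero Q := fun h => by rw [hW.zero h] at hQpos; simp at hQpos
    by_cases hK : IsZero (kernel p)
    · have := (IsSES.of_epi p).isIso_of_isZero_left hK
      exact ⟨_, .base E (hQ.of_iso (asIso p).symm) h0⟩
    have hadd := hW.add (IsSES.of_epi p)
    obtain ⟨m, hm⟩ := hd (kernel p)
    have hmn : m < n := by
      have : c * m < c * n := by rw [← hm, ← hn, hadd, Complex.add_im]; linarith
      exact_mod_cast lt_of_mul_lt_mul_left this hc.le
    obtain ⟨b, hb⟩ := ih m hmn _ hm hK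
    refine ⟨_, .step _ _ (IsSES.of_epi p) hb hQ hQ0 ?_⟩
    by_contra hlt
    obtain ⟨Q', p', _, hQ', hQ'0, rfl⟩ := hb.exists_last
    rw [ha, not_lt] at hlt
    have hQ'pos : 0 < (W Q').im := lt_of_le_of_ne (hW.upper _).im_nonneg fun h => by
      rw [cslope_eq_top.2 h.symm] at hlt; simp at hlt
    obtain ⟨V, π, α, β, hπ, hαβ, -, -⟩ := (IsSES.of_epi p).quotient (IsSES.of_epi p')
    have := hπ.epi
    have haddV := hW.add hαβ
    have hVa : SlopesGE W a V := hEa.of_epi π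
    have hVpos : 0 < (W V).im := by rw [haddV, Complex.add_im]; linarith
    have eV := (le_cslope_iff (hW.upper V) a).2 (hVa V (𝟙 V))
    have e1 := (cslope_le_iff (hW.upper Q') a).1 hlt
    have e2 := (cslope_le_iff (hW.upper Q) a).1 ha.le
    have eVa : cslope (W V) = a := by
      refine le_antisymm ((cslope_le_iff (hW.upper V) a).2 ⟨hVpos.ne', ?_⟩) eV
      rw [haddV, Complex.add_re, Complex.add_im]; linarith [e1.2, e2.2]
    have hVss : SS W V := SS.of_slopesGE hW (TorsionFree.ext hW hαβ
      (SS.torsionFree hW hQ' fun h => by rw [cslope_eq_top] at h; exact hQ'pos.ne' h)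
      (SS.torsionFree hW hQ (by simp [ha]))) hVa eVa
    obtain ⟨k', hk'⟩ := hd V
    have hPk' : P k' := ⟨V, π, inferInstance, hVss, eVa, hk'⟩
    have hle := Nat.le_findGreatest (hbound k' hPk') hPk'
    have : c * k' ≤ c * (Nat.findGreatest P n : ℝ) :=
      mul_le_mul_of_nonneg_left (by exact_mod_cast hle) hc.le
    rw [← hk', ← hk, haddV, Complex.add_im] at this
    linarith

theorem HNTower.exists_seq {E : 𝒜} {b : WithTop ℝ} (h : HNTower W E b) :
    ∃ (n : ℕ) (obj factor : ℕ → 𝒜), IsZero (obj 0) ∧ obj n = E ∧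
      (∀ j < n, HasSES (obj j) (obj (j + 1)) (factor j)) ∧
      (∀ j < n, SS W (factor j) ∧ ¬ IsZero (factor j) ∧ b ≤ cslope (W (factor j))) ∧
      ∀ j k, j < k → k < n → cslope (W (factor k)) < cslope (W (factor j)) := by
  induction h with
  | base E hE h0 =>
    refine ⟨1, fun k => if k = 0 then kernel (𝟙 E) else E, fun _ => E, isZero_kernel_of_mono _, rfl,
      ?_, fun _ _ => ⟨hE, h0, le_rfl⟩, fun j k h1 h2 => by omega⟩
    intro j hj
    obtain rfl : j = 0 := by omega
    exact ⟨kernel.ι (𝟙 E), 𝟙 E, IsSES.of_epi (𝟙 E)⟩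
  | @step K E Q i p h b _ hQ h0 hb ih =>
    obtain ⟨n, obj, factor, hz, rfl, hses, hss, hanti⟩ := ih
    refine ⟨n + 1, fun k => if k ≤ n then obj k else E, fun k => if k < n then factor k else Q,
      by simpa using hz, by simp, ?_, ?_, ?_⟩
    · intro j hj
      by_cases hjn : j < n
      · simpa [hjn, hjn.le, Nat.succ_le_of_lt hjn] using hses j hjn
      · obtain rfl : j = n := by omega
        simpa using ⟨i, p, h⟩
    · intro j hj
      by_cases hjn : j < n
      · obtain ⟨h1, h2, h3⟩ := hss j hjn
        simp only [hjn, if_true]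
        exact ⟨h1, h2, hb.le.trans h3⟩
      · simp only [hjn, if_false]
        exact ⟨hQ, h0, le_rfl⟩
    · intro j k hjk hk
      have hjn : j < n := by omega
      by_cases hkn : k < n
      · simpa [hjn, hkn] using hanti j k hjk hkn
      · simp only [hjn, hkn, if_true, if_false]
        exact hb.trans_le (hss j hjn).2.2

end HarderNarasimhan

/-! ### HN filtrations in the heart of a t-structure. -/

section

variable {D : Type u} [Category.{v} D] [Preadditive D] [HasZeroObject D] [HasShift D ℤ]
  [∀ n : ℤ, (shiftFunctor D n).Additive] [Pretriangulated D] [IsTriangulated D]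
  {Γ : Type w} [AddCommGroup Γ] {cl : K0 D →+ Γ} {Z : Γ →+ ℂ} {A : ObjectProperty D}

/-- The central charge on the objects of `A`. -/
def heartCharge (cl : K0 D →+ Γ) (Z : Γ →+ ℂ) (A : ObjectProperty D) (E : A.FullSubcategory) : ℂ :=
  Z (cl (K0.of E.obj))

theorem IsBoundedHeart.isWeakCharge (hA : IsBoundedHeart A)
    (hup : ∀ E, A E → InUpper (Z (cl (K0.of E)))) :
    letI := hA.abelian
    IsWeakCharge (heartCharge cl Z A) := by
  letI := hA.abelian
  refine ⟨fun {X Y Z i p} h => ?_, fun E => hup _ E.property⟩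
  obtain ⟨δ, hT⟩ := hA.triangle_of_shortExact h.2
  simp only [heartCharge, K0.of_triangle hT, map_add]

theorem IsBoundedHeart.nonempty_hnFiltration (hA : IsBoundedHeart A)
    (hup : ∀ E, A E → InUpper (Z (cl (K0.of E))))
    {c : ℝ} (hc : 0 < c) (hd : ∀ E, A E → ∃ n : ℕ, (Z (cl (K0.of E))).im = c * n)
    (hrad : letI := hA.abelian
      ∀ E : A.FullSubcategory, ∃ (L Q : A.FullSubcategory) (i : L ⟶ E) (p : E ⟶ Q), IsSES i p ∧
      (heartCharge cl Z A L).im = 0 ∧ TorsionFree (heartCharge cl Z A) Q) (E : A.FullSubcategory) :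
    Nonempty (HNFiltration cl Z A E) := by
  letI := hA.abelian
  by_cases hE : IsZero E
  · exact ⟨{ n := 0, obj := fun _ => E, factor := fun _ => E, isZero_zero := hE,
             lastIso := Iso.refl _, incl := fun j => j.elim0, proj := fun j => j.elim0
             comp_zero := fun j => j.elim0, shortExact := fun j => j.elim0
             factor_ne_zero := fun j => j.elim0, semistable := fun j => j.elim0
             slope_anti := fun j => j.elim0 }⟩
  obtain ⟨n, hn⟩ := hd E.obj E.property
  obtain ⟨b, hb⟩ := exists_hnTower (hA.isWeakCharge hup) hc (fun E => hd E.obj E.property) hrad n E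
    hn hE
  obtain ⟨n, obj, factor, hz, hobj, hses, hss, hanti⟩ := hb.exists_seq
  choose i p h using hses
  exact ⟨{ n := n, obj := fun j => obj j, factor := fun j => factor j, isZero_zero := hz
           lastIso := eqToIso hobj, incl := fun j => i j j.2, proj := fun j => p j j.2
           comp_zero := fun j => (h j j.2).1, shortExact := fun j => (h j j.2).2
           factor_ne_zero := fun j => (hss j j.2).2.1, semistable := fun j => (hss j j.2).1
           slope_anti := fun j k hjk => hanti j k hjk k.2 }⟩

end

/-! ### The correspondence between phases in `(0, 1]` and slopes. -/

section PhaseSlope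

/-- The slope of semistable objects of phase `φ ∈ (0, 1]`. -/
noncomputable def phaseSlope (φ : ℝ) : WithTop ℝ :=
  if φ = 1 then ⊤ else ((-Real.cos (Real.pi * φ) / Real.sin (Real.pi * φ) : ℝ) : WithTop ℝ)

theorem sin_pi_mul_pos {φ : ℝ} (h0 : 0 < φ) (h1 : φ < 1) : 0 < Real.sin (Real.pi * φ) :=
  Real.sin_pos_of_pos_of_lt_pi (mul_pos Real.pi_pos h0) (by nlinarith [Real.pi_pos])

theorem phaseSlope_lt {φ ψ : ℝ} (h0 : 0 < φ) (h : φ < ψ) (h1 : ψ ≤ 1) :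
    phaseSlope φ < phaseSlope ψ := by
  have hφ := sin_pi_mul_pos h0 (h.trans_le h1)
  rw [phaseSlope, if_neg (h.trans_le h1).ne, phaseSlope]
  split_ifs with hψ
  · exact WithTop.coe_lt_top _
  · have hψ := sin_pi_mul_pos (h0.trans h) (lt_of_le_of_ne h1 hψ)
    rw [WithTop.coe_lt_coe, div_lt_div_iff₀ hφ hψ]
    -- `sin (π (ψ - φ)) > 0` is the inequality of cotangents after clearing denominators.
    have := sin_pi_mul_pos (φ := ψ - φ) (by linarith) (by linarith)
    rw [mul_sub, Real.sin_sub] at this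
    linarith

theorem phaseSlope_lt_iff {φ ψ : ℝ} (hφ : φ ∈ Set.Ioc (0 : ℝ) 1) (hψ : ψ ∈ Set.Ioc (0 : ℝ) 1) :
    phaseSlope φ < phaseSlope ψ ↔ φ < ψ := by
  refine ⟨fun h => ?_, fun h => phaseSlope_lt hφ.1 h hψ.2⟩
  by_contra h'
  rcases (not_lt.1 h').eq_or_lt with rfl | h'
  · exact lt_irrefl _ h
  · exact lt_asymm h (phaseSlope_lt hψ.1 h' hφ.2)

theorem phaseSlope_half_add_arctan (a : ℝ) :
    phaseSlope (1 / 2 + Real.arctan a / Real.pi) = a := by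
  have h1 := Real.arctan_lt_pi_div_two a
  have hpi := Real.pi_pos
  have : 1 / 2 + Real.arctan a / Real.pi ≠ 1 := by
    intro h
    have : Real.arctan a = Real.pi / 2 := by field_simp at h; linarith
    linarith
  have e : Real.pi * (1 / 2 + Real.arctan a / Real.pi) = Real.arctan a + Real.pi / 2 := by
    field_simp; ring
  rw [phaseSlope, if_neg this, e, Real.cos_add_pi_div_two, Real.sin_add_pi_div_two, neg_neg,
    ← Real.tan_eq_sin_div_cos, Real.tan_arctan]

theorem half_add_arctan_mem (a : ℝ) :
    1 / 2 + Real.arctan a / Real.pi ∈ Set.Ioo (0 : ℝ) 1 := by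
  have h1 := Real.arctan_lt_pi_div_two a
  have h2 := Real.neg_pi_div_two_lt_arctan a
  have hpi := Real.pi_pos
  constructor
  · have : -(1 / 2) < Real.arctan a / Real.pi := by rw [lt_div_iff₀ hpi]; linarith
    linarith
  · have : Real.arctan a / Real.pi < 1 / 2 := by rw [div_lt_iff₀ hpi]; linarith
    linarith

theorem exists_phaseSlope_eq (s : WithTop ℝ) : ∃ φ ∈ Set.Ioc (0 : ℝ) 1, phaseSlope φ = s := by
  induction s with
  | top => exact ⟨1, ⟨one_pos, le_rfl⟩, if_pos rfl⟩
  | coe a => exact ⟨_, Set.Ioo_subset_Ioc_self (half_add_arctan_mem a), phaseSlope_half_add_arctan a⟩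

end PhaseSlope

/-! ### Towers of triangles with decreasing phases. -/

section Towers

variable {D : Type u} [Category.{v} D] [Preadditive D] [HasZeroObject D] [HasShift D ℤ]
  [∀ n : ℤ, (shiftFunctor D n).Additive] [Pretriangulated D]

/-- There is a distinguished triangle `X → Y → Z → X[1]`. -/
def HasTri (X Y Z : D) : Prop :=
  ∃ (f : X ⟶ Y) (g : Y ⟶ Z) (h : Z ⟶ X⟦(1 : ℤ)⟧), Triangle.mk f g h ∈ distTriang D

theorem HasTri.shift {X Y Z : D} (h : HasTri X Y Z) (n : ℤ) :
    HasTri (X⟦n⟧) (Y⟦n⟧) (Z⟦n⟧) := by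
  obtain ⟨f, g, h, hT⟩ := h
  exact ⟨_, _, _, Triangle.shift_distinguished _ hT n⟩

theorem HasTri.of_iso {X Y Z X' Y' Z' : D} (h : HasTri X Y Z) (e₁ : X ≅ X') (e₂ : Y ≅ Y')
    (e₃ : Z ≅ Z') : HasTri X' Y' Z' := by
  obtain ⟨f, g, h, hT⟩ := h
  exact ⟨e₁.inv ≫ f ≫ e₂.hom, e₂.inv ≫ g ≫ e₃.hom, e₃.inv ≫ h ≫ e₁.hom⟦(1 : ℤ)⟧',
    distTriang_of_iso hT e₁ e₂ e₃ (by simp) (by simp) (by simp)⟩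

theorem HasTri.rotate {X Y Z : D} (h : HasTri X Y Z) : HasTri Y Z (X⟦(1 : ℤ)⟧) := by
  obtain ⟨f, g, h, hT⟩ := h
  exact ⟨_, _, _, rot_of_distTriang _ hT⟩

theorem HasTri.of_isZero_left {X Z : D} (hX : IsZero X) : HasTri X Z Z :=
  HasTri.of_iso ⟨_, _, _, contractible_distinguished₁ Z⟩ hX.isoZero.symm (Iso.refl _) (Iso.refl _)

theorem HasTri.of_isZero_right {X Z : D} (hZ : IsZero Z) : HasTri X X Z :=
  HasTri.of_iso ⟨_, _, _, contractible_distinguished X⟩ (Iso.refl _) (Iso.refl _) hZ.isoZero.symm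

theorem HasTri.iso_of_isZero_left {X Y Z : D} (h : HasTri X Y Z) (hX : IsZero X) :
    Nonempty (Y ≅ Z) := by
  obtain ⟨f, g, h, hT⟩ := h
  have : IsIso g := (Triangle.isZero₁_iff_isIso₂ _ hT).1 hX
  exact ⟨asIso g⟩

theorem HasTri.iso_of_isZero_right {X Y Z : D} (h : HasTri X Y Z) (hZ : IsZero Z) :
    Nonempty (X ≅ Y) := by
  obtain ⟨f, g, h, hT⟩ := h
  have : IsIso f := (Triangle.isZero₃_iff_isIso₁ _ hT).1 hZ
  exact ⟨asIso f⟩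

theorem HasTri.octahedron [IsTriangulated D] {X Y Z X' X'' : D} (h : HasTri X Y Z)
    (h' : HasTri X' X X'') : ∃ W, HasTri X' Y W ∧ HasTri X'' W Z := by
  obtain ⟨f, g, h, hT⟩ := h
  obtain ⟨f', g', h', hT'⟩ := h'
  obtain ⟨W, p, δ, a, b, ε, h1, h2, -⟩ := exists_octahedron hT hT'
  exact ⟨W, ⟨_, _, _, h1⟩, ⟨_, _, _, h2⟩⟩

theorem HasTri.octahedron' [IsTriangulated D] {X Y Z Z' Z'' : D} (h : HasTri X Y Z)
    (h' : HasTri Z' Z Z'') : ∃ W, HasTri W Y Z'' ∧ HasTri X W Z' := by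
  obtain ⟨f, g, h, hT⟩ := h
  obtain ⟨f', g', h', hT'⟩ := h'
  obtain ⟨W, p, δ, a, b, ε, h1, h2, -⟩ := exists_octahedron' hT hT'
  exact ⟨W, ⟨_, _, _, h1⟩, ⟨_, _, _, h2⟩⟩

/-- `E` is a nonzero object with a Harder-Narasimhan filtration with smallest phase `lo` and
largest phase `hi`. -/
inductive Tower (P : ℝ → ObjectProperty D) : ℝ → ℝ → D → Prop
  | base {φ : ℝ} {E : D} (hE : P φ E) (h0 : ¬ IsZero E) : Tower P φ φ E
  | step {X Y Z : D} (h : HasTri X Y Z) {lo hi φ : ℝ} (hX : Tower P lo hi X) (hZ : P φ Z)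
      (h0 : ¬ IsZero Z) (hlt : φ < lo) : Tower P φ hi Y

variable {P : ℝ → ObjectProperty D}

theorem Tower.le {lo hi : ℝ} {E : D} (h : Tower P lo hi E) : lo ≤ hi := by
  induction h with
  | base => exact le_rfl
  | step _ _ _ _ hlt ih => exact hlt.le.trans ih

theorem Tower.of_iso (hP : ∀ φ {X Y : D}, (X ≅ Y) → P φ X → P φ Y) {lo hi : ℝ} {E E' : D}
    (h : Tower P lo hi E) (e : E ≅ E') : Tower P lo hi E' := by
  cases h with
  | base hE h0 => exact .base (hP _ e hE) fun h => h0 (h.of_iso e)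
  | step h hX hZ h0 hlt => exact .step (h.of_iso (Iso.refl _) e (Iso.refl _)) hX hZ h0 hlt

theorem isZero_of_shift {X : D} {n : ℤ} (h : IsZero (X⟦n⟧)) : IsZero X := by
  rw [IsZero.iff_id_eq_zero] at *
  apply shift_hom_eq_zero n
  rw [CategoryTheory.Functor.map_id, h]

theorem isZero_shift {X : D} (h : IsZero X) (n : ℤ) : IsZero (X⟦n⟧) :=
  Functor.map_isZero _ h

theorem Tower.shift {n : ℤ} (hP : ∀ φ (X : D), P φ X → P (φ + n) (X⟦n⟧)) {lo hi : ℝ} {E : D}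
    (h : Tower P lo hi E) : Tower P (lo + n) (hi + n) (E⟦n⟧) := by
  induction h with
  | base hE h0 => exact .base (hP _ _ hE) fun h => h0 (isZero_of_shift h)
  | step h _ hZ h0 hlt ih =>
    exact .step (h.shift n) ih (hP _ _ hZ) (fun h => h0 (isZero_of_shift h)) (by linarith)

/-- Induction on the tower of `G`: its last factor becomes the last factor of `E`, and the
octahedral axiom makes the rest of `E` an extension of the rest of `G` by `E'`. -/
theorem Tower.concat [IsTriangulated D] {lo hi lo' hi' : ℝ} {G : D} (hG : Tower P lo' hi' G) :
    ∀ {E' E : D}, HasTri E' E G → Tower P lo hi E' → hi' < lo → Tower P lo' hi E := by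
  induction hG with
  | base hG h0 => intro E' E h hE' hlt; exact .step h hE' hG h0 hlt
  | step h _ hZ h0 hlt' ih =>
    intro E' E hE hE' hlt
    obtain ⟨V, h1, h2⟩ := hE.octahedron' h
    exact .step h1 (ih h2 hE' hlt) hZ h0 hlt'

theorem Tower.mem_extClosure {lo hi : ℝ} {E : D} (h : Tower P lo hi E) :
    extClosure (fun X => ∃ φ ∈ Set.Icc lo hi, P φ X) E := by
  have mono : ∀ {S S' : ObjectProperty D} (hS : ∀ X, S X → S' X) {X : D}, extClosure S X →
      extClosure S' X := by
    intro S S' hS X hX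
    induction hX with
    | of_isZero E h => exact .of_isZero E h
    | of_mem E h => exact .of_mem E (hS E h)
    | ext T hT _ _ h1 h3 => exact .ext T hT h1 h3
  induction h with
  | base hE _ => exact .of_mem _ ⟨_, ⟨le_rfl, le_rfl⟩, hE⟩
  | @step X Y Z h lo hi φ hX hZ h0 hlt ih =>
    obtain ⟨f, g, h, hT⟩ := h
    refine .ext _ hT (mono ?_ ih) (.of_mem _ ⟨φ, ⟨le_rfl, hlt.le.trans hX.le⟩, hZ⟩)
    rintro X ⟨ψ, hψ, hX⟩
    exact ⟨ψ, ⟨hlt.le.trans hψ.1, hψ.2⟩, hX⟩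

theorem Tower.exists_seq {lo hi : ℝ} {E : D} (h : Tower P lo hi E) :
    ∃ (n : ℕ) (obj factor : ℕ → D) (phase : ℕ → ℝ), IsZero (obj 0) ∧ obj (n + 1) = E ∧
      (∀ j < n + 1, HasTri (obj j) (obj (j + 1)) (factor j)) ∧
      (∀ j < n + 1, P (phase j) (factor j) ∧ ¬ IsZero (factor j)) ∧
      phase 0 = hi ∧ phase n = lo ∧ (∀ j < n + 1, lo ≤ phase j) ∧
      ∀ j k, j < k → k < n + 1 → phase k < phase j := by
  induction h with
  | @base φ E hE h0 =>
    refine ⟨0, fun k => if k = 0 then 0 else E, fun _ => E, fun _ => φ, isZero_zero D, rfl,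
      ?_, fun _ _ => ⟨hE, h0⟩, rfl, rfl, fun _ _ => le_rfl, fun j k h1 h2 => by omega⟩
    intro j hj
    obtain rfl : j = 0 := by omega
    simpa using HasTri.of_isZero_left (isZero_zero D)
  | @step X Y Z h lo hi φ hX hZ h0 hlt ih =>
    obtain ⟨n, obj, factor, phase, hz, rfl, htri, hf, hhi, hlo, hle, hanti⟩ := ih
    refine ⟨n + 1, fun k => if k ≤ n + 1 then obj k else Y, fun k => if k < n + 1 then factor k else Z,
      fun k => if k < n + 1 then phase k else φ, by simpa using hz, by simp, ?_, ?_, by simpa, by simp,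
      ?_, ?_⟩
    · intro j hj
      by_cases hjn : j < n + 1
      · simpa [hjn, hjn.le, Nat.succ_le_of_lt hjn] using htri j hjn
      · obtain rfl : j = n + 1 := by omega
        simpa using h
    · intro j hj
      by_cases hjn : j < n + 1
      · simpa [hjn] using hf j hjn
      · simpa [hjn] using ⟨hZ, h0⟩
    · intro j hj
      by_cases hjn : j < n + 1
      · simpa [hjn] using hlt.le.trans (hle j hjn)
      · simp [hjn]
    · intro j k hjk hk
      have hjn : j < n + 1 := by omega
      by_cases hkn : k < n + 1
      · simpa [hjn, hkn] using hanti j k hjk hkn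
      · simp only [hjn, hkn, if_true, if_false]
        exact hlt.trans_le (hle j hjn)

theorem Tower.exists_phaseFiltration {lo hi : ℝ} {E : D} (h : Tower P lo hi E) :
    ∃ h : PhaseFiltration P E, h.phiMinus = lo ∧ h.phiPlus = hi := by
  obtain ⟨n, obj, factor, phase, hz, hE, htri, hf, hhi, hlo, hle, hanti⟩ := h.exists_seq
  choose f g h hT using htri
  exact ⟨{ n := n, obj := fun j => obj j, factor := fun j => factor j, phase := fun j => phase j,
           isZero_zero := hz, lastIso := eqToIso hE, incl := fun j => f j j.2
           proj := fun j => g j j.2, conn := fun j => h j j.2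
           distinguished := fun j => hT j j.2, factor_mem := fun j => (hf j j.2).1
           factor_ne_zero := fun j => (hf j j.2).2
           phase_anti := fun j k hjk => hanti j k hjk k.2 }, hlo, hhi⟩

theorem PhaseFiltration.tower (hP : ∀ φ {X Y : D}, (X ≅ Y) → P φ X → P φ Y) {E : D}
    (h : PhaseFiltration P E) : Tower P h.phiMinus h.phiPlus E := by
  suffices ∀ (j : ℕ) (hj : j < h.n + 1), Tower P (h.phase ⟨j, hj⟩) (h.phase 0)
      (h.obj ⟨j + 1, by omega⟩) from (this h.n (by omega)).of_iso hP h.lastIso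
  intro j
  induction j with
  | zero =>
    intro hj
    obtain ⟨e⟩ := HasTri.iso_of_isZero_left ⟨_, _, _, h.distinguished 0⟩ h.isZero_zero
    exact .base (hP _ e.symm (h.factor_mem 0)) fun h0 => h.factor_ne_zero 0 (h0.of_iso e.symm)
  | succ j ih =>
    intro hj
    exact .step ⟨_, _, _, h.distinguished ⟨j + 1, hj⟩⟩ (ih (by omega)) (h.factor_mem ⟨j + 1, hj⟩)
      (h.factor_ne_zero ⟨j + 1, hj⟩) (h.phase_anti (by simp [Fin.lt_def]))

/-- `E` is zero or has a Harder-Narasimhan filtration with phases in `(a, b]`. -/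
def TowerIn (P : ℝ → ObjectProperty D) (a b : ℝ) (E : D) : Prop :=
  IsZero E ∨ ∃ lo hi, Tower P lo hi E ∧ a < lo ∧ hi ≤ b

theorem TowerIn.of_iso (hP : ∀ φ {X Y : D}, (X ≅ Y) → P φ X → P φ Y) {a b : ℝ} {E E' : D}
    (h : TowerIn P a b E) (e : E ≅ E') : TowerIn P a b E' := by
  rcases h with h | ⟨lo, hi, h, h1, h2⟩
  · exact .inl (h.of_iso e.symm)
  · exact .inr ⟨lo, hi, h.of_iso hP e, h1, h2⟩

theorem TowerIn.mono {a b a' b' : ℝ} {E : D} (h : TowerIn P a b E) (ha : a' ≤ a) (hb : b ≤ b') :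
    TowerIn P a' b' E := by
  rcases h with h | ⟨lo, hi, h, h1, h2⟩
  · exact .inl h
  · exact .inr ⟨lo, hi, h, ha.trans_lt h1, h2.trans hb⟩

theorem TowerIn.concat [IsTriangulated D] (hP : ∀ φ {X Y : D}, (X ≅ Y) → P φ X → P φ Y)
    {a b c : ℝ} (hac : a ≤ c) (hcb : c ≤ b) {X Y Z : D} (h : HasTri X Y Z) (hX : TowerIn P c b X)
    (hZ : TowerIn P a c Z) : TowerIn P a b Y := by
  rcases hX with hX | ⟨lo, hi, hX, h1, h2⟩
  · obtain ⟨e⟩ := h.iso_of_isZero_left hX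
    exact (hZ.of_iso hP e.symm).mono le_rfl hcb
  · rcases hZ with hZ | ⟨lo', hi', hZ, h1', h2'⟩
    · obtain ⟨e⟩ := h.iso_of_isZero_right hZ
      exact .inr ⟨lo, hi, hX.of_iso hP e, hac.trans_lt h1, h2⟩
    · exact .inr ⟨lo', hi, hZ.concat h hX (h2'.trans_lt h1), h1', h2⟩

end Towers

/-! ### The slicing associated with a very weak pre-stability condition. -/

section AssociatedSlicing

variable {D : Type u} [Category.{v} D] [Preadditive D] [HasZeroObject D] [HasShift D ℤ]
  [∀ n : ℤ, (shiftFunctor D n).Additive] [Pretriangulated D]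
  {Γ : Type w} [AddCommGroup Γ] {cl : K0 D →+ Γ} {Z : Γ →+ ℂ} {A : ObjectProperty D}

theorem basicPhase.of_iso (hA : IsBoundedHeart A) {φ : ℝ} {X Y : D} (e : X ≅ Y)
    (h : basicPhase cl Z A φ X) : basicPhase cl Z A φ Y := by
  rcases h with h | ⟨hX, h1, h2⟩
  · exact .inl (h.of_iso e.symm)
  · refine .inr ⟨hA.of_iso e hX, ?_, by rwa [← K0.of_iso e]⟩
    exact SS.of_iso (W := heartCharge cl Z A) (A.isoMk (X := ⟨X, hX⟩) (Y := ⟨Y, hA.of_iso e hX⟩) e) h1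

theorem phase.of_iso (hA : IsBoundedHeart A) (φ : ℝ) {X Y : D} (e : X ≅ Y)
    (h : phase cl Z A φ X) : phase cl Z A φ Y :=
  basicPhase.of_iso hA ((shiftFunctor D _).mapIso e) h

theorem phase_zero (φ : ℝ) {X : D} (h : IsZero X) : phase cl Z A φ X :=
  .inl (isZero_shift h _)

theorem sub_ceil_mem (φ : ℝ) : φ - (⌈φ⌉ - 1 : ℤ) ∈ Set.Ioc (0 : ℝ) 1 := by
  push_cast
  constructor
  · linarith [Int.ceil_lt_add_one φ]
  · linarith [Int.le_ceil φ]

theorem ceil_eq_of_mem {ψ : ℝ} (hψ : ψ ∈ Set.Ioc (0 : ℝ) 1) (n : ℤ) : ⌈ψ + n⌉ - 1 = n := by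
  have : ⌈ψ⌉ = 1 := by rw [Int.ceil_eq_iff]; constructor <;> push_cast <;> linarith [hψ.1, hψ.2]
  rw [Int.ceil_add_intCast, this]; ring

theorem phase_add_int_iff {ψ : ℝ} (hψ : ψ ∈ Set.Ioc (0 : ℝ) 1) (n : ℤ)
    (X : D) : phase cl Z A (ψ + n) X ↔ basicPhase cl Z A ψ (X⟦-n⟧) := by
  unfold phase
  rw [ceil_eq_of_mem hψ]
  simp

theorem phase_iff_basicPhase (hA : IsBoundedHeart A) {ψ : ℝ} (hψ : ψ ∈ Set.Ioc (0 : ℝ) 1)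
    (X : D) : phase cl Z A ψ X ↔ basicPhase cl Z A ψ X := by
  have h := phase_add_int_iff (cl := cl) (Z := Z) (A := A) hψ 0 X
  simp only [Int.cast_zero, add_zero, neg_zero] at h
  rw [h]
  exact ⟨fun h => h.of_iso hA ((shiftFunctorZero D ℤ).app X),
    fun h => h.of_iso hA ((shiftFunctorZero D ℤ).app X).symm⟩

theorem phase_shift_iff (hA : IsBoundedHeart A) (φ : ℝ) (n : ℤ) (X : D) :
    phase cl Z A (φ + n) (X⟦n⟧) ↔ phase cl Z A φ X := by
  obtain ⟨ψ, m, hψ, rfl⟩ : ∃ (ψ : ℝ) (m : ℤ), ψ ∈ Set.Ioc (0 : ℝ) 1 ∧ φ = ψ + m :=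
    ⟨φ - (⌈φ⌉ - 1 : ℤ), ⌈φ⌉ - 1, sub_ceil_mem φ, by push_cast; ring⟩
  rw [phase_add_int_iff hψ, show ψ + m + n = ψ + (m + n : ℤ) by push_cast; ring,
    phase_add_int_iff hψ]
  let e : X⟦n⟧⟦-(m + n)⟧ ≅ X⟦-m⟧ := (shiftFunctorAdd' D n (-(m + n)) (-m) (by ring)).symm.app X
  exact ⟨fun h => h.of_iso hA e, fun h => h.of_iso hA e.symm⟩

theorem basicPhase.slope_eq {φ : ℝ} {E : D} (h : basicPhase cl Z A φ E) (h0 : ¬ IsZero E) :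
    ∃ hE : A E, SS (heartCharge cl Z A) ⟨E, hE⟩ ∧ cslope (heartCharge cl Z A ⟨E, hE⟩) = phaseSlope φ := by
  rcases h with h | h
  · exact absurd h h0
  · exact h

theorem isZero_of_fullSubcategory {E : A.FullSubcategory} (h : IsZero E) : IsZero E.obj := by
  rw [IsZero.iff_id_eq_zero] at *
  exact congrArg (fun f => f.hom) h

theorem isZero_fullSubcategory {E : A.FullSubcategory} (h : IsZero E.obj) : IsZero E := by
  rw [IsZero.iff_id_eq_zero] at *
  exact ObjectProperty.hom_ext _ h

variable [IsTriangulated D]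

/-- After shifting, either both objects lie in the heart and the slopes of the two semistable
objects exclude a nonzero map, or the map has negative degree between objects of the heart. -/
theorem phase_hom_eq_zero (hA : IsBoundedHeart A)
    (hup : ∀ E, A E → InUpper (Z (cl (K0.of E)))) {φ₁ φ₂ : ℝ} (h : φ₂ < φ₁) {X Y : D}
    (hX : phase cl Z A φ₁ X) (hY : phase cl Z A φ₂ Y) (f : X ⟶ Y) : f = 0 := by
  obtain ⟨ψ₁, m, hψ₁, rfl⟩ : ∃ (ψ : ℝ) (m : ℤ), ψ ∈ Set.Ioc (0 : ℝ) 1 ∧ φ₁ = ψ + m :=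
    ⟨φ₁ - (⌈φ₁⌉ - 1 : ℤ), ⌈φ₁⌉ - 1, sub_ceil_mem φ₁, by push_cast; ring⟩
  obtain ⟨ψ₂, n, hψ₂, rfl⟩ : ∃ (ψ : ℝ) (m : ℤ), ψ ∈ Set.Ioc (0 : ℝ) 1 ∧ φ₂ = ψ + m :=
    ⟨φ₂ - (⌈φ₂⌉ - 1 : ℤ), ⌈φ₂⌉ - 1, sub_ceil_mem φ₂, by push_cast; ring⟩
  rw [phase_add_int_iff hψ₁] at hX
  rw [phase_add_int_iff hψ₂] at hY
  by_cases hX0 : IsZero (X⟦-m⟧)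
  · exact (isZero_of_shift hX0).eq_of_src _ _
  by_cases hY0 : IsZero (Y⟦-n⟧)
  · exact (isZero_of_shift hY0).eq_of_tgt _ _
  obtain ⟨hXA, hXs, hXsl⟩ := hX.slope_eq hX0
  obtain ⟨hYA, hYs, hYsl⟩ := hY.slope_eq hY0
  have hnm : n ≤ m := by
    have h3 : (n : ℝ) < m + 1 := by linarith [hψ₁.2, hψ₂.1]
    have h4 : n < m + 1 := by exact_mod_cast h3
    omega
  apply shift_hom_eq_zero (-m)
  rcases hnm.eq_or_lt with rfl | hlt
  · letI := hA.abelian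
    have := SS.hom_eq_zero (hA.isWeakCharge hup) hXs hYs (by
      rw [hXsl, hYsl]; exact phaseSlope_lt hψ₂.1 (by linarith) hψ₁.2) (ObjectProperty.homMk (f⟦-n⟧'))
    exact congrArg (fun f => f.hom) this
  · let e : Y⟦-m⟧ ≅ Y⟦-n⟧⟦n - m⟧ := (shiftFunctorAdd' D (-n) (n - m) (-m) (by ring)).app Y
    have := hA.hom_shift_zero hXA hYA (n := n - m) (by omega) (f⟦-m⟧' ≫ e.hom)
    rw [← cancel_mono e.hom, this, zero_comp]

theorem phase_ext (hA : IsBoundedHeart A) (hup : ∀ E, A E → InUpper (Z (cl (K0.of E)))) {φ : ℝ}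
    {X Y E : D} (h : HasTri X E Y) (hX : phase cl Z A φ X) (hY : phase cl Z A φ Y) :
    phase cl Z A φ E := by
  by_cases hX0 : IsZero X
  · obtain ⟨e⟩ := h.iso_of_isZero_left hX0
    exact phase.of_iso hA φ e.symm hY
  by_cases hY0 : IsZero Y
  · obtain ⟨e⟩ := h.iso_of_isZero_right hY0
    exact phase.of_iso hA φ e hX
  obtain ⟨hXA, hXs, hXsl⟩ := basicPhase.slope_eq hX fun h => hX0 (isZero_of_shift h)
  obtain ⟨hYA, hYs, hYsl⟩ := basicPhase.slope_eq hY fun h => hY0 (isZero_of_shift h)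
  obtain ⟨f, g, δ, hT⟩ := h.shift (-(⌈φ⌉ - 1))
  have hEA := hA.ext hT hXA hYA
  letI := hA.abelian
  obtain ⟨h1, h2⟩ := SS.ext (hA.isWeakCharge hup) (hA.shortExact_of_triangle
    (X := ⟨_, hXA⟩) (Y := ⟨_, hEA⟩) (Z := ⟨_, hYA⟩) (ObjectProperty.homMk f)
    (ObjectProperty.homMk g) δ hT) hXs hYs hXsl hYsl
  exact .inr ⟨hEA, h1, h2⟩

theorem heart_towerIn (hA : IsBoundedHeart A)
    (hn : ∀ E : A.FullSubcategory, Nonempty (HNFiltration cl Z A E)) {E : D} (hE : A E) :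
    TowerIn (phase cl Z A) 0 1 E := by
  obtain ⟨h⟩ := hn ⟨E, hE⟩
  -- The induction remembers that the smallest phase so far belongs to the preceding factor, so that
  -- strict decrease of slopes yields strict decrease of phases.
  suffices ∀ (j : ℕ) (hj : j ≤ h.n), IsZero (h.obj ⟨j, by omega⟩).obj ∨ ∃ (k : ℕ) (hk : k + 1 = j)
      (lo hi : ℝ), Tower (phase cl Z A) lo hi (h.obj ⟨j, by omega⟩).obj ∧ 0 < lo ∧ hi ≤ 1 ∧
      phaseSlope lo = slope Z (cl (K0.of (h.factor ⟨k, by omega⟩).obj)) by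
    have e : (h.obj (Fin.last h.n)).obj ≅ E := A.ι.mapIso h.lastIso
    rcases this h.n le_rfl with h0 | ⟨k, hk, lo, hi, h1, h2, h3, -⟩
    · exact .inl (h0.of_iso e.symm)
    · exact .inr ⟨lo, hi, h1.of_iso (fun φ {_ _} => phase.of_iso hA φ) e, h2, h3⟩
  intro j
  induction j with
  | zero => exact fun _ => .inl (isZero_of_fullSubcategory h.isZero_zero)
  | succ j ih =>
    intro hj
    right
    obtain ⟨ψ, hψ, hs⟩ := exists_phaseSlope_eq (slope Z (cl (K0.of (h.factor ⟨j, by omega⟩).obj)))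
    have hF : phase cl Z A ψ (h.factor ⟨j, by omega⟩).obj :=
      (phase_iff_basicPhase hA hψ _).2 (.inr ⟨(h.factor ⟨j, by omega⟩).property,
        h.semistable ⟨j, by omega⟩, hs.symm⟩)
    have hF0 : ¬ IsZero (h.factor ⟨j, by omega⟩).obj :=
      fun h0 => h.factor_ne_zero _ (isZero_fullSubcategory h0)
    obtain ⟨δ, hT⟩ := hA.triangle_of_shortExact (h.shortExact ⟨j, by omega⟩)
    have htri : HasTri (h.obj ⟨j, by omega⟩).obj (h.obj ⟨j + 1, by omega⟩).obj
      (h.factor ⟨j, by omega⟩).obj := ⟨_, _, _, hT⟩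
    rcases ih (by omega) with h0 | ⟨k, rfl, lo, hi, h1, h2, h3, h4⟩
    · obtain ⟨e⟩ := htri.iso_of_isZero_left h0
      exact ⟨j, rfl, ψ, ψ, .base (phase.of_iso hA _ e.symm hF) (fun h => hF0 (h.of_iso e.symm)),
        hψ.1, hψ.2, hs⟩
    · refine ⟨k + 1, rfl, ψ, hi, .step htri h1 hF hF0 ?_, hψ.1, h3, hs⟩
      rw [← phaseSlope_lt_iff hψ ⟨h2, h1.le.trans h3⟩, hs, h4]
      exact h.slope_anti (by simp [Fin.lt_def])

/-- Induction on the cohomological amplitude. The cohomology object in the top degree `d` is a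
shifted object of the heart with phases in `(-d, -d + 1]`, below those of the rest, so the towers
can be concatenated. -/
theorem exists_towerIn (hA : IsBoundedHeart A)
    (hn : ∀ E : A.FullSubcategory, Nonempty (HNFiltration cl Z A E)) (E : D) :
    ∃ a b : ℝ, a ≤ b ∧ TowerIn (phase cl Z A) a b E := by
  have hiso := fun φ {X Y : D} => phase.of_iso (X := X) (Y := Y) (cl := cl) (Z := Z) hA φ
  obtain ⟨τ, hτ, hτA⟩ := id hA
  obtain ⟨⟨a, ha⟩, b, hb⟩ := hτ E
  suffices ∀ (k : ℕ) (E : D), τ.IsGE E a → τ.IsLE E (a + k - 1) →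
      TowerIn (phase cl Z A) (-(a + k - 1)) (-a + 1) E by
    refine ⟨_, _, ?_, this (b - a + 1).toNat E ha ?_⟩
    · have : (0 : ℝ) ≤ ((b - a + 1).toNat : ℝ) := Nat.cast_nonneg _
      linarith
    · exact τ.isLE_of_le E b _ (by omega)
  intro k
  induction k with
  | zero =>
    intro E h1 h2
    exact .inl (τ.isZero E (a + (0 : ℕ) - 1) a (by simp))
  | succ k ih =>
    intro E h1 h2
    obtain ⟨X, Y, hX, hY, f, g, h, hT⟩ := τ.exists_triangle E (a + k - 1) (a + k) (by ring)
    rw [τ.le_iff_isLE] at hX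
    rw [τ.ge_iff_isGE] at hY
    have hX' : τ.IsGE X a := by
      refine τ.isGE₂ _ (inv_rot_of_distTriang _ hT) a ?_ h1
      have := τ.isGE_shift Y (a + k) (-1) (a + k + 1)
      exact τ.isGE_of_ge (Y⟦(-1 : ℤ)⟧) a (a + k + 1)
    have hY' : τ.IsLE Y (a + k) := by
      refine τ.isLE₂ _ (rot_of_distTriang _ hT) (a + k)
        (τ.isLE_of_le E (a + (k + 1 : ℕ) - 1) (a + k) (by push_cast; omega)) ?_
      have := τ.isLE_shift X (a + k - 1) 1 (a + k - 2)
      exact τ.isLE_of_le (X⟦(1 : ℤ)⟧) (a + k - 2) (a + k)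
    have hYA : A (Y⟦a + k⟧) := by
      rw [← hτA, τ.mem_heart_iff]
      exact ⟨τ.isLE_shift Y (a + k) (a + k) 0, τ.isGE_shift Y (a + k) (a + k) 0⟩
    refine TowerIn.concat (c := -(a + k - 1)) hiso (by push_cast; linarith) (by
      have : (0 : ℝ) ≤ k := Nat.cast_nonneg k
      linarith) ⟨f, g, h, hT⟩ (ih X hX' hX) ?_
    rcases heart_towerIn hA hn hYA with h0 | ⟨lo, hi, h3, h4, h5⟩
    · exact .inl (isZero_of_shift h0)
    · have e := h3.shift (n := -(a + k)) (fun φ X => (phase_shift_iff hA φ _ X).2)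
      refine .inr ⟨_, _, e.of_iso hiso (shiftShiftNeg Y (a + k)), ?_, ?_⟩
      · push_cast; linarith
      · push_cast; linarith

/-- The slicing associated with a very weak pre-stability condition. -/
noncomputable def IsVeryWeakPreStability.slicing (h : IsVeryWeakPreStability cl Z A) :
    Slicing D where
  P := phase cl Z A
  of_iso := fun φ {_ _} => phase.of_iso h.isBoundedHeart φ
  zero_mem := fun φ _ => phase_zero φ
  biprod_mem := fun _ X Y => phase_ext h.isBoundedHeart h.upper
    ⟨_, _, _, binaryBiproductTriangle_distinguished X Y⟩
  shift_iff := fun φ X => by simpa using phase_shift_iff h.isBoundedHeart φ 1 X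
  hom_zero := fun _ _ hlt _ _ => phase_hom_eq_zero h.isBoundedHeart h.upper hlt
  exists_filtration := fun E h0 => by
    obtain ⟨a, b, -, h1 | ⟨lo, hi, h1, -⟩⟩ := exists_towerIn h.isBoundedHeart h.hn E
    · exact absurd h1 h0
    · exact ⟨h1.exists_phaseFiltration.choose⟩

end AssociatedSlicing

/-! ### Slicings: orthogonality, uniqueness of phases, truncations and t-structures. -/

section Slicings

variable {D : Type u} [Category.{v} D] [Preadditive D] [HasZeroObject D] [HasShift D ℤ]
  [∀ n : ℤ, (shiftFunctor D n).Additive] [Pretriangulated D]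

theorem HasTri.exists_mid_of_hom {X Y Z T : D} {f : X ⟶ Y} {g : Y ⟶ Z} {h : Z ⟶ X⟦(1 : ℤ)⟧}
    (hT : Triangle.mk f g h ∈ distTriang D) (k : T ⟶ Y) (hk : k ≫ g = 0) : ∃ l, l ≫ f = k :=
  let ⟨l, hl⟩ := Triangle.coyoneda_exact₂ _ hT k hk
  ⟨l, hl.symm⟩

theorem HasTri.exists_desc_of_hom {X Y Z T : D} {f : X ⟶ Y} {g : Y ⟶ Z} {h : Z ⟶ X⟦(1 : ℤ)⟧}
    (hT : Triangle.mk f g h ∈ distTriang D) (k : Y ⟶ T) (hk : f ≫ k = 0) : ∃ l, g ≫ l = k :=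
  let ⟨l, hl⟩ := Triangle.yoneda_exact₂ _ hT k hk
  ⟨l, hl.symm⟩

theorem HasTri.exists_mid_of_hom_left {X Y Z T : D} {f : X ⟶ Y} {g : Y ⟶ Z}
    {h : Z ⟶ X⟦(1 : ℤ)⟧} (hT : Triangle.mk f g h ∈ distTriang D) (k : T ⟶ X) (hk : k ≫ f = 0) :
    ∃ (l : T ⟶ Z⟦(-1 : ℤ)⟧) (m : Z⟦(-1 : ℤ)⟧ ⟶ X), l ≫ m = k :=
  let ⟨l, hl⟩ := Triangle.coyoneda_exact₂ _ (inv_rot_of_distTriang _ hT) k hk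
  ⟨l, _, hl.symm⟩

theorem HasTri.exists_desc_of_hom_right {X Y Z T : D} {f : X ⟶ Y} {g : Y ⟶ Z}
    {h : Z ⟶ X⟦(1 : ℤ)⟧} (hT : Triangle.mk f g h ∈ distTriang D) (k : Z ⟶ T) (hk : g ≫ k = 0) :
    ∃ l : X⟦(1 : ℤ)⟧ ⟶ T, h ≫ l = k :=
  let ⟨l, hl⟩ := Triangle.yoneda_exact₃ _ hT k hk
  ⟨l, hl.symm⟩

theorem HasTri.hom_eq_zero_to {X Y Z T : D} (h : HasTri X Y Z) (hX : ∀ f : T ⟶ X, f = 0)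
    (hZ : ∀ f : T ⟶ Z, f = 0) (k : T ⟶ Y) : k = 0 := by
  obtain ⟨f, g, h, hT⟩ := h
  obtain ⟨l, rfl⟩ := HasTri.exists_mid_of_hom hT k (hZ _)
  rw [hX l, zero_comp]

theorem HasTri.hom_eq_zero_from {X Y Z T : D} (h : HasTri X Y Z) (hX : ∀ f : X ⟶ T, f = 0)
    (hZ : ∀ f : Z ⟶ T, f = 0) (k : Y ⟶ T) : k = 0 := by
  obtain ⟨f, g, h, hT⟩ := h
  obtain ⟨l, rfl⟩ := HasTri.exists_desc_of_hom hT k (hX _)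
  rw [hZ l, comp_zero]

theorem extClosure.mono {S S' : ObjectProperty D} (hS : ∀ X, S X → S' X) {X : D}
    (h : extClosure S X) : extClosure S' X := by
  induction h with
  | of_isZero E h => exact .of_isZero E h
  | of_mem E h => exact .of_mem E (hS E h)
  | ext T hT _ _ h1 h3 => exact .ext T hT h1 h3

theorem extClosure.hasTri {S : ObjectProperty D} {X Y Z : D} (h : HasTri X Y Z)
    (hX : extClosure S X) (hZ : extClosure S Z) : extClosure S Y := by
  obtain ⟨f, g, h, hT⟩ := h
  exact .ext _ hT hX hZ

theorem extClosure.of_iso {S : ObjectProperty D} {X Y : D} (e : X ≅ Y) (hX : extClosure S X) :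
    extClosure S Y :=
  extClosure.hasTri ⟨_, _, _, distTriang_of_hom_iso e⟩ hX (.of_isZero _ (isZero_zero D))

theorem extClosure.hom_eq_zero {S T : ObjectProperty D}
    (h : ∀ X Y, S X → T Y → ∀ f : X ⟶ Y, f = 0) {X Y : D} (hX : extClosure S X)
    (hY : extClosure T Y) (f : X ⟶ Y) : f = 0 := by
  induction hX with
  | of_isZero E h => exact h.eq_of_src _ _
  | of_mem E hE =>
    induction hY with
    | of_isZero E h => exact h.eq_of_tgt _ _
    | of_mem E hE' => exact h _ _ hE hE' f
    | ext T hT _ _ h1 h3 => exact HasTri.hom_eq_zero_to ⟨_, _, _, hT⟩ h1 h3 f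
  | ext T hT _ _ h1 h3 => exact HasTri.hom_eq_zero_from ⟨_, _, _, hT⟩ h1 h3 f

theorem extClosure.shift {S S' : ObjectProperty D} (n : ℤ) (h : ∀ X, S X → S' (X⟦n⟧)) {X : D}
    (hX : extClosure S X) : extClosure S' (X⟦n⟧) := by
  induction hX with
  | of_isZero E h => exact .of_isZero _ (isZero_shift h n)
  | of_mem E hE => exact .of_mem _ (h _ hE)
  | ext T hT _ _ h1 h3 => exact extClosure.hasTri (HasTri.shift ⟨_, _, _, hT⟩ n) h1 h3

namespace Slicing

variable (S : Slicing D)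

/-- The extension closure of the `P φ`, `φ ∈ I`. -/
def interval (I : Set ℝ) : ObjectProperty D := extClosure fun E => ∃ φ ∈ I, S.P φ E

variable {S}

theorem shift_iff_int (φ : ℝ) (n : ℤ) (X : D) : S.P (φ + n) (X⟦n⟧) ↔ S.P φ X := by
  induction n using Int.induction_on with
  | zero =>
    simp only [Int.cast_zero, add_zero]
    exact ⟨S.of_iso _ ((shiftFunctorZero D ℤ).app X), S.of_iso _ ((shiftFunctorZero D ℤ).app X).symm⟩
  | succ n ih =>
    rw [← ih, ← S.shift_iff (φ + (n : ℤ))]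
    let e : X⟦(n : ℤ) + 1⟧ ≅ X⟦(n : ℤ)⟧⟦(1 : ℤ)⟧ := (shiftFunctorAdd D (n : ℤ) 1).app X
    rw [show φ + ((n : ℤ) + 1 : ℤ) = φ + (n : ℤ) + 1 by push_cast; ring]
    exact ⟨S.of_iso _ e, S.of_iso _ e.symm⟩
  | pred n ih =>
    rw [← ih, ← S.shift_iff (φ + ((-(n : ℤ) - 1 : ℤ)))]
    let e : X⟦-(n : ℤ)⟧ ≅ X⟦-(n : ℤ) - 1⟧⟦(1 : ℤ)⟧ :=
      (shiftFunctorAdd' D (-(n : ℤ) - 1) 1 (-(n : ℤ)) (by ring)).app X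
    rw [show φ + (-(n : ℤ) - 1 : ℤ) + 1 = φ + (-(n : ℤ) : ℤ) by push_cast; ring]
    exact ⟨S.of_iso _ e.symm, S.of_iso _ e⟩

theorem interval.mono {I J : Set ℝ} {E : D} (h : ∀ φ ∈ I, φ ∈ J) (hE : S.interval I E) : S.interval J E :=
  extClosure.mono (fun _ ⟨φ, hφ, hX⟩ => ⟨φ, h φ hφ, hX⟩) hE

theorem interval.of_P {I : Set ℝ} {φ : ℝ} (hφ : φ ∈ I) {E : D} (hE : S.P φ E) : S.interval I E :=
  .of_mem _ ⟨φ, hφ, hE⟩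

theorem interval.of_isZero {I : Set ℝ} {E : D} (hE : IsZero E) : S.interval I E :=
  extClosure.of_isZero _ hE

theorem interval.ext {I : Set ℝ} {X Y Z : D} (h : HasTri X Y Z) (hX : S.interval I X)
    (hZ : S.interval I Z) : S.interval I Y :=
  extClosure.hasTri h hX hZ

theorem interval.of_iso {I : Set ℝ} {X Y : D} (e : X ≅ Y) (hX : S.interval I X) : S.interval I Y :=
  extClosure.of_iso e hX

theorem interval.shift {I J : Set ℝ} (n : ℤ) (h : ∀ φ ∈ I, φ + n ∈ J) {X : D}
    (hX : S.interval I X) : S.interval J (X⟦n⟧) :=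
  extClosure.shift n (fun Y ⟨φ, hφ, hY⟩ => ⟨φ + n, h φ hφ, (shift_iff_int φ n Y).2 hY⟩) hX

theorem interval.hom_eq_zero {I J : Set ℝ} (h : ∀ φ ∈ I, ∀ ψ ∈ J, ψ < φ) {X Y : D}
    (hX : S.interval I X) (hY : S.interval J Y) (f : X ⟶ Y) : f = 0 :=
  extClosure.hom_eq_zero (fun X Y ⟨φ, hφ, hX⟩ ⟨ψ, hψ, hY⟩ f =>
    S.hom_zero φ ψ (h φ hφ ψ hψ) X Y hX hY f) hX hY f

theorem exists_tower {E : D} (hE : ¬ IsZero E) : ∃ lo hi, Tower S.P lo hi E :=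
  let ⟨h⟩ := S.exists_filtration E hE
  ⟨_, _, h.tower S.of_iso⟩

theorem _root_.VeryWeakStab.Tower.interval {lo hi : ℝ} {E : D} (h : Tower S.P lo hi E) :
    S.interval (Set.Icc lo hi) E := h.mem_extClosure

/-- A nonzero map from phase `hi` survives each extension: if it died, it would factor through a
shift by `-1` of the new factor, which has smaller phase. -/
theorem _root_.VeryWeakStab.Tower.exists_hom_from {lo hi : ℝ} {E : D} (h : Tower S.P lo hi E) :
    ∃ (X : D) (f : X ⟶ E), S.P hi X ∧ f ≠ 0 := by
  induction h with
  | base hE h0 => exact ⟨_, 𝟙 _, hE, fun h => h0 ((IsZero.iff_id_eq_zero _).2 h)⟩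
  | step h hX hZ h0 hlt ih =>
    obtain ⟨W, k, hW, hk⟩ := ih
    have hle := hX.le
    obtain ⟨f, g, h, hT⟩ := h
    refine ⟨W, k ≫ f, hW, fun h0 => hk ?_⟩
    obtain ⟨l, m, rfl⟩ := HasTri.exists_mid_of_hom_left hT k h0
    rw [S.hom_zero _ _ (by push_cast; linarith) _ _ hW ((shift_iff_int _ (-1) _).2 hZ) l,
      zero_comp]

/-- The projection to the last factor is nonzero: otherwise the identity of that factor would factor
through `X[1]`, all of whose phases are larger. -/
theorem _root_.VeryWeakStab.Tower.exists_hom_to {lo hi : ℝ} {E : D} (h : Tower S.P lo hi E) :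
    ∃ (Y : D) (f : E ⟶ Y), S.P lo Y ∧ f ≠ 0 := by
  cases h with
  | base hE h0 => exact ⟨_, 𝟙 _, hE, fun h => h0 ((IsZero.iff_id_eq_zero _).2 h)⟩
  | @step X _ Z h lo' _ _ hX hZ h0 hlt =>
    obtain ⟨f, g, h, hT⟩ := h
    refine ⟨_, g, hZ, fun hg => h0 ?_⟩
    rw [IsZero.iff_id_eq_zero]
    obtain ⟨l, hl⟩ := HasTri.exists_desc_of_hom_right hT (𝟙 Z) (by rw [hg, zero_comp])
    rw [← hl, interval.hom_eq_zero (I := Set.Icc (lo' + 1) (hi + 1)) (J := {lo}) ?_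
      (interval.shift 1 ?_ hX.interval) (interval.of_P (Set.mem_singleton _) hZ) l, comp_zero]
    · rintro φ hφ ψ rfl
      linarith [hφ.1]
    · intro φ hφ
      push_cast
      exact ⟨by linarith [hφ.1], by linarith [hφ.2]⟩

/-- The extremal HN phases are detected by nonzero maps, and orthogonality would kill these maps if
all of `I` lay strictly on one side. -/
theorem interval.exists_le {I : Set ℝ} {lo hi : ℝ} {E : D} (hE : S.interval I E)
    (h : Tower S.P lo hi E) : (∃ φ ∈ I, φ ≤ lo) ∧ ∃ φ ∈ I, hi ≤ φ := by
  constructor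
  · by_contra! hlt
    obtain ⟨Y, f, hY, hf⟩ := h.exists_hom_to
    exact hf (interval.hom_eq_zero (J := {lo}) (by rintro φ hφ ψ rfl; exact hlt φ hφ) hE
      (interval.of_P (Set.mem_singleton _) hY) f)
  · by_contra! hlt
    obtain ⟨Y, f, hY, hf⟩ := h.exists_hom_from
    exact hf (interval.hom_eq_zero (I := {hi}) (by rintro φ rfl ψ hψ; exact hlt ψ hψ)
      (interval.of_P (Set.mem_singleton _) hY) hE f)

theorem interval.tower_mem {I : Set ℝ} (hI : I.OrdConnected) {lo hi : ℝ} {E : D}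
    (hE : S.interval I E) (h : Tower S.P lo hi E) : lo ∈ I ∧ hi ∈ I := by
  obtain ⟨⟨φ, hφ, h1⟩, ψ, hψ, h2⟩ := hE.exists_le h
  exact ⟨hI.out hφ hψ ⟨h1, h.le.trans h2⟩, hI.out hφ hψ ⟨h1.trans h.le, h2⟩⟩

theorem _root_.VeryWeakStab.Tower.unique {lo hi lo' hi' : ℝ} {E : D} (h : Tower S.P lo hi E)
    (h' : Tower S.P lo' hi' E) : lo = lo' ∧ hi = hi' := by
  have h1 := h.interval.tower_mem Set.ordConnected_Icc h'
  have h2 := h'.interval.tower_mem Set.ordConnected_Icc h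
  exact ⟨le_antisymm h1.1.1 h2.1.1, le_antisymm h2.2.2 h1.2.2⟩

theorem interval.inter {I J : Set ℝ} (hI : I.OrdConnected) (hJ : J.OrdConnected) {E : D}
    (hEI : S.interval I E) (hEJ : S.interval J E) : S.interval (I ∩ J) E := by
  by_cases h0 : IsZero E
  · exact .of_isZero h0
  obtain ⟨lo, hi, h⟩ := S.exists_tower h0
  have h1 := hEI.tower_mem hI h
  have h2 := hEJ.tower_mem hJ h
  exact h.interval.mono fun φ hφ => ⟨hI.out h1.1 h1.2 hφ, hJ.out h2.1 h2.2 hφ⟩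

theorem interval.singleton {φ : ℝ} {E : D} (h : S.interval {φ} E) : S.P φ E := by
  by_cases h0 : IsZero E
  · exact S.zero_mem _ _ h0
  obtain ⟨lo, hi, ht⟩ := S.exists_tower h0
  obtain ⟨h1, h2⟩ := h.tower_mem Set.ordConnected_singleton ht
  rw [Set.mem_singleton_iff] at h1 h2
  subst h1 h2
  cases ht with
  | base hE => exact hE
  | step _ hX _ _ hlt => exact absurd hX.le (not_le.2 hlt)

variable [IsTriangulated D]

/-- If the smallest phase lies in `U`, then so do all phases. Otherwise the last factor is added to
the lower part by the octahedral axiom. -/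
theorem _root_.VeryWeakStab.Tower.truncation {U : Set ℝ} (hU : IsUpperSet U) {lo hi : ℝ} {E : D}
    (h : Tower S.P lo hi E) : ∃ X Y, HasTri X E Y ∧ S.interval (Set.Icc lo hi ∩ U) X ∧
      S.interval (Set.Icc lo hi ∩ Uᶜ) Y := by
  induction h with
  | @base φ E hE h0 =>
    by_cases hφ : φ ∈ U
    · exact ⟨E, 0, HasTri.of_isZero_right (isZero_zero D), .of_P (And.intro (And.intro le_rfl le_rfl) hφ) hE,
        .of_isZero (isZero_zero D)⟩
    · exact ⟨0, E, HasTri.of_isZero_left (isZero_zero D), .of_isZero (isZero_zero D),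
        .of_P (And.intro (And.intro le_rfl le_rfl) hφ) hE⟩
  | @step X Y Z h lo hi φ hX hZ h0 hlt ih =>
    by_cases hφ : φ ∈ U
    · refine ⟨Y, 0, HasTri.of_isZero_right (isZero_zero D), ?_, .of_isZero (isZero_zero D)⟩
      exact (Tower.step h hX hZ h0 hlt).interval.mono fun ψ hψ => ⟨hψ, hU hψ.1 hφ⟩
    · obtain ⟨X', X'', h', h1, h2⟩ := ih
      obtain ⟨W, h3, h4⟩ := h.octahedron h'
      exact ⟨X', W, h3, h1.mono fun ψ hψ => ⟨⟨hlt.le.trans hψ.1.1, hψ.1.2⟩, hψ.2⟩, .ext h4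
        (h2.mono fun ψ hψ => ⟨⟨hlt.le.trans hψ.1.1, hψ.1.2⟩, hψ.2⟩)
        (.of_P (And.intro (And.intro le_rfl (hlt.le.trans hX.le)) hφ) hZ)⟩

theorem interval.truncation {I U : Set ℝ} (hI : I.OrdConnected) (hU : IsUpperSet U) {E : D}
    (h : S.interval I E) : ∃ X Y, HasTri X E Y ∧ S.interval (I ∩ U) X ∧ S.interval (I ∩ Uᶜ) Y := by
  by_cases h0 : IsZero E
  · exact ⟨0, E, HasTri.of_isZero_left (isZero_zero D), .of_isZero (isZero_zero D), .of_isZero h0⟩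
  obtain ⟨lo, hi, ht⟩ := S.exists_tower h0
  obtain ⟨h1, h2⟩ := h.tower_mem hI ht
  obtain ⟨X, Y, h3, h4, h5⟩ := ht.truncation hU
  exact ⟨X, Y, h3, h4.mono fun φ hφ => ⟨hI.out h1 h2 hφ.1, hφ.2⟩,
    h5.mono fun φ hφ => ⟨hI.out h1 h2 hφ.1, hφ.2⟩⟩

theorem exists_bounds (E : D) : ∃ a b : ℝ, S.interval (Set.Icc a b) E := by
  by_cases h0 : IsZero E
  · exact ⟨0, 0, .of_isZero h0⟩
  obtain ⟨lo, hi, ht⟩ := S.exists_tower h0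
  exact ⟨lo, hi, ht.interval⟩

variable (S) in
/-- The t-structure whose aisle is the extension closure of the `P φ`, `φ > a`. -/
def tStructure (a : ℝ) : Triangulated.TStructure D where
  le n := S.interval (Set.Ioi (a - n))
  ge n := S.interval (Set.Iic (a + 1 - n))
  le_isClosedUnderIsomorphisms _ := ⟨fun e h => h.of_iso e⟩
  ge_isClosedUnderIsomorphisms _ := ⟨fun e h => h.of_iso e⟩
  le_shift n k n' h X hX := by
    refine hX.shift k fun φ hφ => ?_
    rw [Set.mem_Ioi] at *
    rw [← h] at hφ
    push_cast at hφ
    linarith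
  ge_shift n k n' h X hX := by
    refine hX.shift k fun φ hφ => ?_
    rw [Set.mem_Iic] at *
    rw [← h] at hφ
    push_cast at hφ
    linarith
  zero' X Y f hX hY := by
    refine interval.hom_eq_zero ?_ hX hY f
    intro φ hφ ψ hψ
    simp at hφ hψ
    linarith
  le_zero_le X hX := hX.mono (Set.Ioi_subset_Ioi (show a - (1 : ℤ) ≤ a - (0 : ℤ) by simp))
  ge_one_le X hX := hX.mono (Set.Iic_subset_Iic.2 (show a + 1 - (1 : ℤ) ≤ a + 1 - (0 : ℤ) by simp))
  exists_triangle_zero_one A := by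
    obtain ⟨b, c, h⟩ := S.exists_bounds A
    obtain ⟨X, Y, ⟨f, g, h, hT⟩, hX, hY⟩ :=
      h.truncation Set.ordConnected_Icc (isUpperSet_Ioi a)
    refine ⟨X, Y, hX.mono fun φ hφ => ?_, hY.mono fun φ hφ => ?_, f, g, h, hT⟩
    · simpa using hφ.2
    · simpa using hφ.2

theorem isBoundedHeart_interval (a : ℝ) : IsBoundedHeart (S.interval (Set.Ioc a (a + 1))) := by
  refine ⟨S.tStructure a, fun E => ?_, ?_⟩
  · obtain ⟨b, c, h⟩ := S.exists_bounds E
    constructor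
    · refine ⟨-⌈c - a⌉ + 1, ⟨h.mono fun φ hφ => ?_⟩⟩
      simp only [Set.mem_Iic]
      push_cast
      linarith [hφ.2, Int.le_ceil (c - a)]
    · refine ⟨⌈a - b⌉ + 1, ⟨h.mono fun φ hφ => ?_⟩⟩
      simp only [Set.mem_Ioi]
      push_cast
      linarith [hφ.1, Int.le_ceil (a - b)]
  · ext E
    constructor
    · rintro ⟨h1, h2⟩
      refine (interval.inter Set.ordConnected_Ioi Set.ordConnected_Iic h1 h2).mono ?_
      intro φ hφ
      simpa using hφ
    · intro h
      constructor
      · exact h.mono fun φ hφ => by simpa using hφ.1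
      · exact h.mono fun φ hφ => by simpa using hφ.2

end Slicing

variable [IsTriangulated D] {Γ : Type w} [AddCommGroup Γ] {cl : K0 D →+ Γ} {Z : Γ →+ ℂ}
  {A : ObjectProperty D}

theorem mem_heart_of_basicPhase (hA : IsBoundedHeart A) {φ : ℝ} {E : D}
    (h : basicPhase cl Z A φ E) : A E := by
  rcases h with h | ⟨h, -⟩
  · exact hA.of_isZero h
  · exact h

theorem IsVeryWeakPreStability.heart_iff (h : IsVeryWeakPreStability cl Z A) (E : D) :
    A E ↔ h.slicing.interval (Set.Ioc 0 1) E := by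
  constructor
  · intro hE
    rcases heart_towerIn h.isBoundedHeart h.hn hE with h0 | ⟨lo, hi, ht, h1, h2⟩
    · exact .of_isZero h0
    · exact Slicing.interval.mono (S := h.slicing) (fun φ hφ => ⟨h1.trans_le hφ.1, hφ.2.trans h2⟩)
        ht.mem_extClosure
  · intro hE
    induction hE with
    | of_isZero E h0 => exact h.isBoundedHeart.of_isZero h0
    | of_mem E hE =>
      obtain ⟨φ, hφ, hE⟩ := hE
      exact mem_heart_of_basicPhase h.isBoundedHeart ((phase_iff_basicPhase h.isBoundedHeart hφ E).1 hE)
    | ext T hT _ _ h1 h3 => exact h.isBoundedHeart.ext (f := T.mor₁) (g := T.mor₂) (h := T.mor₃) hT h1 h3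

theorem IsVeryWeakPreStability.tiltHeart_eq (h : IsVeryWeakPreStability cl Z A) :
    tiltHeart cl Z A = h.slicing.interval (Set.Ioc (1 / 2) (3 / 2)) := rfl

theorem IsVeryWeakPreStability.isBoundedHeart_tiltHeart (h : IsVeryWeakPreStability cl Z A) :
    IsBoundedHeart (tiltHeart cl Z A) := by
  have := h.slicing.isBoundedHeart_interval (1 / 2)
  norm_num at this
  rwa [h.tiltHeart_eq]

end Slicings

/-! ### Bounded denominators of rational homomorphisms. -/

section Discreteness

theorem exists_common_denominator {Γ : Type w} [AddCommGroup Γ] [Module.Finite ℤ Γ] (f : Γ →+ ℝ)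
    (hf : ∀ x, ∃ q : ℚ, f x = q) : ∃ N : ℕ, 0 < N ∧ ∀ x, ∃ n : ℤ, N * f x = n := by
  choose q hq using hf
  obtain ⟨s, hs⟩ := (Module.Finite.fg_top : (⊤ : Submodule ℤ Γ).FG)
  refine ⟨∏ x ∈ s, (q x).den, Finset.prod_pos fun x _ => (q x).den_pos, fun x => ?_⟩
  have hx : x ∈ Submodule.span ℤ (s : Set Γ) := hs ▸ Submodule.mem_top
  induction hx using Submodule.span_induction with
  | mem x hx =>
    obtain ⟨k, hk⟩ := Finset.dvd_prod_of_mem (fun x => (q x).den) hx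
    refine ⟨k * (q x).num, ?_⟩
    rw [hk, hq]
    push_cast
    have h1 : ((q x).den : ℝ) * (q x : ℝ) = (q x).num := by exact_mod_cast Rat.den_mul_eq_num (q x)
    rw [← h1]; ring
  | zero => exact ⟨0, by simp⟩
  | add x y _ _ hx hy =>
    obtain ⟨m, hm⟩ := hx
    obtain ⟨n, hn⟩ := hy
    exact ⟨m + n, by rw [map_add, mul_add, hm, hn]; push_cast; ring⟩
  | smul a x _ hx =>
    obtain ⟨m, hm⟩ := hx
    exact ⟨a * m, by rw [map_zsmul, zsmul_eq_mul, mul_left_comm, hm]; push_cast; ring⟩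

end Discreteness

/-! ### Values of the tilted central charge on the tilted heart. -/

theorem InUpper.add {z w : ℂ} (hz : InUpper z) (hw : InUpper w) : InUpper (z + w) := by
  have h1 := hz.im_nonneg
  have h2 := hw.im_nonneg
  rcases h1.eq_or_lt with h1 | h1
  · rcases h2.eq_or_lt with h2 | h2
    · exact .inr ⟨by simp [← h1, ← h2], by
        simpa using add_nonpos (hz.re_nonpos h1.symm) (hw.re_nonpos h2.symm)⟩
    · exact .inl (by simpa [← h1] using h2)
  · exact .inl (by simpa using add_pos_of_pos_of_nonneg h1 h2)

/-- The admissible values form a cone containing no line. This is what makes vanishing of a charge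
pass to subobjects and quotients. -/
theorem InUpper.eq_zero_of_add {z w : ℂ} (hz : InUpper z) (hw : InUpper w) (h : z + w = 0) :
    z = 0 ∧ w = 0 := by
  have h1 := hz.im_nonneg
  have h2 := hw.im_nonneg
  have him : z.im + w.im = 0 := by simpa using congrArg Complex.im h
  have hre : z.re + w.re = 0 := by simpa using congrArg Complex.re h
  have hz0 : z.im = 0 := by linarith
  have hw0 : w.im = 0 := by linarith
  have h3 := hz.re_nonpos hz0
  have h4 := hw.re_nonpos hw0
  exact ⟨Complex.ext (by simp; linarith) hz0, Complex.ext (by simp; linarith) hw0⟩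

section Values

variable {D : Type u} [Category.{v} D] [Preadditive D] [HasZeroObject D] [HasShift D ℤ]
  [∀ n : ℤ, (shiftFunctor D n).Additive] [Pretriangulated D]

theorem HasTri.of_eq {X Y Z : D} (h : HasTri X Y Z) : K0.of Y = K0.of X + K0.of Z := by
  obtain ⟨f, g, h, hT⟩ := h
  exact K0.of_triangle hT

theorem K0.of_shift_neg_one (X : D) : K0.of (X⟦(-1 : ℤ)⟧) = -K0.of X := by
  have h := K0.of_shift (X⟦(-1 : ℤ)⟧)
  rw [K0.of_iso (shiftNegShift X (1 : ℤ))] at h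
  rw [h, neg_neg]

variable [IsTriangulated D] {Γ : Type w} [AddCommGroup Γ] {cl : K0 D →+ Γ} {Z : Γ →+ ℂ}
  {A : ObjectProperty D} {ΔR ΔI : Γ →+ ℚ}

theorem tiltCharge_re (Z : Γ →+ ℂ) (ΔI : Γ →+ ℚ) (t : ℝ) (x : Γ) :
    (tiltCharge Z ΔI t x).re = (Z x).im + t * ΔI x := by
  simp [tiltCharge]

theorem tiltCharge_im (Z : Γ →+ ℂ) (ΔI : Γ →+ ℚ) (t : ℝ) (x : Γ) :
    (tiltCharge Z ΔI t x).im = -(Z x).re := by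
  simp [tiltCharge]

section PhaseValues

variable (h : IsVeryWeakPreStability cl Z A)
include h

theorem IsVeryWeakPreStability.of_phase {φ : ℝ} (hφ : φ ∈ Set.Ioo (0 : ℝ) 1) {E : D}
    (hE : phase cl Z A φ E) (h0 : ¬ IsZero E) : ∃ hA : A E, SS (heartCharge cl Z A) ⟨E, hA⟩ ∧
      cslope (Z (cl (K0.of E))) = phaseSlope φ ∧ 0 < (Z (cl (K0.of E))).im ∧
      (Z (cl (K0.of E))).re * Real.sin (Real.pi * φ) =
        (Z (cl (K0.of E))).im * Real.cos (Real.pi * φ) := by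
  obtain ⟨hA, hs, hsl⟩ := basicPhase.slope_eq
    ((phase_iff_basicPhase h.isBoundedHeart (Set.Ioo_subset_Ioc_self hφ) E).1 hE) h0
  have hsin := sin_pi_mul_pos hφ.1 hφ.2
  have hne : (Z (cl (K0.of E))).im ≠ 0 := by
    intro him
    have : cslope (Z (cl (K0.of E))) = ⊤ := cslope_eq_top.2 him
    rw [show cslope (Z (cl (K0.of E))) = phaseSlope φ from hsl, phaseSlope, if_neg hφ.2.ne] at this
    exact WithTop.coe_ne_top this
  refine ⟨hA, hs, hsl, lt_of_le_of_ne (InUpper.im_nonneg (h.upper E hA)) hne.symm, ?_⟩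
  have h2 : cslope (Z (cl (K0.of E))) = phaseSlope φ := hsl
  rw [cslope_of_im_ne hne, phaseSlope, if_neg hφ.2.ne, WithTop.coe_eq_coe,
    div_eq_div_iff hne hsin.ne'] at h2
  linarith

theorem IsVeryWeakPreStability.phase_one_iff (E : D) :
    phase cl Z A 1 E ↔ A E ∧ (Z (cl (K0.of E))).im = 0 := by
  rw [phase_iff_basicPhase h.isBoundedHeart ⟨one_pos, le_rfl⟩]
  constructor
  · rintro (h0 | ⟨hA, hs, hsl⟩)
    · exact ⟨h.isBoundedHeart.of_isZero h0, by simp [K0.of_isZero h0]⟩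
    · rw [if_pos rfl] at hsl
      exact ⟨hA, cslope_eq_top.1 hsl⟩
  · rintro ⟨hA, him⟩
    letI := h.isBoundedHeart.abelian
    refine .inr ⟨hA, SS.of_im_eq_zero (h.isBoundedHeart.isWeakCharge h.upper) him, ?_⟩
    rw [if_pos rfl]
    exact cslope_eq_top.2 him

theorem IsVeryWeakPreStability.phase_one_of_kernelCat {E : D} (hE : kernelCat cl Z A E) :
    phase cl Z A 1 E := (h.phase_one_iff E).2 ⟨hE.1, by simp [hE.2]⟩

theorem IsVeryWeakPreStability.re_neg_of_phase {φ : ℝ} (hφ : φ ∈ Set.Ioo (1 / 2 : ℝ) 1) {E : D}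
    (hE : phase cl Z A φ E) (h0 : ¬ IsZero E) : (Z (cl (K0.of E))).re < 0 := by
  obtain ⟨-, -, -, him, heq⟩ := h.of_phase ⟨by linarith [hφ.1], hφ.2⟩ hE h0
  have hsin := sin_pi_mul_pos (by linarith [hφ.1]) hφ.2
  have hcos : Real.cos (Real.pi * φ) < 0 := Real.cos_neg_of_pi_div_two_lt_of_lt
    (by nlinarith [Real.pi_pos, hφ.1]) (by nlinarith [Real.pi_pos, hφ.2])
  by_contra! hre
  nlinarith [mul_nonneg hre hsin.le, mul_neg_of_pos_of_neg him hcos]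

theorem IsVeryWeakPreStability.re_pos_of_phase {φ : ℝ} (hφ : φ ∈ Set.Ioo (0 : ℝ) (1 / 2)) {E : D}
    (hE : phase cl Z A φ E) (h0 : ¬ IsZero E) : 0 < (Z (cl (K0.of E))).re := by
  obtain ⟨-, -, -, him, heq⟩ := h.of_phase ⟨hφ.1, by linarith [hφ.2]⟩ hE h0
  have hsin := sin_pi_mul_pos hφ.1 (by linarith [hφ.2])
  have hcos : 0 < Real.cos (Real.pi * φ) := Real.cos_pos_of_mem_Ioo
    ⟨by nlinarith [Real.pi_pos, hφ.1], by nlinarith [Real.pi_pos, hφ.2]⟩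
  by_contra! hre
  nlinarith [mul_nonpos_of_nonpos_of_nonneg hre hsin.le, mul_pos him hcos]

theorem IsVeryWeakPreStability.re_eq_zero_of_phase_half {E : D}
    (hE : phase cl Z A (1 / 2) E) (h0 : ¬ IsZero E) : (Z (cl (K0.of E))).re = 0 := by
  obtain ⟨-, -, -, him, heq⟩ := h.of_phase ⟨by norm_num, by norm_num⟩ hE h0
  rw [mul_one_div, Real.sin_pi_div_two, Real.cos_pi_div_two] at heq
  linarith

theorem IsVeryWeakPreStability.phase_shift_neg {φ : ℝ} {E : D} (hE : phase cl Z A φ E) :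
    phase cl Z A (φ - 1) (E⟦(-1 : ℤ)⟧) := by
  have := (phase_shift_iff (cl := cl) (Z := Z) h.isBoundedHeart φ (-1) E).2 hE
  rwa [show φ + ((-1 : ℤ) : ℝ) = φ - 1 by push_cast; ring] at this

end PhaseValues

/-- Values of the central charge on the generators of the tilted heart. -/
theorem IsVeryWeakPreStability.tilt_generator (h : IsVeryWeakPreStability cl Z A) {φ : ℝ}
    (hφ : φ ∈ Set.Ioc (1 / 2 : ℝ) (3 / 2)) {E : D} (hE : phase cl Z A φ E) :
    (Z (cl (K0.of E))).re < 0 ∨ kernelCat cl Z A E ∨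
      φ = 3 / 2 ∧ ¬ IsZero E ∧ (Z (cl (K0.of E))).re = 0 ∧ (Z (cl (K0.of E))).im < 0 ∧
        phase cl Z A (1 / 2) (E⟦(-1 : ℤ)⟧) := by
  by_cases h0 : IsZero E
  · exact .inr (.inl ⟨h.isBoundedHeart.of_isZero h0, by simp [K0.of_isZero h0]⟩)
  rcases lt_trichotomy φ 1 with h1 | rfl | h1
  · exact .inl (h.re_neg_of_phase ⟨hφ.1, h1⟩ hE h0)
  · obtain ⟨hA, him⟩ := (h.phase_one_iff E).1 hE
    rcases (InUpper.re_nonpos (h.upper E hA) him).eq_or_lt with hre | hre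
    · exact .inr (.inl ⟨hA, Complex.ext hre him⟩)
    · exact .inl hre
  · have hE' := h.phase_shift_neg hE
    have h0' : ¬ IsZero (E⟦(-1 : ℤ)⟧) := fun h => h0 (isZero_of_shift h)
    have hval : Z (cl (K0.of (E⟦(-1 : ℤ)⟧))) = -Z (cl (K0.of E)) := by
      rw [K0.of_shift_neg_one, map_neg, map_neg]
    rcases hφ.2.eq_or_lt with rfl | h2
    · rw [show (3 / 2 - 1 : ℝ) = 1 / 2 by norm_num] at hE'
      refine .inr (.inr ⟨rfl, h0, ?_, ?_, hE'⟩)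
      · simpa [hval] using h.re_eq_zero_of_phase_half hE' h0'
      · obtain ⟨-, -, -, him, -⟩ := h.of_phase ⟨by norm_num, by norm_num⟩ hE' h0'
        simpa [hval] using him
    · exact .inl (by simpa [hval] using
        h.re_pos_of_phase ⟨by linarith, by linarith⟩ hE' h0')

theorem IsBGInequality.nonneg_of_phase (hBG : IsBGInequality cl Z A ΔR ΔI)
    (h : IsVeryWeakPreStability cl Z A) {φ : ℝ} {E : D} (hφ : φ ∈ Set.Ioo (0 : ℝ) 1)
    (hE : phase cl Z A φ E) :
    0 ≤ (Z (cl (K0.of E))).re * (ΔR (cl (K0.of E)) : ℝ) +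
      (Z (cl (K0.of E))).im * (ΔI (cl (K0.of E)) : ℝ) := by
  by_cases h0 : IsZero E
  · simp [K0.of_isZero h0]
  obtain ⟨hA, hs, -⟩ := h.of_phase hφ hE h0
  exact hBG.nonneg ⟨E, hA⟩ hs

/-- If `Re Z < 0`, the tilted imaginary part is positive; on `C` the tilted charge equals `t Δ_I ≤
0`. In phase `3/2` the BG inequality for `E[-1]` reads `Im Z · Δ_I ≥ 0` with `Im Z(E) < 0`, so
`Δ_I(E) ≤ 0` and the tilted charge is a negative real number. It can thus vanish only on objects of
`C` with `Δ_I = 0`. -/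
theorem IsBGInequality.tilt_generator (hBG : IsBGInequality cl Z A ΔR ΔI)
    (h : IsVeryWeakPreStability cl Z A) {t : ℝ} (ht : 0 < t) {φ : ℝ}
    (hφ : φ ∈ Set.Ioc (1 / 2 : ℝ) (3 / 2)) {E : D} (hE : phase cl Z A φ E) :
    InUpper (tiltCharge Z ΔI t (cl (K0.of E))) ∧ (tiltCharge Z ΔI t (cl (K0.of E)) = 0 →
      kernelCatDagger cl Z A ΔI E) := by
  rcases h.tilt_generator hφ hE with h1 | h1 | ⟨-, h0, h1, h2, h3⟩
  · refine ⟨.inl ?_, fun h0 => ?_⟩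
    · rw [tiltCharge_im]; linarith
    · have := congrArg Complex.im h0
      rw [tiltCharge_im, Complex.zero_im] at this
      linarith
  · have h3 : (tiltCharge Z ΔI t (cl (K0.of E))).re = t * ΔI (cl (K0.of E)) := by
      rw [tiltCharge_re, h1.2]; simp
    refine ⟨.inr ⟨by rw [tiltCharge_im, h1.2]; simp, ?_⟩, fun h0 => ⟨h1, ?_⟩⟩
    · rw [h3]
      exact mul_nonpos_of_nonneg_of_nonpos ht.le (by exact_mod_cast hBG.ΔI_nonpos E h1)
    · rw [h0, Complex.zero_re, eq_comm, mul_eq_zero] at h3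
      exact_mod_cast h3.resolve_left ht.ne'
  · have hval : Z (cl (K0.of (E⟦(-1 : ℤ)⟧))) = -Z (cl (K0.of E)) := by
      rw [K0.of_shift_neg_one, map_neg, map_neg]
    have hval' : ΔI (cl (K0.of (E⟦(-1 : ℤ)⟧))) = -ΔI (cl (K0.of E)) := by
      rw [K0.of_shift_neg_one, map_neg, map_neg]
    have hb := hBG.nonneg_of_phase h ⟨by norm_num, by norm_num⟩ h3
    rw [hval, hval', Complex.neg_re, Complex.neg_im, h1] at hb
    push_cast at hb
    have hΔ : (ΔI (cl (K0.of E)) : ℝ) ≤ 0 := by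
      by_contra! hpos
      nlinarith [mul_neg_of_neg_of_pos h2 hpos]
    have hre : (tiltCharge Z ΔI t (cl (K0.of E))).re < 0 := by
      rw [tiltCharge_re]
      nlinarith [mul_nonpos_of_nonneg_of_nonpos ht.le hΔ]
    refine ⟨.inr ⟨by rw [tiltCharge_im, h1]; simp, hre.le⟩, fun h0 => ?_⟩
    rw [h0] at hre
    simp at hre

theorem IsBoundedHeart.kernelCat_ext (hA : IsBoundedHeart A) {X Y W : D} (h : HasTri X Y W)
    (hX : kernelCat cl Z A X) (hW : kernelCat cl Z A W) : kernelCat cl Z A Y := by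
  refine ⟨?_, by rw [h.of_eq, map_add, map_add, hX.2, hW.2, add_zero]⟩
  obtain ⟨f, g, k, hT⟩ := h
  exact hA.ext hT hX.1 hW.1

theorem IsBoundedHeart.kernelCat_of_isZero (hA : IsBoundedHeart A) {X : D} (h : IsZero X) :
    kernelCat cl Z A X := ⟨hA.of_isZero h, by simp [K0.of_isZero h]⟩

theorem IsBGInequality.tilt_upper (hBG : IsBGInequality cl Z A ΔR ΔI)
    (h : IsVeryWeakPreStability cl Z A) {t : ℝ} (ht : 0 < t) {E : D} (hE : tiltHeart cl Z A E) :
    InUpper (tiltCharge Z ΔI t (cl (K0.of E))) ∧ (tiltCharge Z ΔI t (cl (K0.of E)) = 0 →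
      kernelCatDagger cl Z A ΔI E) := by
  induction hE with
  | of_isZero E h0 =>
    refine ⟨.inr (by simp [K0.of_isZero h0]), fun _ => ⟨h.isBoundedHeart.kernelCat_of_isZero h0, ?_⟩⟩
    simp [K0.of_isZero h0]
  | of_mem E hE =>
    obtain ⟨φ, hφ, hE⟩ := hE
    exact hBG.tilt_generator h ht hφ hE
  | ext T hT _ _ h1 h3 =>
    have htri : HasTri T.obj₁ T.obj₂ T.obj₃ := ⟨_, _, _, hT⟩
    rw [htri.of_eq, map_add, map_add]
    refine ⟨h1.1.add h3.1, fun h0 => ?_⟩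
    obtain ⟨h4, h5⟩ := h1.1.eq_zero_of_add h3.1 h0
    refine ⟨h.isBoundedHeart.kernelCat_ext htri (h1.2 h4).1 (h3.2 h5).1, ?_⟩
    rw [htri.of_eq, map_add, map_add, (h1.2 h4).2, (h3.2 h5).2, add_zero]

theorem IsVeryWeakPreStability.tiltHeart_of_kernelCat (h : IsVeryWeakPreStability cl Z A) {E : D}
    (hE : kernelCat cl Z A E) : tiltHeart cl Z A E :=
  .of_mem _ ⟨1, by norm_num, h.phase_one_of_kernelCat hE⟩

theorem IsBGInequality.kernelCat_tilt (hBG : IsBGInequality cl Z A ΔR ΔI)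
    (h : IsVeryWeakPreStability cl Z A) {t : ℝ} (ht : 0 < t) :
    kernelCat cl (tiltCharge Z ΔI t) (tiltHeart cl Z A) = kernelCatDagger cl Z A ΔI := by
  ext E
  constructor
  · rintro ⟨h1, h2⟩
    exact (hBG.tilt_upper h ht h1).2 h2
  · intro hE
    refine ⟨h.tiltHeart_of_kernelCat hE.1, Complex.ext ?_ ?_⟩
    · rw [tiltCharge_re, hE.1.2, hE.2]; simp
    · rw [tiltCharge_im, hE.1.2]; simp

/-- Objects of `P((1/2, 3/2))` with `Re Z = 0` have `Z = 0` and lie in the original heart. -/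
theorem IsVeryWeakPreStability.kernelCat_of_re_eq_zero (h : IsVeryWeakPreStability cl Z A) {E : D}
    (hE : h.slicing.interval (Set.Ioo (1 / 2) (3 / 2)) E) (hre : (Z (cl (K0.of E))).re = 0) :
    kernelCat cl Z A E := by
  -- The inequality has to be carried along: in an extension with `Re Z = 0` it forces both outer
  -- terms to have `Re Z = 0`.
  suffices (Z (cl (K0.of E))).re ≤ 0 ∧ ((Z (cl (K0.of E))).re = 0 → kernelCat cl Z A E) from
    this.2 hre
  clear hre
  induction hE with
  | of_isZero E h0 =>
    exact ⟨by simp [K0.of_isZero h0], fun _ => h.isBoundedHeart.kernelCat_of_isZero h0⟩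
  | of_mem E hE =>
    obtain ⟨φ, hφ, hE⟩ := hE
    rcases h.tilt_generator (Set.Ioo_subset_Ioc_self hφ) hE with h1 | h1 | ⟨rfl, -⟩
    · exact ⟨h1.le, fun h2 => absurd h2 h1.ne⟩
    · exact ⟨by simp [h1.2], fun _ => h1⟩
    · exact absurd hφ.2 (lt_irrefl _)
  | ext T hT _ _ h1 h3 =>
    have htri : HasTri T.obj₁ T.obj₂ T.obj₃ := ⟨_, _, _, hT⟩
    rw [htri.of_eq, map_add, map_add, Complex.add_re]
    refine ⟨add_nonpos h1.1 h3.1, fun h0 => ?_⟩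
    have h4 := h1.1
    have h5 := h3.1
    exact h.isBoundedHeart.kernelCat_ext htri (h1.2 (by linarith)) (h3.2 (by linarith))

end Values

/-! ### Torsion with respect to the kernel of a weak charge, and relatively injective extensions. -/

section Torsion

variable {𝒜 : Type u} [Category.{v} 𝒜] [Abelian 𝒜]

/-- Take `S` maximal with `P`. The kernel subobject in the statement is the preimage in `E` of the
image of `f`; it contains `S`, so if it satisfies `P` it equals `S`, and then `f` vanishes. -/
theorem exists_maximal_subobject {E : 𝒜} (hE : IsNoetherianObject E) (P : Subobject E → Prop)
    (h0 : ∃ S, P S) : ∃ S, P S ∧ ∀ (X : 𝒜) (f : X ⟶ cokernel S.arrow),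
      P (kernelSubobject (cokernel.π S.arrow ≫ cokernel.π f)) → f = 0 := by
  obtain ⟨S, hS, hmax⟩ := WellFounded.has_min (wellFounded_gt (α := Subobject E)) {S | P S} h0
  refine ⟨S, hS, fun X f hf => ?_⟩
  have hle : S ≤ kernelSubobject (cokernel.π S.arrow ≫ cokernel.π f) :=
    le_kernelSubobject _ _ (by simp)
  have heq : S = kernelSubobject (cokernel.π S.arrow ≫ cokernel.π f) := by
    by_contra hne
    exact hmax _ hf (lt_of_le_of_ne hle hne)
  have h1 : (kernelSubobject (cokernel.π S.arrow ≫ cokernel.π f)).arrow ≫ cokernel.π S.arrow = 0 := by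
    rw [← Subobject.ofLE_arrow heq.ge, Category.assoc, cokernel.condition, comp_zero]
  have h2 : kernel.ι (cokernel.π S.arrow ≫ cokernel.π f) ≫ cokernel.π S.arrow = 0 := by
    rw [← kernelSubobject_arrow', Category.assoc, h1, comp_zero]
  obtain ⟨l, hl⟩ := (IsSES.of_epi (cokernel.π S.arrow ≫ cokernel.π f)).exists_desc _ h2
  have h3 : cokernel.π f ≫ l = 𝟙 _ := by
    rw [← cancel_epi (cokernel.π S.arrow), ← Category.assoc, hl, Category.comp_id]
  rw [← Category.comp_id f, ← h3, cokernel.condition_assoc, zero_comp]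

variable {W : 𝒜 → ℂ} (hW : IsWeakCharge W)

/-- `E` has no nonzero map from an object on which `W` vanishes. -/
def KernelFree (W : 𝒜 → ℂ) (E : 𝒜) : Prop := ∀ X : 𝒜, W X = 0 → ∀ f : X ⟶ E, f = 0

include hW

theorem IsWeakCharge.eq_zero_of_ses {X Y Z : 𝒜} {i : X ⟶ Y} {p : Y ⟶ Z} (h : IsSES i p)
    (hY : W Y = 0) : W X = 0 ∧ W Z = 0 :=
  (hW.upper X).eq_zero_of_add (hW.upper Z) ((hW.add h).symm.trans hY)

theorem IsWeakCharge.eq_zero_of_mono {X Y : 𝒜} (i : X ⟶ Y) [Mono i] (hY : W Y = 0) : W X = 0 :=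
  (hW.eq_zero_of_ses (IsSES.of_mono i) hY).1

theorem IsWeakCharge.eq_zero_of_epi {X Y : 𝒜} (p : X ⟶ Y) [Epi p] (hX : W X = 0) : W Y = 0 :=
  (hW.eq_zero_of_ses (IsSES.of_epi p) hX).2

theorem IsWeakCharge.image_eq_zero {X Y : 𝒜} (f : X ⟶ Y) (hX : W X = 0) :
    W (Abelian.image f) = 0 :=
  hW.eq_zero_of_epi (Abelian.factorThruImage f) hX

theorem exists_kernel_torsion {E : 𝒜} (hE : IsNoetherianObject E) :
    ∃ (T F : 𝒜) (i : T ⟶ E) (p : E ⟶ F), IsSES i p ∧ W T = 0 ∧ KernelFree W F := by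
  obtain ⟨S, hS, hmax⟩ := exists_maximal_subobject hE (fun S => W (S : 𝒜) = 0)
    ⟨⊥, hW.zero ((isZero_zero 𝒜).of_iso Subobject.botCoeIsoZero)⟩
  refine ⟨_, _, _, _, IsSES.of_mono S.arrow, hS, fun X hX f => hmax X f ?_⟩
  rw [hW.iso (kernelSubobjectIso _)]
  have h1 := hW.add (IsSES.of_epi (cokernel.π S.arrow ≫ cokernel.π f))
  have h2 := hW.add (IsSES.of_mono S.arrow)
  have h3 : W (cokernel S.arrow) = W (Abelian.image f) + W (cokernel f) :=
    hW.add (IsSES.of_epi (cokernel.π f))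
  rw [hW.image_eq_zero f hX, zero_add] at h3
  rw [h1, hS, zero_add, h3] at h2
  simpa using h2

/-- Extensions of objects of the kernel by a torsion-free object are torsion-free as soon as
they are kernel-free. -/
theorem KernelFree.torsionFree_of_ses {V U K : 𝒜} {i : V ⟶ U} {p : U ⟶ K} (h : IsSES i p)
    (hV : TorsionFree W V) (hK : W K = 0) (hU : KernelFree W U) : TorsionFree W U := by
  intro T hT f
  have h1 : kernel.ι (Abelian.factorThruImage (f ≫ p)) ≫ f = 0 := by
    obtain ⟨l, hl⟩ := h.exists_lift (kernel.ι (Abelian.factorThruImage (f ≫ p)) ≫ f) (by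
      have h2 := kernel.condition (Abelian.factorThruImage (f ≫ p)) =≫ Abelian.image.ι (f ≫ p)
      rwa [Category.assoc, Abelian.image.fac, zero_comp, ← Category.assoc] at h2)
    rw [← hl, hV _ _ l, zero_comp]
    exact le_antisymm ((hW.im_le_of_mono (kernel.ι _)).trans_eq hT) (hW.upper _).im_nonneg
  obtain ⟨l, hl⟩ := (IsSES.of_epi (Abelian.factorThruImage (f ≫ p))).exists_desc f h1
  rw [← hl, hU _ (hW.eq_zero_of_mono (Abelian.image.ι (f ≫ p)) hK) l, comp_zero]

/-- An object `K` with `W K = 0` changes neither the charge nor the lower bound on slopes of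
quotients; kernel-freeness supplies the torsion-freeness needed for the semistability criterion. -/
theorem KernelFree.ss_of_ses {V U K : 𝒜} {i : V ⟶ U} {p : U ⟶ K} (h : IsSES i p)
    (hV : SS W V) (hVim : (W V).im ≠ 0) (hK : W K = 0) (hU : KernelFree W U) :
    SS W U ∧ W U = W V := by
  have hWU : W U = W V := by rw [hW.add h, hK, add_zero]
  have hs : cslope (W V) = ((-(W V).re / (W V).im : ℝ) : WithTop ℝ) := cslope_of_im_ne hVim
  refine ⟨SS.of_slopesGE hW (a := -(W V).re / (W V).im) (KernelFree.torsionFree_of_ses hW h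
    (SS.torsionFree hW hV (by rw [hs]; exact WithTop.coe_ne_top)) hK hU) ?_ (by rw [hWU, hs]), hWU⟩
  exact SlopesGE.ext hW h (SlopesGE.of_ss hW hV hs.ge) (SlopesGE.of_im_eq_zero hW _ (by simp [hK]))

/-- A kernel-free object `V` has a kernel-free extension `U` by an object of the kernel such that
every extension of an object of the kernel by `U` splits, provided that such `U` have a minimal
value of `d` and embed into objects that are injective relative to the kernel of `W` and `d`. -/
theorem exists_relatively_injective (hN : ∀ E : 𝒜, IsNoetherianObject E) (d : 𝒜 → ℤ)
    (hd : ∀ {X Y Z : 𝒜} {i : X ⟶ Y} {p : Y ⟶ Z}, IsSES i p → d Y = d X + d Z)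
    (hd0 : ∀ X, W X = 0 → d X ≤ 0) {V : 𝒜} (hV : KernelFree W V) (m : ℤ)
    (hm : ∀ (U K : 𝒜) (i : V ⟶ U) (p : U ⟶ K), IsSES i p → W K = 0 → KernelFree W U → m ≤ d U)
    (hull : ∀ (U K : 𝒜) (i : V ⟶ U) (p : U ⟶ K), IsSES i p → W K = 0 → KernelFree W U →
      ∃ (U' : 𝒜) (j : U ⟶ U'), Mono j ∧ ∀ (X Y K : 𝒜) (a : X ⟶ Y) (b : Y ⟶ K), IsSES a b →
        W K = 0 → d K = 0 → ∀ g : X ⟶ U', ∃ g', a ≫ g' = g) :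
    ∃ (U K : 𝒜) (i : V ⟶ U) (p : U ⟶ K), IsSES i p ∧ W K = 0 ∧ KernelFree W U ∧
      ∀ (E L : 𝒜) (a : U ⟶ E) (b : E ⟶ L), IsSES a b → W L = 0 → ∃ s, s ≫ b = 𝟙 L := by
  classical
  -- minimal value of `d`
  let P : ℕ → Prop := fun n => ∃ (U K : 𝒜) (i : V ⟶ U) (p : U ⟶ K), IsSES i p ∧ W K = 0 ∧
    KernelFree W U ∧ d U = m + n
  have hP : ∃ n, P n := by
    have hz := (isZero_zero 𝒜)
    have hid : IsSES (𝟙 V) (0 : V ⟶ (0 : 𝒜)) := IsSES.of_id V hz 0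
    have hle := hm V 0 _ _ hid (hW.zero hz) hV
    exact ⟨(d V - m).toNat, V, 0, _, _, hid, hW.zero hz, hV, by omega⟩
  obtain ⟨U₀, K₀, i₀, p₀, h₀, hK₀, hU₀, hd₀⟩ := Nat.find_spec hP
  have hmin : ∀ (U K : 𝒜) (i : V ⟶ U) (p : U ⟶ K), IsSES i p → W K = 0 → KernelFree W U →
      d U₀ ≤ d U := by
    intro U K i p h hK hU
    have hle := hm U K i p h hK hU
    have := Nat.find_min' hP ⟨U, K, i, p, h, hK, hU, show d U = m + (d U - m).toNat by omega⟩
    omega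
  obtain ⟨U', j, hj, hinj⟩ := hull U₀ K₀ i₀ p₀ h₀ hK₀ hU₀
  have hWF := hN U'
  -- Among the kernel-free extensions of `U₀` by kernel objects that lie in the hull `U'`, a maximal
  -- one exists because `U'` is noetherian.
  let Q : Subobject U' → Prop := fun S => ∃ (U K : 𝒜) (g : U ⟶ U') (_ : Mono g) (u : U₀ ⟶ U)
    (p : U ⟶ K), S = Subobject.mk g ∧ u ≫ g = j ∧ IsSES u p ∧ W K = 0 ∧ KernelFree W U
  have hQ : ∃ S, Q S := ⟨_, U₀, 0, j, hj, 𝟙 U₀, 0, rfl, Category.id_comp _,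
    IsSES.of_id U₀ (isZero_zero 𝒜) 0, hW.zero (isZero_zero 𝒜), hU₀⟩
  obtain ⟨S, ⟨U, K, g, hg, u, p, rfl, hug, hup, hK, hU⟩, hmax⟩ :=
    WellFounded.has_min (wellFounded_gt (α := Subobject U')) {S | Q S} hQ
  have hm₀ := h₀.mono
  have hmu := hup.mono
  have hV₁ : IsSES (i₀ ≫ u) (cokernel.π (i₀ ≫ u)) := IsSES.of_mono _
  have hWV₁ : W (cokernel (i₀ ≫ u)) = 0 := by
    have h1 := hW.add hV₁
    rw [hW.add hup, hW.add h₀, hK, hK₀] at h1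
    simpa using h1
  refine ⟨U, _, _, _, hV₁, hWV₁, hU, fun E L a b hab hL => ?_⟩
  -- Dividing `E` by its kernel torsion gives a kernel-free `F`. Since `U` is kernel-free, it meets
  -- `T` trivially and still embeds in `F`.
  obtain ⟨T, F, t, q, htq, hT, hF⟩ := exists_kernel_torsion hW (hN E)
  have hma := hab.mono
  have hmt := htq.mono
  have haq : Mono (a ≫ q) := by
    refine Preadditive.mono_of_kernel_zero ?_
    obtain ⟨l, hl⟩ := htq.exists_lift (kernel.ι (a ≫ q) ≫ a) (by
      rw [Category.assoc, kernel.condition])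
    have : Mono (l ≫ t) := hl ▸ inferInstance
    have : Mono l := mono_of_mono l t
    exact hU _ (hW.eq_zero_of_mono l hT) _
  have hM : IsSES (a ≫ q) (cokernel.π (a ≫ q)) := IsSES.of_mono _
  have hWF : W F = W U := by
    have h1 := hW.add htq
    rw [hT, hW.add hab, hL, add_zero, zero_add] at h1
    exact h1.symm
  have hWM : W (cokernel (a ≫ q)) = 0 := by
    have h1 := hW.add hM
    rw [hWF] at h1
    simpa using h1
  -- By minimality `d U₀ ≤ d F = d U₀ + d K + d (F / U)`, and the last two terms are nonpositive, so
  -- both vanish. Hence the lifting property of the hull applies to `F / U`.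
  have hdM : d (cokernel (a ≫ q)) = 0 := by
    have h1 := hmin F _ (i₀ ≫ u ≫ a ≫ q) _ (IsSES.of_mono _) (by
      have h1 := hW.add (IsSES.of_mono (i₀ ≫ u ≫ a ≫ q))
      rw [hWF, hW.add hup, hW.add h₀, hK, hK₀] at h1
      simpa using h1) hF
    have h2 := hd0 _ hK
    have h3 := hd0 _ hWM
    have h4 := hd hM
    have h5 := hd hup
    omega
  obtain ⟨g', hg'⟩ := hinj _ _ _ _ _ hM hWM hdM g
  -- The kernel of `g'` meets `U` trivially, hence embeds in `F / U`, where `W` vanishes; as `F` is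
  -- kernel-free, it is zero.
  have hmg' : Mono g' := by
    refine Preadditive.mono_of_kernel_zero (hF _ ?_ _)
    refine @IsWeakCharge.eq_zero_of_mono _ _ _ _ hW _ _ (kernel.ι g' ≫ cokernel.π (a ≫ q)) ?_ hWM
    rw [Preadditive.mono_iff_cancel_zero]
    intro X k hk
    obtain ⟨l, hl⟩ := hM.exists_lift (k ≫ kernel.ι g') (by rw [Category.assoc, hk])
    have h1 : l ≫ g = 0 := by
      rw [← hg', ← Category.assoc, hl, Category.assoc, kernel.condition, comp_zero]
    have h2 : l = 0 := (cancel_mono g).1 (h1.trans zero_comp.symm)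
    rw [← cancel_mono (kernel.ι g'), ← hl, h2, zero_comp, zero_comp]
  have hle : Subobject.mk g ≤ Subobject.mk g' := Subobject.mk_le_mk_of_comm (a ≫ q) hg'
  -- By maximality `F` is no larger than `U` inside `U'`. This produces a retraction `E → F → U` of
  -- `a`, hence a splitting.
  have hge : Subobject.mk g' ≤ Subobject.mk g := by
    by_contra hnot
    refine hmax (Subobject.mk g') ⟨F, _, g', hmg', u ≫ a ≫ q, cokernel.π (u ≫ a ≫ q), rfl, ?_,
      IsSES.of_mono _, ?_, hF⟩ (lt_of_le_not_ge hle hnot)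
    · rw [Category.assoc, hg', hug]
    · have h1 := hW.add (IsSES.of_mono (u ≫ a ≫ q))
      rw [hWF, hW.add hup, hK] at h1
      simpa using h1
  have hs : Subobject.ofMkLEMk g' g hge ≫ g = g' := Subobject.ofMkLEMk_comp hge
  have hret : a ≫ q ≫ Subobject.ofMkLEMk g' g hge = 𝟙 U := by
    rw [← cancel_mono g, Category.assoc, Category.assoc, hs, Category.id_comp, ← hg', Category.assoc]
  obtain ⟨σ, hσ⟩ := hab.exists_desc (𝟙 E - (q ≫ Subobject.ofMkLEMk g' g hge) ≫ a) (by
    rw [Preadditive.comp_sub, Category.comp_id, ← Category.assoc, hret, Category.id_comp, sub_self])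
  have := hab.epi
  refine ⟨σ, ?_⟩
  rw [← cancel_epi b, ← Category.assoc, hσ, Preadditive.sub_comp, Category.id_comp, Category.assoc,
    hab.1, comp_zero, sub_zero, Category.comp_id]

end Torsion

/-! ### Extensions `U` of semistable objects with `Hom(C, U[1]) = 0`. -/

section RelativelyInjective

variable {D : Type u} [Category.{v} D] [Preadditive D] [HasZeroObject D] [HasShift D ℤ]
  [∀ n : ℤ, (shiftFunctor D n).Additive] [Pretriangulated D]

theorem HasTri.exists_extension {X Y Z T : D} {f : X ⟶ Y} {g : Y ⟶ Z} {h : Z ⟶ X⟦(1 : ℤ)⟧}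
    (hT : Triangle.mk f g h ∈ distTriang D) (k : X ⟶ T) (hk : h ≫ k⟦(1 : ℤ)⟧' = 0) :
    ∃ l : Y ⟶ T, f ≫ l = k := by
  obtain ⟨l, hl⟩ : ∃ l : Y⟦(1 : ℤ)⟧ ⟶ T⟦(1 : ℤ)⟧, k⟦(1 : ℤ)⟧' = (-f⟦(1 : ℤ)⟧') ≫ l :=
    Triangle.yoneda_exact₂ _ (rot_of_distTriang _ (rot_of_distTriang _ hT)) (k⟦(1 : ℤ)⟧') hk
  refine ⟨-(shiftFunctor D (1 : ℤ)).preimage l, (shiftFunctor D (1 : ℤ)).map_injective ?_⟩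
  rw [Functor.map_comp, Functor.map_neg, Functor.map_preimage, hl]
  simp

theorem HasTri.connecting_eq_zero {X Y Z : D} {f : X ⟶ Y} {g : Y ⟶ Z} {h : Z ⟶ X⟦(1 : ℤ)⟧}
    (hT : Triangle.mk f g h ∈ distTriang D) (s : Z ⟶ Y) (hs : s ≫ g = 𝟙 Z) : h = 0 := by
  have h0 : g ≫ h = 0 := comp_distTriang_mor_zero₂₃ _ hT
  rw [← Category.id_comp h, ← hs, Category.assoc, h0, comp_zero]

theorem exists_hasTri_of_connecting {X Z : D} (h : Z ⟶ X⟦(1 : ℤ)⟧) :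
    ∃ (Y : D) (f : X ⟶ Y) (g : Y ⟶ Z), Triangle.mk f g h ∈ distTriang D :=
  distinguished_cocone_triangle₂ h

variable [IsTriangulated D] {Γ : Type w} [AddCommGroup Γ] {cl : K0 D →+ Γ} {Z : Γ →+ ℂ}
  {A : ObjectProperty D} {ΔR ΔI : Γ →+ ℚ}

theorem IsVeryWeakPreStability.phase_of_ss (h : IsVeryWeakPreStability cl Z A) {φ : ℝ}
    (hφ : φ ∈ Set.Ioc (0 : ℝ) 1) {E : A.FullSubcategory} (hE : SS (heartCharge cl Z A) E)
    (hs : cslope (heartCharge cl Z A E) = phaseSlope φ) : phase cl Z A φ E.obj :=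
  (phase_iff_basicPhase h.isBoundedHeart hφ _).2 (.inr ⟨E.property, hE, hs⟩)

/-- Applies `exists_relatively_injective` with `d` an integral multiple of `Δ_I`. Kernel-free
extensions `U` of `V` by objects of `C` stay semistable of the same phase, so the hull of goodness
is available for them; vanishing against `C†` gives the lifting property when `d = 0`. -/
theorem exists_kernelCat_injective [Module.Finite ℤ Γ] (h : IsVeryWeakPreStability cl Z A)
    (hBG : IsBGInequality cl Z A ΔR ΔI) (hgood : IsGood cl Z A ΔI) {φ : ℝ}
    (hφ : φ ∈ Set.Ioo (0 : ℝ) 1) {V : D} (hV : phase cl Z A φ V) :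
    ∃ U K, HasTri V U K ∧ phase cl Z A φ U ∧ kernelCat cl Z A K ∧
      ∀ X, kernelCat cl Z A X → ∀ f : X ⟶ U⟦(1 : ℤ)⟧, f = 0 := by
  by_cases hV0 : IsZero V
  · exact ⟨V, 0, HasTri.of_isZero_right (isZero_zero D), hV,
      h.isBoundedHeart.kernelCat_of_isZero (isZero_zero D),
      fun X _ f => (isZero_shift hV0 1).eq_of_tgt _ _⟩
  letI := h.isBoundedHeart.abelian
  have hW : IsWeakCharge (heartCharge cl Z A) := h.isBoundedHeart.isWeakCharge h.upper
  obtain ⟨hVA, hVs, hVsl, hVim, -⟩ := h.of_phase hφ hV hV0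
  obtain ⟨N, hN, hd⟩ := exists_common_denominator ((Rat.castHom ℝ).toAddMonoidHom.comp ΔI)
    (fun x => ⟨ΔI x, rfl⟩)
  choose d₀ hd₀ using hd
  let d : A.FullSubcategory → ℤ := fun E => d₀ (cl (K0.of E.obj))
  have hdE : ∀ E : A.FullSubcategory, (N : ℝ) * (ΔI (cl (K0.of E.obj)) : ℝ) = d E :=
    fun E => hd₀ _
  have hN' : (0 : ℝ) < N := by exact_mod_cast hN
  let V' : A.FullSubcategory := ⟨V, hVA⟩
  have hVtf : TorsionFree (heartCharge cl Z A) V' := SS.torsionFree hW hVs (by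
    intro h0
    exact hVim.ne' (cslope_eq_top.1 h0))
  have key : ∀ (U K : A.FullSubcategory) (i : V' ⟶ U) (p : U ⟶ K), IsSES i p →
      heartCharge cl Z A K = 0 → KernelFree (heartCharge cl Z A) U →
      SS (heartCharge cl Z A) U ∧ heartCharge cl Z A U = heartCharge cl Z A V' ∧
        phase cl Z A φ U.obj := by
    intro U K i p hip hK hU
    obtain ⟨h1, h2⟩ := KernelFree.ss_of_ses hW hip hVs hVim.ne' hK hU
    exact ⟨h1, h2, h.phase_of_ss (Set.Ioo_subset_Ioc_self hφ) h1 (by rw [h2]; exact hVsl)⟩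
  obtain ⟨U, K, i, p, hip, hK, hU, hsplit⟩ := exists_relatively_injective hW hgood.noetherian d
    (fun {X Y W i p} hip => by
      obtain ⟨δ, hT⟩ := h.isBoundedHeart.triangle_of_shortExact hip.2
      have : ((d Y : ℤ) : ℝ) = d X + d W := by
        rw [← hdE, ← hdE, ← hdE, K0.of_triangle hT]
        push_cast [map_add]
        ring
      exact_mod_cast this)
    (fun X hX => by
      have h1 := hBG.ΔI_nonpos X.obj ⟨X.property, hX⟩
      have h2 : ((d X : ℤ) : ℝ) ≤ 0 := by
        rw [← hdE]
        exact mul_nonpos_of_nonneg_of_nonpos hN'.le (by exact_mod_cast h1)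
      exact_mod_cast h2)
    (V := V') (fun X hX f => hVtf X (by rw [hX]; rfl) f)
    -- The BG inequality for `U`, solved for `Δ_I(U)`. It involves only data of `V`, since `Z` and
    -- `Δ_R` vanish on `C`.
    ⌊(N : ℝ) * (-((Z (cl (K0.of V))).re * (ΔR (cl (K0.of V)) : ℝ)) / (Z (cl (K0.of V))).im)⌋
    (fun U K i p hip hK hU => by
      obtain ⟨h1, h2, -⟩ := key U K i p hip hK hU
      obtain ⟨δ, hT⟩ := h.isBoundedHeart.triangle_of_shortExact hip.2
      have h3 := hBG.nonneg U h1
      have h4 : Z (cl (K0.of U.obj)) = Z (cl (K0.of V)) := h2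
      have h5 : ΔR (cl (K0.of U.obj)) = ΔR (cl (K0.of V)) := by
        rw [K0.of_triangle hT, map_add, map_add, hBG.ΔR_eq_zero K.obj ⟨K.property, hK⟩, add_zero]
      rw [h4, h5] at h3
      have h6 : (⌊(N : ℝ) * (-((Z (cl (K0.of V))).re * (ΔR (cl (K0.of V)) : ℝ)) /
          (Z (cl (K0.of V))).im)⌋ : ℝ) ≤ d U := by
        refine (Int.floor_le _).trans ?_
        rw [← hdE]
        refine mul_le_mul_of_nonneg_left ?_ hN'.le
        rw [div_le_iff₀ hVim]
        linarith
      exact_mod_cast h6)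
    (fun U K i p hip hK hU => by
      obtain ⟨h1, h2, h3⟩ := key U K i p hip hK hU
      obtain ⟨U', j, hj, hvan⟩ := hgood.hull φ hφ U h3
      refine ⟨U', j, hj, fun X Y L a b hab hL hdL g => ?_⟩
      obtain ⟨δ, hT⟩ := h.isBoundedHeart.triangle_of_shortExact hab.2
      obtain ⟨l, hl⟩ := HasTri.exists_extension hT g.hom (hvan L.obj ⟨⟨L.property, hL⟩, by
        have := hdE L
        rw [hdL, Int.cast_zero, mul_eq_zero] at this
        exact_mod_cast this.resolve_left hN'.ne'⟩ _)
      exact ⟨ObjectProperty.homMk l, ObjectProperty.hom_ext _ hl⟩)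
  obtain ⟨δ, hT⟩ := h.isBoundedHeart.triangle_of_shortExact hip.2
  refine ⟨U.obj, K.obj, ⟨_, _, _, hT⟩, (key U K i p hip hK hU).2.2, ⟨K.property, hK⟩, ?_⟩
  intro X hX f
  -- `f` is the class of an extension of `X` by `U` in the heart; a splitting makes it zero.
  obtain ⟨E, a, b, hE⟩ := exists_hasTri_of_connecting f
  have hEA : A E := h.isBoundedHeart.ext hE U.property hX.1
  have hses := h.isBoundedHeart.shortExact_of_triangle (X := U) (Y := ⟨E, hEA⟩) (Z := ⟨X, hX.1⟩)
    (ObjectProperty.homMk a) (ObjectProperty.homMk b) f hE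
  obtain ⟨s, hs⟩ := hsplit ⟨E, hEA⟩ ⟨X, hX.1⟩ _ _ hses hX.2
  exact HasTri.connecting_eq_zero hE s.hom (congrArg (fun f => f.hom) hs)

end RelativelyInjective

/-! ### Radicals in the tilted heart and the HN property. -/

section Radical

variable {D : Type u} [Category.{v} D] [Preadditive D] [HasZeroObject D] [HasShift D ℤ]
  [∀ n : ℤ, (shiftFunctor D n).Additive] [Pretriangulated D]

theorem iso_of_hasTri_of_eq {X X' Y Z : D} {f : X ⟶ Y} {f' : X' ⟶ Y} {g : Y ⟶ Z}
    {h : Z ⟶ X⟦(1 : ℤ)⟧} {h' : Z ⟶ X'⟦(1 : ℤ)⟧} (hT : Triangle.mk f g h ∈ distTriang D)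
    (hT' : Triangle.mk f' g h' ∈ distTriang D) : Nonempty (X ≅ X') := by
  have e := isoTriangleOfIso₁₂ _ _ (rot_of_distTriang _ hT) (rot_of_distTriang _ hT')
    (Iso.refl Y) (Iso.refl Z) ((Category.comp_id g).trans (Category.id_comp g).symm)
  exact ⟨(shiftFunctor D (1 : ℤ)).preimageIso (Triangle.π₃.mapIso e)⟩

variable [IsTriangulated D] {Γ : Type w} [AddCommGroup Γ] {cl : K0 D →+ Γ} {Z : Γ →+ ℂ}
  {A : ObjectProperty D} {ΔR ΔI : Γ →+ ℚ}

variable (cl Z A) in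
/-- There is a triangle `K → E → Q` with `K` in the kernel category and `Q` in the tilted heart
without maps from the kernel category. -/
def HasKernelRadical (E : D) : Prop :=
  ∃ K Q, HasTri K E Q ∧ kernelCat cl Z A K ∧ tiltHeart cl Z A Q ∧
    ∀ X, kernelCat cl Z A X → ∀ f : X ⟶ Q, f = 0

/-- Let `f : K → N[1]` be the class of the extension. The radical is a maximal subobject `S` of `K`
on which `f` vanishes, and `Q` is the extension of `K / S` by `N` given by the induced class. A map
from `C` to `Q` has image in `K / S` on which this class vanishes, so by maximality it lands in `N`,
where it is zero. -/
theorem HasKernelRadical.of_extension (h : IsVeryWeakPreStability cl Z A)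
    (hN : ∀ E : A.FullSubcategory, IsNoetherianObject E) {N E K : D} (htri : HasTri N E K)
    (hNA : tiltHeart cl Z A N) (hN0 : ∀ X, kernelCat cl Z A X → ∀ f : X ⟶ N, f = 0)
    (hK : kernelCat cl Z A K) : HasKernelRadical cl Z A E := by
  letI := h.isBoundedHeart.abelian
  have hW : IsWeakCharge (heartCharge cl Z A) := h.isBoundedHeart.isWeakCharge h.upper
  obtain ⟨n, e, f, hT⟩ := htri
  let K' : A.FullSubcategory := ⟨K, hK.1⟩
  obtain ⟨S, hS, hmax⟩ := exists_maximal_subobject (hN K')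
    (fun S => S.arrow.hom ≫ f = 0) ⟨⊥, by
      rw [Subobject.bot_arrow]
      exact zero_comp⟩
  obtain ⟨hS0, hK0⟩ := hW.eq_zero_of_ses (IsSES.of_mono S.arrow) hK.2
  obtain ⟨δ, hS'⟩ := h.isBoundedHeart.triangle_of_shortExact (IsSES.of_mono S.arrow).2
  obtain ⟨f', hf'⟩ := HasTri.exists_desc_of_hom hS' f hS
  obtain ⟨Q, a, b, hQ⟩ := exists_hasTri_of_connecting f'
  -- The fibre `W` of the composite `K → K / S → N[1]` is an extension of `Q` by `S`. The composite
  -- is `f`, whose fibre is also `E`.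
  obtain ⟨W, i, δ', a', b', ε, hW1, hW2, -⟩ := exists_octahedron' hS' (rot_of_distTriang _ hQ)
  replace hW1 : Triangle.mk i f δ' ∈ distTriang D := hf' ▸ hW1
  obtain ⟨eWE⟩ := iso_of_hasTri_of_eq hW1 (rot_of_distTriang _ hT)
  refine ⟨(S : A.FullSubcategory).obj, Q, HasTri.of_iso ⟨_, _, _, hW2⟩ (Iso.refl _) eWE
    (Iso.refl _), ⟨(S : A.FullSubcategory).property, hS0⟩, ?_, ?_⟩
  · exact Slicing.interval.ext (S := h.slicing) ⟨_, _, _, hQ⟩ hNA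
      (h.tiltHeart_of_kernelCat ⟨(cokernel S.arrow).property, hK0⟩)
  · intro X hX u
    let X' : A.FullSubcategory := ⟨X, hX.1⟩
    let v : X' ⟶ cokernel S.arrow := ObjectProperty.homMk (u ≫ b)
    have hbf : b ≫ f' = 0 := comp_distTriang_mor_zero₂₃ _ hQ
    have himg : (Abelian.image.ι v).hom ≫ f' = 0 := by
      have hses := IsSES.of_epi (Abelian.factorThruImage v)
      obtain ⟨δ₂, hT₂⟩ := h.isBoundedHeart.triangle_of_shortExact hses.2
      obtain ⟨l, hl⟩ := HasTri.exists_desc_of_hom_right hT₂ ((Abelian.image.ι v).hom ≫ f') (by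
        have h1 : (Abelian.factorThruImage v).hom ≫ (Abelian.image.ι v).hom = u ≫ b :=
          congrArg (fun f => f.hom) (Abelian.image.fac v)
        change (Abelian.factorThruImage v).hom ≫ (Abelian.image.ι v).hom ≫ f' = 0
        rw [← Category.assoc, h1, Category.assoc, hbf, comp_zero])
      have hl0 : (shiftFunctor D (1 : ℤ)).preimage l = 0 :=
        hN0 _ ⟨(kernel (Abelian.factorThruImage v)).property,
          hW.eq_zero_of_mono (X := kernel (Abelian.factorThruImage v)) (Y := X') (kernel.ι _) hX.2⟩ _
      have hl1 : l = 0 := by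
        rw [← (shiftFunctor D (1 : ℤ)).map_preimage l, hl0, Functor.map_zero]
      rw [← hl, hl1, comp_zero]
    have hv : v = 0 := by
      refine hmax X' v ?_
      obtain ⟨l, hl⟩ : ∃ l, l ≫ Abelian.image.ι v =
          (kernelSubobject (cokernel.π S.arrow ≫ cokernel.π v)).arrow ≫ cokernel.π S.arrow :=
        ⟨kernel.lift _ _ (by rw [Category.assoc, kernelSubobject_arrow_comp]), kernel.lift_ι _ _ _⟩
      have hl' := congrArg (fun f => f.hom) hl
      change l.hom ≫ (Abelian.image.ι v).hom =
        (kernelSubobject (cokernel.π S.arrow ≫ cokernel.π v)).arrow.hom ≫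
          (cokernel.π S.arrow).hom at hl'
      rw [← hf']
      change _ ≫ (cokernel.π S.arrow).hom ≫ f' = 0
      rw [← Category.assoc, ← hl', Category.assoc, himg, comp_zero]
    have hub : u ≫ b = 0 := congrArg (fun f => f.hom) hv
    obtain ⟨l, rfl⟩ := HasTri.exists_mid_of_hom hQ u hub
    rw [hN0 X hX l, zero_comp]

/-- After dividing `E` by `K₁`, the preimage `E''` of `K₂` is an extension of `K₂` by `Q₁`, to which
`HasKernelRadical.of_extension` applies. Its radical is an object of `C` and is glued to `K₁`. -/
theorem HasKernelRadical.ext (h : IsVeryWeakPreStability cl Z A)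
    (hN : ∀ E : A.FullSubcategory, IsNoetherianObject E) {E₁ E E₂ : D} (htri : HasTri E₁ E E₂)
    (h₁ : HasKernelRadical cl Z A E₁) (h₂ : HasKernelRadical cl Z A E₂) :
    HasKernelRadical cl Z A E := by
  obtain ⟨K₁, Q₁, ht₁, hK₁, hQ₁, hv₁⟩ := h₁
  obtain ⟨K₂, Q₂, ht₂, hK₂, hQ₂, hv₂⟩ := h₂
  obtain ⟨E', h3, h4⟩ := htri.octahedron ht₁
  obtain ⟨E'', h5, h6⟩ := h4.octahedron' ht₂
  obtain ⟨K₃, Q₃, h7, hK₃, hQ₃, hv₃⟩ := HasKernelRadical.of_extension h hN h6 hQ₁ hv₁ hK₂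
  obtain ⟨Q', h8, h9⟩ := h5.octahedron h7
  obtain ⟨L, h10, h11⟩ := h3.octahedron' h8
  exact ⟨L, Q', h10, h.isBoundedHeart.kernelCat_ext h11 hK₁ hK₃,
    Slicing.interval.ext (S := h.slicing) h9 hQ₃ hQ₂,
    fun X hX f => h9.hom_eq_zero_to (hv₃ X hX) (hv₂ X hX) f⟩

/-- Below phase `1` there are no maps from `C`, and in phase `1` noetherianity gives the kernel
torsion. Above phase `1`, put `V = E[-1]`: the triangle `V → U → K` rotates to `K → E → U[1]`, and
`Hom(C, U[1]) = 0`. -/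
theorem HasKernelRadical.of_phase [Module.Finite ℤ Γ] (h : IsVeryWeakPreStability cl Z A)
    (hBG : IsBGInequality cl Z A ΔR ΔI) (hgood : IsGood cl Z A ΔI) {φ : ℝ}
    (hφ : φ ∈ Set.Ioc (1 / 2 : ℝ) (3 / 2)) {E : D} (hE : phase cl Z A φ E) :
    HasKernelRadical cl Z A E := by
  rcases lt_trichotomy φ 1 with h1 | rfl | h1
  · exact ⟨0, E, HasTri.of_isZero_left (isZero_zero D),
      h.isBoundedHeart.kernelCat_of_isZero (isZero_zero D), .of_mem _ ⟨φ, hφ, hE⟩, fun X hX f =>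
      phase_hom_eq_zero h.isBoundedHeart h.upper h1 (h.phase_one_of_kernelCat hX) hE f⟩
  · letI := h.isBoundedHeart.abelian
    have hW : IsWeakCharge (heartCharge cl Z A) := h.isBoundedHeart.isWeakCharge h.upper
    obtain ⟨hA, him⟩ := (h.phase_one_iff E).1 hE
    obtain ⟨T, F, i, p, hip, hT, hF⟩ := exists_kernel_torsion hW (hgood.noetherian ⟨E, hA⟩)
    obtain ⟨δ, htri⟩ := h.isBoundedHeart.triangle_of_shortExact hip.2
    refine ⟨T.obj, F.obj, ⟨_, _, _, htri⟩, ⟨T.property, hT⟩, .of_mem _ ⟨1, hφ,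
      (h.phase_one_iff _).2 ⟨F.property, ?_⟩⟩, fun X hX f => ?_⟩
    · have h2 := K0.of_triangle htri
      have h3 : Z (cl (K0.of T.obj)) = 0 := hT
      have h4 : Z (cl (K0.of E)) = Z (cl (K0.of F.obj)) := by
        rw [h2, map_add, map_add, h3, zero_add]
      rw [← h4, him]
    · exact congrArg (fun f => f.hom) (hF ⟨X, hX.1⟩ hX.2 (ObjectProperty.homMk f))
  · obtain ⟨U, K, ht, hU, hK, hv⟩ := exists_kernelCat_injective h hBG hgood
      (φ := φ - 1) ⟨by linarith, by linarith [hφ.2]⟩ (h.phase_shift_neg hE)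
    refine ⟨K, U⟦(1 : ℤ)⟧, ht.rotate.rotate.of_iso (Iso.refl _) (shiftNegShift E (1 : ℤ))
      (Iso.refl _), hK, .of_mem _ ⟨φ, hφ, ?_⟩, hv⟩
    have := (phase_shift_iff (cl := cl) (Z := Z) h.isBoundedHeart (φ - 1) 1 U).2 hU
    simpa using this

theorem HasKernelRadical.of_tiltHeart [Module.Finite ℤ Γ] (h : IsVeryWeakPreStability cl Z A)
    (hBG : IsBGInequality cl Z A ΔR ΔI) (hgood : IsGood cl Z A ΔI) {E : D}
    (hE : tiltHeart cl Z A E) : HasKernelRadical cl Z A E := by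
  induction hE with
  | of_isZero E h0 =>
    exact ⟨0, E, HasTri.of_isZero_left (isZero_zero D),
      h.isBoundedHeart.kernelCat_of_isZero (isZero_zero D), .of_isZero _ h0,
      fun X hX f => h0.eq_of_tgt _ _⟩
  | of_mem E hE =>
    obtain ⟨φ, hφ, hE⟩ := hE
    exact HasKernelRadical.of_phase h hBG hgood hφ hE
  | ext T hT _ _ h1 h3 => exact HasKernelRadical.ext h hgood.noetherian ⟨_, _, _, hT⟩ h1 h3

theorem IsVeryWeakPreStability.re_eq_zero_of_phase_three_half
    (h : IsVeryWeakPreStability cl Z A) {X : D} (hX' : phase cl Z A (3 / 2) X) :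
    (Z (cl (K0.of X))).re = 0 := by
  by_cases h0 : IsZero X
  · simp [K0.of_isZero h0]
  have h1 := h.phase_shift_neg hX'
  rw [show (3 / 2 - 1 : ℝ) = 1 / 2 by norm_num] at h1
  have h2 := h.re_eq_zero_of_phase_half h1 fun h => h0 (isZero_of_shift h)
  rw [K0.of_shift_neg_one, map_neg, map_neg] at h2
  simpa using h2

/-- Objects of the tilted heart with `Re Z = 0` are extensions of an object of the kernel category
by an object of phase `3 / 2`. -/
theorem IsVeryWeakPreStability.exists_hasTri_of_re_eq_zero (h : IsVeryWeakPreStability cl Z A)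
    {E : D} (hE : tiltHeart cl Z A E) (hre : (Z (cl (K0.of E))).re = 0) :
    ∃ X Y, HasTri X E Y ∧ phase cl Z A (3 / 2) X ∧ kernelCat cl Z A Y := by
  rw [h.tiltHeart_eq] at hE
  obtain ⟨X, Y, htri, hX, hY⟩ := hE.truncation Set.ordConnected_Ioc (isUpperSet_Ici (3 / 2))
  have hX' : phase cl Z A (3 / 2) X := Slicing.interval.singleton (S := h.slicing)
    (hX.mono fun φ hφ => le_antisymm hφ.1.2 hφ.2)
  have hY' : h.slicing.interval (Set.Ioo (1 / 2) (3 / 2)) Y :=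
    hY.mono fun φ hφ => ⟨hφ.1.1, not_le.1 hφ.2⟩
  refine ⟨X, Y, htri, hX', h.kernelCat_of_re_eq_zero hY' ?_⟩
  rw [htri.of_eq, map_add, map_add, Complex.add_re,
    h.re_eq_zero_of_phase_three_half hX', zero_add] at hre
  exact hre

/-- The torsion pair of the tilted heart whose torsion part is given by `Re Z = 0`. -/
theorem exists_tilt_radical [Module.Finite ℤ Γ] (h : IsVeryWeakPreStability cl Z A)
    (hBG : IsBGInequality cl Z A ΔR ΔI) (hgood : IsGood cl Z A ΔI) {E : D}
    (hE : tiltHeart cl Z A E) : ∃ L Q, HasTri L E Q ∧ tiltHeart cl Z A L ∧ tiltHeart cl Z A Q ∧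
      (Z (cl (K0.of L))).re = 0 ∧ ∀ X, tiltHeart cl Z A X → (Z (cl (K0.of X))).re = 0 →
        ∀ f : X ⟶ Q, f = 0 := by
  have hE' := hE
  rw [h.tiltHeart_eq] at hE
  obtain ⟨A₁, E₂, htri, hA₁, hE₂⟩ := hE.truncation Set.ordConnected_Ioc (isUpperSet_Ici (3 / 2))
  have hA₁' : phase cl Z A (3 / 2) A₁ := Slicing.interval.singleton (S := h.slicing)
    (hA₁.mono fun φ hφ => le_antisymm hφ.1.2 hφ.2)
  have hE₂' : h.slicing.interval (Set.Ioo (1 / 2) (3 / 2)) E₂ :=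
    hE₂.mono fun φ hφ => ⟨hφ.1.1, not_le.1 hφ.2⟩
  have hE₂'' : tiltHeart cl Z A E₂ := Slicing.interval.mono (S := h.slicing)
    (fun φ hφ => Set.Ioo_subset_Ioc_self hφ) hE₂'
  obtain ⟨K, Q, ht, hK, hQ, hv⟩ := HasKernelRadical.of_tiltHeart h hBG hgood hE₂''
  obtain ⟨L, h1, h2⟩ := htri.octahedron' ht
  have hA₁A : tiltHeart cl Z A A₁ := .of_mem _ ⟨3 / 2, by norm_num, hA₁'⟩
  refine ⟨L, Q, h1, Slicing.interval.ext (S := h.slicing) h2 hA₁A (h.tiltHeart_of_kernelCat hK), hQ,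
    ?_, ?_⟩
  · rw [h2.of_eq, map_add, map_add, hK.2, add_zero, h.re_eq_zero_of_phase_three_half hA₁']
  · have hone : ∀ X, phase cl Z A (3 / 2) X → ∀ f : X ⟶ Q, f = 0 := by
      intro X hX u
      obtain ⟨k, q, δ, hT⟩ := ht
      -- `Y` is the pullback of `E₂ → Q` along `u`, an extension of `X` by `K` with `Re Z = 0`. Its
      -- phase `3/2` part has no maps to `E₂`, so `Y → Q` factors through an object of `C` and
      -- vanishes. Then `u` factors through `K[1]`, of phase `2`, and vanishes too.
      obtain ⟨Y, k', y, hY⟩ := exists_hasTri_of_connecting (u ≫ δ)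
      obtain ⟨m, hm⟩ : ∃ m : Y ⟶ E₂, y ≫ u = m ≫ q := by
        obtain ⟨m, -, hm⟩ := complete_distinguished_triangle_morphism₂ _ _ hY hT (𝟙 K) u
          (by
            change (u ≫ δ) ≫ (𝟙 K)⟦(1 : ℤ)⟧' = u ≫ δ
            rw [CategoryTheory.Functor.map_id, Category.comp_id])
        exact ⟨m, hm⟩
      have hYt : HasTri K Y X := ⟨_, _, _, hY⟩
      have hYA : tiltHeart cl Z A Y := Slicing.interval.ext (S := h.slicing) hYt
        (h.tiltHeart_of_kernelCat hK) (.of_mem _ ⟨3 / 2, by norm_num, hX⟩)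
      obtain ⟨Y₁, Y₂, ⟨a, b, ε, hab⟩, hY₁, hY₂⟩ := h.exists_hasTri_of_re_eq_zero hYA (by
        rw [hYt.of_eq, map_add, map_add, hK.2, zero_add, h.re_eq_zero_of_phase_three_half hX])
      obtain ⟨m₂, hm₂⟩ := HasTri.exists_desc_of_hom hab m
        (Slicing.interval.hom_eq_zero (S := h.slicing) (I := {3 / 2}) (by
          rintro φ rfl ψ hψ
          exact hψ.2) (.of_mem _ ⟨_, rfl, hY₁⟩) hE₂' _)
      have hyu : y ≫ u = 0 := by
        rw [hm, ← hm₂, Category.assoc, hv Y₂ hY₂ (m₂ ≫ q), comp_zero]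
      obtain ⟨l, hl⟩ := HasTri.exists_desc_of_hom_right hY u hyu
      have hK1 : phase cl Z A 2 (K⟦(1 : ℤ)⟧) := by
        have := (phase_shift_iff (cl := cl) (Z := Z) h.isBoundedHeart 1 1 K).2
          (h.phase_one_of_kernelCat hK)
        rwa [show (1 : ℝ) + ((1 : ℤ) : ℝ) = 2 by norm_num] at this
      have hl0 : l = 0 := Slicing.interval.hom_eq_zero (S := h.slicing) (I := {2}) (by
          rintro φ rfl ψ hψ
          linarith [hψ.2]) (.of_mem _ ⟨2, rfl, hK1⟩) hQ l
      rw [← hl, hl0, comp_zero]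
    intro X hX hre f
    obtain ⟨X₁, X₂, hX12, hX₁, hX₂⟩ := h.exists_hasTri_of_re_eq_zero hX hre
    exact hX12.hom_eq_zero_from (hone X₁ hX₁) (hv X₂ hX₂) f

theorem IsGood.exists_im_tiltCharge_eq [Module.Finite ℤ Γ] (hgood : IsGood cl Z A ΔI)
    (t : ℝ) : ∃ c : ℝ, 0 < c ∧ ∀ x, ∃ n : ℤ, (tiltCharge Z ΔI t x).im = c * n := by
  obtain ⟨ζ₁, ζ₂, h1, -, hr⟩ := hgood.rational
  let f : Γ →+ ℝ := (AddMonoidHom.mulLeft (-ζ₁⁻¹)).comp (Complex.reAddGroupHom.comp Z)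
  have hf : ∀ x, f x = -ζ₁⁻¹ * (Z x).re := fun x => rfl
  obtain ⟨N, hN, hd⟩ := exists_common_denominator f fun x => by
    obtain ⟨a, b, hab⟩ := hr x
    refine ⟨-a, ?_⟩
    rw [hf, hab]
    simp
    field_simp
  have hN' : (0 : ℝ) < N := by exact_mod_cast hN
  refine ⟨ζ₁ / N, by positivity, fun x => ?_⟩
  obtain ⟨n, hn⟩ := hd x
  refine ⟨n, ?_⟩
  rw [← hn, hf, tiltCharge_im]
  field_simp

theorem isVeryWeakPreStability_tilt [Module.Finite ℤ Γ] (h : IsVeryWeakPreStability cl Z A)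
    (hBG : IsBGInequality cl Z A ΔR ΔI) (hgood : IsGood cl Z A ΔI) {t : ℝ} (ht : 0 < t) :
    IsVeryWeakPreStability cl (tiltCharge Z ΔI t) (tiltHeart cl Z A) := by
  have hup := fun E (hE : tiltHeart cl Z A E) => (hBG.tilt_upper h ht hE).1
  obtain ⟨c, hc, hd⟩ := hgood.exists_im_tiltCharge_eq t
  refine ⟨h.isBoundedHeart_tiltHeart, hup, h.isBoundedHeart_tiltHeart.nonempty_hnFiltration hup hc
    (fun E hE => ?_) fun E => ?_⟩
  · obtain ⟨n, hn⟩ := hd (cl (K0.of E))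
    have h0 : (0 : ℝ) ≤ n := by
      have := InUpper.im_nonneg (hup E hE)
      rw [hn] at this
      exact nonneg_of_mul_nonneg_right this hc
    lift n to ℕ using by exact_mod_cast h0
    exact ⟨n, by simpa using hn⟩
  · obtain ⟨L, Q, ⟨f, g, δ, hT⟩, hL, hQ, hre, hv⟩ := exists_tilt_radical h hBG hgood E.property
    have him : ∀ x, (tiltCharge Z ΔI t x).im = 0 ↔ (Z x).re = 0 := fun x => by
      rw [tiltCharge_im, neg_eq_zero]
    refine ⟨⟨L, hL⟩, ⟨Q, hQ⟩, ObjectProperty.homMk f, ObjectProperty.homMk g,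
      h.isBoundedHeart_tiltHeart.shortExact_of_triangle (X := ⟨L, hL⟩) (Y := E) (Z := ⟨Q, hQ⟩)
        _ _ δ hT, (him _).2 hre, fun X hX f => ?_⟩
    exact ObjectProperty.hom_ext _ (hv X.obj X.property ((him _).1 hX) f.hom)

end Radical

/-! ### Bounds from a form that is negative definite on a kernel. -/

section QuadraticBounds

/-- Compactness of the unit sphere: on its closed part where `q ≥ 0` the map `L` has no zero, so `‖L
x‖` has a positive minimum there. -/
theorem exists_norm_le_of_nonneg {E : Type*} [NormedAddCommGroup E] [NormedSpace ℝ E]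
    [FiniteDimensional ℝ E] (q : QuadraticForm ℝ E) (L : E →ₗ[ℝ] ℂ)
    (hneg : ∀ x, L x = 0 → x ≠ 0 → q x < 0) :
    (∃ m : ℝ, 0 < m ∧ ∀ x, 0 ≤ q x → m * ‖x‖ ≤ ‖L x‖) ∧ ∃ B : ℝ, 0 < B ∧ ∀ x, q x ≤ B * ‖x‖ ^ 2 := by
  have hq : Continuous q := by
    have h1 : ∀ x, q x = (QuadraticMap.associated (R := ℝ) q).toContinuousBilinearMap x x :=
      fun x => (QuadraticMap.associated_eq_self_apply ℝ q x).symm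
    rw [show (q : E → ℝ) = _ from funext h1]
    fun_prop
  have hL : Continuous L := L.continuous_of_finiteDimensional
  have hscale : ∀ x : E, x ≠ 0 → ‖(‖x‖⁻¹ : ℝ) • x‖ = 1 := fun x hx => by
    rw [norm_smul, norm_inv, norm_norm, inv_mul_cancel₀ (norm_ne_zero_iff.2 hx)]
  have hqs : ∀ x : E, q ((‖x‖⁻¹ : ℝ) • x) = ‖x‖⁻¹ * ‖x‖⁻¹ * q x := fun x => by
    rw [QuadraticMap.map_smul, smul_eq_mul]
  constructor
  · have hK : IsCompact (Metric.sphere (0 : E) 1 ∩ {x | 0 ≤ q x}) :=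
      (isCompact_sphere 0 1).inter_right (isClosed_le continuous_const hq)
    by_cases hne : (Metric.sphere (0 : E) 1 ∩ {x | 0 ≤ q x}).Nonempty
    · obtain ⟨x₀, ⟨hx₀, hq₀⟩, hmin⟩ := hK.exists_isMinOn hne hL.norm.continuousOn
      have hx0 : x₀ ≠ 0 := by
        rintro rfl
        simp at hx₀
      refine ⟨‖L x₀‖, norm_pos_iff.2 fun h0 => absurd (hneg x₀ h0 hx0) (not_lt.2 hq₀), fun x hx => ?_⟩
      by_cases hx' : x = 0
      · simp [hx']
      have hpos := norm_pos_iff.2 hx'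
      have h1 : ‖L x₀‖ ≤ ‖L ((‖x‖⁻¹ : ℝ) • x)‖ := hmin ⟨by simpa using hscale x hx', by
        change 0 ≤ q _
        rw [hqs]; positivity⟩
      rw [map_smul, norm_smul, norm_inv, norm_norm, inv_mul_eq_div, le_div_iff₀ hpos] at h1
      exact h1
    · refine ⟨1, one_pos, fun x hx => ?_⟩
      by_cases hx' : x = 0
      · simp [hx']
      refine absurd ⟨(‖x‖⁻¹ : ℝ) • x, by simpa using hscale x hx', ?_⟩ hne
      change 0 ≤ q _
      rw [hqs]; positivity
  · obtain ⟨B, hB⟩ := (isCompact_sphere (0 : E) 1).exists_bound_of_continuousOn hq.continuousOn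
    refine ⟨max B 1, lt_max_of_lt_right one_pos, fun x => ?_⟩
    by_cases hx' : x = 0
    · simp [hx']
    have hpos := norm_pos_iff.2 hx'
    have h1 := (le_abs_self _).trans (hB ((‖x‖⁻¹ : ℝ) • x) (by simpa using hscale x hx'))
    have h2 : q x = ‖x‖ ^ 2 * q ((‖x‖⁻¹ : ℝ) • x) := by
      rw [hqs]; field_simp
    rw [h2, mul_comm]
    exact mul_le_mul_of_nonneg_right (h1.trans (le_max_left _ _)) (by positivity)

variable {V : Type*} [AddCommGroup V] [Module ℝ V] [Module.Finite ℝ V] (q : QuadraticForm ℝ V)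
  (L : V →ₗ[ℝ] ℂ) (hneg : ∀ x, L x = 0 → x ≠ 0 → q x < 0)
include hneg

theorem exists_le_sq_norm : ∃ C : ℝ, 0 < C ∧ ∀ x, q x ≤ C * ‖L x‖ ^ 2 := by
  let e := (Module.finBasis ℝ V).equivFun
  obtain ⟨⟨m, hm, h1⟩, B, hB, h2⟩ := exists_norm_le_of_nonneg (q.comp e.symm.toLinearMap)
    (L ∘ₗ e.symm.toLinearMap) (fun x h0 hx => hneg _ h0 (by simpa using hx))
  refine ⟨B / m ^ 2, by positivity, fun x => ?_⟩
  have h1' := h1 (e x)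
  have h2' := h2 (e x)
  simp only [QuadraticMap.comp_apply, LinearEquiv.coe_coe, LinearEquiv.symm_apply_apply,
    LinearMap.comp_apply] at h1' h2'
  by_cases hx : 0 ≤ q x
  · refine h2'.trans ?_
    have h3 : (m * ‖e x‖) ^ 2 ≤ ‖L x‖ ^ 2 := pow_le_pow_left₀ (by positivity) (h1' hx) 2
    rw [div_mul_eq_mul_div, le_div_iff₀ (by positivity)]
    nlinarith
  · exact (not_le.1 hx).le.trans (by positivity)

theorem exists_abs_le_norm (δ : V →ₗ[ℝ] ℝ) :
    ∃ C : ℝ, 0 < C ∧ ∀ x, 0 ≤ q x → |δ x| ≤ C * ‖L x‖ := by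
  let e := (Module.finBasis ℝ V).equivFun
  obtain ⟨⟨m, hm, h1⟩, -⟩ := exists_norm_le_of_nonneg (q.comp e.symm.toLinearMap)
    (L ∘ₗ e.symm.toLinearMap) (fun x h0 hx => hneg _ h0 (by simpa using hx))
  let δ' := (δ ∘ₗ e.symm.toLinearMap).toContinuousLinearMap
  refine ⟨(‖δ'‖ + 1) / m, by positivity, fun x hx => ?_⟩
  have h1' := h1 (e x)
  simp only [QuadraticMap.comp_apply, LinearEquiv.coe_coe, LinearEquiv.symm_apply_apply,
    LinearMap.comp_apply] at h1'
  have h2 : |δ x| ≤ ‖δ'‖ * ‖e x‖ := by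
    have := δ'.le_opNorm (e x)
    simpa [δ'] using this
  have h3 : |δ x| ≤ (‖δ'‖ + 1) * ‖e x‖ := h2.trans (by nlinarith [norm_nonneg (e x)])
  rw [div_mul_eq_mul_div, le_div_iff₀ hm]
  calc |δ x| * m ≤ (‖δ'‖ + 1) * ‖e x‖ * m := mul_le_mul_of_nonneg_right h3 hm.le
    _ = (‖δ'‖ + 1) * (m * ‖e x‖) := by ring
    _ ≤ _ := mul_le_mul_of_nonneg_left (h1' hx) (by positivity)

end QuadraticBounds

/-! ### Numerical wall-crossing for lists of vectors. -/

section WallCrossing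

variable {V : Type*} [AddCommGroup V] [Module ℝ V] (R I δ : V →ₗ[ℝ] ℝ)

/-- The orientation of the pair of vectors `(I + s δ) + i R` at `x` and `y`; it is positive
when the slope `-(I + s δ) / R` is larger at `x`. -/
def orientation (s : ℝ) (x y : V) : ℝ := (I y + s * δ y) * R x - (I x + s * δ x) * R y

variable {R I δ}

theorem orientation_add_left (s : ℝ) (x x' y : V) :
    orientation R I δ s (x + x') y = orientation R I δ s x y + orientation R I δ s x' y := by
  simp only [orientation, map_add]; ring

theorem orientation_add_right (s : ℝ) (x y y' : V) :
    orientation R I δ s x (y + y') = orientation R I δ s x y + orientation R I δ s x y' := by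
  simp only [orientation, map_add]; ring

theorem orientation_pos_trans {s : ℝ} {x y z : V} (hx : 0 < R x) (hy : 0 < R y) (hz : 0 < R z)
    (h1 : 0 < orientation R I δ s x y) (h2 : 0 < orientation R I δ s y z) :
    0 < orientation R I δ s x z := by
  have : R y * orientation R I δ s x z =
      R z * orientation R I δ s x y + R x * orientation R I δ s y z := by
    simp only [orientation]; ring
  have h3 : 0 < R y * orientation R I δ s x z := by rw [this]; positivity
  exact (mul_pos_iff_of_pos_left hy).1 h3

theorem pairwise_orientation_pos {s : ℝ} : ∀ l : List V, (∀ x ∈ l, 0 < R x) →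
    (∀ l₁ x y l₂, l = l₁ ++ x :: y :: l₂ → 0 < orientation R I δ s x y) →
    l.Pairwise fun x y => 0 < orientation R I δ s x y
  | [], _, _ => List.Pairwise.nil
  | [x], _, _ => List.pairwise_singleton _ _
  | x :: y :: l, hR, h => by
    have ih := pairwise_orientation_pos (y :: l) (fun z hz => hR z (List.mem_cons_of_mem _ hz))
      (fun l₁ a b l₂ hl => h (x :: l₁) a b l₂ (by rw [hl]; rfl))
    have hxy := h [] x y l rfl
    refine List.pairwise_cons.2 ⟨fun z hz => ?_, ih⟩
    rcases List.mem_cons.1 hz with rfl | hz'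
    · exact hxy
    · exact orientation_pos_trans (hR x (by simp)) (hR y (by simp)) (hR z (by simp [hz'])) hxy
        (List.rel_of_pairwise_cons ih hz')

theorem orientation_sum_pos {s : ℝ} {x : V} : ∀ l : List V, l ≠ [] →
    (∀ y ∈ l, 0 < orientation R I δ s x y) → 0 < orientation R I δ s x l.sum
  | [], h, _ => absurd rfl h
  | [y], _, h => by simpa using h y (by simp)
  | y :: z :: l, _, h => by
    rw [List.sum_cons, orientation_add_right]
    exact add_pos (h y (by simp)) (orientation_sum_pos (z :: l) (by simp)
      fun a ha => h a (List.mem_cons_of_mem _ ha))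

/-- Either all the orientations are still positive at `s`, or there is a first wall. -/
theorem exists_first_wall {s₀ s : ℝ} (hs : s₀ ≤ s) {l : List V}
    (h : l.Pairwise fun x y => 0 ≤ orientation R I δ s₀ x y) :
    (l.Pairwise fun x y => 0 < orientation R I δ s x y) ∨ ∃ s' ∈ Set.Icc s₀ s,
      (l.Pairwise fun x y => 0 ≤ orientation R I δ s' x y) ∧
      ¬ l.Pairwise fun x y => 0 < orientation R I δ s' x y := by
  classical
  let F : Finset (Fin l.length × Fin l.length) := Finset.univ.filter fun p => p.1 < p.2
  have hmem : ∀ p, p ∈ F ↔ p.1 < p.2 := fun p => by simp [F]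
  have hiff : ∀ r : V → V → Prop, l.Pairwise r ↔ ∀ p ∈ F, r (l.get p.1) (l.get p.2) := fun r => by
    rw [List.pairwise_iff_get]
    exact ⟨fun h p hp => h p.1 p.2 ((hmem p).1 hp), fun h i j hij => h (i, j) ((hmem _).2 hij)⟩
  by_cases hF : F.Nonempty
  -- The minimum of finitely many continuous orientations; a wall is a zero of it, found by the
  -- intermediate value theorem.
  · let g : ℝ → ℝ := fun s => F.inf' hF fun p => orientation R I δ s (l.get p.1) (l.get p.2)
    have hg : Continuous g := by
      refine Continuous.finset_inf'_apply hF fun p _ => ?_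
      unfold orientation
      fun_prop
    rw [hiff] at h
    have h0 : 0 ≤ g s₀ := Finset.le_inf' _ _ h
    by_cases h1 : 0 < g s
    · left
      rw [hiff]
      exact fun p hp => h1.trans_le (Finset.inf'_le _ hp)
    · right
      obtain ⟨s', hs', hgs'⟩ := intermediate_value_Icc' hs hg.continuousOn ⟨not_lt.1 h1, h0⟩
      refine ⟨s', hs', (hiff _).2 fun p hp => hgs'.ge.trans (Finset.inf'_le _ hp), fun hpos => ?_⟩
      obtain ⟨p, hp, heq⟩ := Finset.exists_mem_eq_inf' hF
        fun p => orientation R I δ s' (l.get p.1) (l.get p.2)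
      exact absurd ((hiff _).1 hpos p hp) (by rw [← heq]; exact not_lt.2 hgs'.le)
  · left
    rw [hiff]
    exact fun p hp => absurd ⟨p, hp⟩ hF

/-- For aligned `x` and `y` the vector `R y · x - R x · y` lies in the kernel at time `s`, where `q
≤ 0`. Expanding shows that the polar form of `x` and `y` is nonnegative. -/
theorem quadraticForm_add_nonneg {q : QuadraticForm ℝ V} {s : ℝ}
    (hneg : ∀ x, R x = 0 → I x + s * δ x = 0 → q x ≤ 0) {x y : V} (hx : 0 < R x) (hy : 0 < R y)
    (hqx : 0 ≤ q x) (hqy : 0 ≤ q y) (h0 : orientation R I δ s x y = 0) : 0 ≤ q (x + y) := by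
  have h1 := hneg (R y • x + (-R x) • y) (by simp; ring) (by
    simp only [orientation] at h0
    simp only [map_add, map_smul, smul_eq_mul]
    linarith)
  rw [QuadraticMap.map_add q, QuadraticMap.map_smul, QuadraticMap.map_smul,
    QuadraticMap.polar_smul_left, QuadraticMap.polar_smul_right] at h1
  simp only [smul_eq_mul] at h1
  have h2 : 0 ≤ QuadraticMap.polar q x y := by
    have h3 : 0 ≤ (R x * R y) * QuadraticMap.polar q x y := by
      nlinarith [mul_nonneg (mul_self_nonneg (R y)) hqx, mul_nonneg (mul_self_nonneg (R x)) hqy]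
    exact nonneg_of_mul_nonneg_right h3 (by positivity)
  rw [QuadraticMap.map_add q]
  positivity

/-- If the slopes of `v₁, …, vₙ` are decreasing at time `s₀`, and no initial partial sum
destabilizes at time `s`, then `q` is nonnegative on the sum. -/
theorem quadraticForm_sum_nonneg {q : QuadraticForm ℝ V} {s : ℝ} (n : ℕ) :
    ∀ (s₀ : ℝ) (l : List V), l.length = n → s₀ ≤ s →
    (∀ s' ∈ Set.Icc s₀ s, ∀ x, R x = 0 → I x + s' * δ x = 0 → q x ≤ 0) →
    (∀ x ∈ l, 0 < R x ∧ 0 ≤ q x) →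
    (l.Pairwise fun x y => 0 ≤ orientation R I δ s₀ x y) →
    (∀ l₁ l₂, l = l₁ ++ l₂ → l₁ ≠ [] → l₂ ≠ [] → orientation R I δ s l₁.sum l₂.sum ≤ 0) →
    0 ≤ q l.sum := by
  induction n with
  | zero =>
    intro s₀ l hl _ _ _ _ _
    rw [List.length_eq_zero_iff.1 hl]
    simp
  | succ n ih =>
    intro s₀ l hl hs hneg hmem hpw hsplit
    rcases exists_first_wall hs hpw with h | ⟨s', hs', hpw', hnot⟩
    -- If all orientations are positive at the final time, the first vector would destabilize the
    -- sum, unless it is the only one.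
    · match l, hl, hmem, h, hsplit with
      | [x], _, hmem, _, _ => simpa using (hmem x (by simp)).2
      | x :: y :: l, _, _, h, hsplit =>
        have h1 := orientation_sum_pos (y :: l) (by simp) (List.pairwise_cons.1 h).1
        have h2 := hsplit [x] (y :: l) rfl (by simp) (by simp)
        rw [List.sum_singleton] at h2
        exact absurd h1 (not_lt.2 h2)
    -- At a wall some pair of neighbours is aligned. Replacing it by its sum shortens the list, and
    -- the induction restarts at the time of the wall.
    · obtain ⟨l₁, x, y, l₂, rfl, hxy⟩ : ∃ l₁ x y l₂, l = l₁ ++ x :: y :: l₂ ∧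
          ¬ 0 < orientation R I δ s' x y := by
        by_contra! hall
        exact hnot (pairwise_orientation_pos l (fun x hx => (hmem x hx).1) hall)
      have hpw'' := List.pairwise_append.1 hpw'
      obtain ⟨hp1, hp2, hp3⟩ := hpw''
      obtain ⟨hp4, hp5⟩ := List.pairwise_cons.1 hp2
      obtain ⟨hp6, hp7⟩ := List.pairwise_cons.1 hp5
      have hzero : orientation R I δ s' x y = 0 := le_antisymm (not_lt.1 hxy) (hp4 y (by simp))
      have hsum : (l₁ ++ x :: y :: l₂).sum = (l₁ ++ (x + y) :: l₂).sum := by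
        simp [add_assoc]
      rw [hsum]
      obtain ⟨hRx, hqx⟩ := hmem x (by simp)
      obtain ⟨hRy, hqy⟩ := hmem y (by simp)
      refine ih s' _ (by simp at hl ⊢; omega) hs'.2 (fun s'' hs'' => hneg s'' ⟨hs'.1.trans hs''.1, hs''.2⟩)
        ?_ ?_ ?_
      · intro z hz
        rcases List.mem_append.1 hz with hz | hz
        · exact hmem z (by simp [hz])
        · rcases List.mem_cons.1 hz with rfl | hz
          · exact ⟨by rw [map_add]; positivity,
              quadraticForm_add_nonneg (hneg s' hs') hRx hRy hqx hqy hzero⟩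
          · exact hmem z (by simp [hz])
      · refine List.pairwise_append.2 ⟨hp1, List.pairwise_cons.2 ⟨fun z hz => ?_, hp7⟩, fun a ha b hb => ?_⟩
        · rw [orientation_add_left]
          exact add_nonneg (hp4 z (by simp [hz])) (hp6 z hz)
        · rcases List.mem_cons.1 hb with rfl | hb
          · rw [orientation_add_right]
            exact add_nonneg (hp3 a ha x (by simp)) (hp3 a ha y (by simp))
          · exact hp3 a ha b (by simp [hb])
      · intro m₁ m₂ hm h1 h2
        -- A cut of the merged list is a cut of the original list that does not separate `x` from
        -- `y`.
        rcases List.append_eq_append_iff.1 hm with ⟨a, rfl, ha⟩ | ⟨c, rfl, rfl⟩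
        · match a, ha with
          | [], ha =>
            rw [List.nil_append] at ha
            subst ha
            have := hsplit l₁ (x :: y :: l₂) rfl (by simpa using h1) (by simp)
            simpa [add_assoc] using this
          | b :: a, ha =>
            rw [List.cons_append, List.cons.injEq] at ha
            obtain ⟨rfl, rfl⟩ := ha
            have := hsplit (l₁ ++ x :: y :: a) m₂ (by simp) (by simp) h2
            simpa [add_assoc] using this
        · have := hsplit m₁ (c ++ x :: y :: l₂) (by simp) h1 (by simp)
          simpa [add_assoc] using this

end WallCrossing

/-! ### Detecting zero after tensoring with `ℝ`. -/

section TensorKernel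

theorem moduleFinite_quotient {Γ : Type w} [AddCommGroup Γ] [Module.Finite ℤ Γ]
    (N : AddSubgroup Γ) : Module.Finite ℤ (Γ ⧸ N) :=
  Module.Finite.of_surjective (QuotientAddGroup.mk' N).toIntLinearMap
    (QuotientAddGroup.mk'_surjective N)

/-- An element of `ℝ ⊗ M` vanishes if its images under two maps with trivial common kernel
vanish. -/
theorem tensor_eq_zero {M P : Type w} [AddCommGroup M] [AddCommGroup P] (p : M →+ P) (d : M →+ ℤ)
    (hinj : ∀ x, p x = 0 → d x = 0 → x = 0) (v : ℝ ⊗[ℤ] M)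
    (hp : p.toIntLinearMap.baseChange ℝ v = 0)
    (hd : ((Int.castAddHom ℝ).comp d).toIntLinearMap.liftBaseChange ℝ v = 0) : v = 0 := by
  let f : M →ₗ[ℤ] P × ℤ := p.toIntLinearMap.prod d.toIntLinearMap
  have hf : Function.Injective f := by
    rw [injective_iff_map_eq_zero]
    intro x hx
    exact hinj x (congrArg Prod.fst hx) (congrArg Prod.snd hx)
  -- `ℝ` is flat over `ℤ`, so joint injectivity of `p` and `d` survives the tensor product.
  refine Module.Flat.lTensor_preserves_injective_linearMap (M := ℝ) f hf ?_
  rw [map_zero]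
  apply (TensorProduct.prodRight ℤ ℝ ℝ P ℤ).injective
  rw [map_zero]
  refine Prod.ext ?_ ((TensorProduct.rid ℤ ℝ).injective ?_)
  · rw [Prod.fst_zero, ← hp]
    clear hp hd
    induction v with
    | zero => simp
    | tmul a x => rfl
    | add x y hx hy => rw [map_add, map_add, Prod.fst_add, hx, hy, map_add]
  · rw [Prod.snd_zero, map_zero, ← hd]
    clear hp hd
    induction v with
    | zero => simp
    | tmul a x => simp [f, mul_comm]
    | add x y hx hy => rw [map_add, map_add, Prod.snd_add, map_add, hx, hy, map_add]

end TensorKernel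

/-! ### The quadratic form for the tilted charges. -/

section TiltedForm

variable {D : Type u} [Category.{v} D] [Preadditive D] [HasZeroObject D] [HasShift D ℤ]
  [∀ n : ℤ, (shiftFunctor D n).Additive] [Pretriangulated D]
  {Γ : Type w} [AddCommGroup Γ] [Module.Finite ℤ Γ] {cl : K0 D →+ Γ} {Z : Γ →+ ℂ}
  {A : ObjectProperty D} {ΔR ΔI : Γ →+ ℚ}

/-- The quadratic form giving the support property of the tilted central charges `Z_s†` for all
`0 < s ≤ T`. -/
theorem exists_tilt_quadraticForm (hBG : IsBGInequality cl Z A ΔR ΔI)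
    {Q : QuadraticForm ℝ (ℝ ⊗[ℤ] (Γ ⧸ Γ₀ cl Z A))}
    (hQ : ∀ x, ZbarReal cl Z A x = 0 → x ≠ 0 → Q x < 0) {N : AddSubgroup Γ}
    (hN : N = Γ₀ cl Z A ⊓ ΔI.ker) {T : ℝ} (hT : 0 < T) :
    ∃ (q : QuadraticForm ℝ (ℝ ⊗[ℤ] (Γ ⧸ N))) (L : ℝ ⊗[ℤ] (Γ ⧸ N) →ₗ[ℝ] ℂ)
      (δ : ℝ ⊗[ℤ] (Γ ⧸ N) →ₗ[ℝ] ℝ) (M : ℝ), 0 < M ∧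
      (∀ x : Γ, L (1 ⊗ₜ (x : Γ ⧸ N)) = Z x) ∧ (∀ x : Γ, δ (1 ⊗ₜ (x : Γ ⧸ N)) = ΔI x) ∧
      (∀ x : Γ, q (1 ⊗ₜ (x : Γ ⧸ N)) = Q (1 ⊗ₜ (x : Γ ⧸ Γ₀ cl Z A)) +
        M * ((Z x).re * ΔR x + (Z x).im * ΔI x)) ∧
      (∀ v, L v = 0 → q v ≤ 0) ∧
      ∀ s, 0 < s → s ≤ T → ∀ v, (L v).re = 0 → (L v).im + s * δ v = 0 → v ≠ 0 → q v < 0 := by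
  have hfin := moduleFinite_quotient (Γ₀ cl Z A)
  obtain ⟨C, hC, hQC⟩ := exists_le_sq_norm Q (ZbarReal cl Z A) hQ
  have hN1 : N ≤ Γ₀ cl Z A := hN ▸ inf_le_left
  have hN2 : N ≤ ΔI.ker := hN ▸ inf_le_right
  have hN3 : N ≤ ΔR.ker := by
    refine hN1.trans fun x hx => ?_
    have h1 : saturation (classes cl (kernelCat cl Z A)) ≤
        ((Rat.castHom ℂ).toAddMonoidHom.comp ΔR).ker := saturation_le_ker _ _ (by
      rintro x ⟨E, hE, rfl⟩
      simp [hBG.ΔR_eq_zero E hE])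
    have h2 : ((ΔR x : ℚ) : ℂ) = 0 := h1 hx
    exact_mod_cast h2
  let toReal : ℚ →+ ℝ := (Rat.castHom ℝ).toAddMonoidHom
  let p : Γ ⧸ N →+ Γ ⧸ Γ₀ cl Z A := QuotientAddGroup.map N _ (AddMonoidHom.id Γ) hN1
  let pr := p.toIntLinearMap.baseChange ℝ
  let L := ZbarReal cl Z A ∘ₗ pr
  let ext : ∀ f : Γ →+ ℚ, N ≤ f.ker → (ℝ ⊗[ℤ] (Γ ⧸ N) →ₗ[ℝ] ℝ) := fun f hf =>
    (QuotientAddGroup.lift N (toReal.comp f) (fun x hx => by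
      have h1 : f x = 0 := hf hx
      change toReal (f x) = 0
      rw [h1, map_zero])).toIntLinearMap.liftBaseChange ℝ
  have hext : ∀ f hf (x : Γ), ext f hf (1 ⊗ₜ (x : Γ ⧸ N)) = f x := fun f hf x => by
    simp only [ext]
    rw [LinearMap.liftBaseChange_tmul, one_smul]
    rfl
  have hpr : ∀ x : Γ, pr (1 ⊗ₜ (x : Γ ⧸ N)) = 1 ⊗ₜ (x : Γ ⧸ Γ₀ cl Z A) := fun x => rfl
  have hL : ∀ x : Γ, L (1 ⊗ₜ (x : Γ ⧸ N)) = Z x := fun x => by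
    change ZbarReal cl Z A (1 ⊗ₜ (x : Γ ⧸ Γ₀ cl Z A)) = Z x
    rw [ZbarReal, LinearMap.liftBaseChange_tmul, one_smul]
    rfl
  let δ := ext ΔI hN2
  let ρ := ext ΔR hN3
  -- The weight of the BG term. On the kernel of `Z_s†` one has `Im L = -s δ`, so `q ≤ (C s - M) s
  -- δ²`, which is negative for `s ≤ T` and `δ ≠ 0` when `M = C T + 1`.
  have hM : 0 < C * T + 1 := by positivity
  let q := Q.comp pr + (C * T + 1) • (QuadraticMap.linMulLin (Complex.reLm ∘ₗ L) ρ +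
    QuadraticMap.linMulLin (Complex.imLm ∘ₗ L) δ)
  have hq : ∀ v, q v = Q (pr v) + (C * T + 1) * ((L v).re * ρ v + (L v).im * δ v) := fun v => rfl
  -- On the lattice this is the equality `N = Γ₀ ∩ ker Δ_I`. After clearing the denominators of
  -- `Δ_I` it passes to real coefficients by `tensor_eq_zero`.
  have hinj : ∀ v, pr v = 0 → δ v = 0 → v = 0 := by
    obtain ⟨n, hn, hd⟩ := exists_common_denominator (toReal.comp ΔI) (fun x => ⟨ΔI x, rfl⟩)
    choose d₀ hd₀ using hd
    have hd₀' : ∀ x, (n : ℝ) * (ΔI x : ℝ) = d₀ x := hd₀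
    have hn' : (n : ℝ) ≠ 0 := by exact_mod_cast hn.ne'
    let d₁ : Γ →+ ℤ := AddMonoidHom.mk' d₀ fun x y => by
      have : ((d₀ (x + y) : ℤ) : ℝ) = d₀ x + d₀ y := by
        rw [← hd₀', ← hd₀', ← hd₀', map_add]
        push_cast
        ring
      exact_mod_cast this
    have hd₁ : ∀ x, d₁ x = 0 ↔ ΔI x = 0 := fun x => by
      have h1 : (n : ℝ) * (ΔI x : ℝ) = d₁ x := hd₀' x
      constructor
      · intro h0
        rw [h0, Int.cast_zero, mul_eq_zero] at h1
        exact_mod_cast h1.resolve_left hn'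
      · intro h0
        rw [h0, Rat.cast_zero, mul_zero] at h1
        exact_mod_cast h1.symm
    let d : Γ ⧸ N →+ ℤ := QuotientAddGroup.lift N d₁ fun x hx => (hd₁ x).2 (hN2 hx)
    intro v hv hδ
    refine tensor_eq_zero p d ?_ v hv ?_
    · intro x hx hdx
      induction x using QuotientAddGroup.induction_on with
      | H x =>
        have h1 : ((x : Γ) : Γ ⧸ Γ₀ cl Z A) = 0 := hx
        rw [QuotientAddGroup.eq_zero_iff] at h1 ⊢
        rw [hN]
        exact ⟨h1, (hd₁ x).1 hdx⟩
    · have h1 : ((Int.castAddHom ℝ).comp d).toIntLinearMap.liftBaseChange ℝ = (n : ℝ) • δ := by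
        ext x
        induction x using QuotientAddGroup.induction_on with
        | H x =>
          change _ = (n : ℝ) * δ (1 ⊗ₜ (x : Γ ⧸ N))
          rw [hext ΔI hN2, hd₀']
          simp
          rfl
      rw [h1, LinearMap.smul_apply, hδ, smul_zero]
  refine ⟨q, L, δ, C * T + 1, hM, hL, hext ΔI hN2, fun x => ?_, fun v hv => ?_, fun s hs hsT v h1 h2 h3 => ?_⟩
  · rw [hq, hpr, hL, hext ΔR hN3, hext ΔI hN2]
  · rw [hq, hv]
    simp only [Complex.zero_re, Complex.zero_im, zero_mul, add_zero, mul_zero]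
    by_cases h0 : pr v = 0
    · rw [h0, QuadraticMap.map_zero]
    · exact (hQ _ hv h0).le
  · rw [hq, h1, zero_mul, zero_add]
    have h4 : (L v).im = -(s * δ v) := by linarith
    by_cases h0 : δ v = 0
    · have hLv : L v = 0 := Complex.ext h1 (by rw [h4, h0]; simp)
      rw [h0, mul_zero, mul_zero, add_zero]
      exact hQ _ hLv fun h5 => h3 (hinj v h5 h0)
    · have h5 := hQC (pr v)
      have h6 : ‖ZbarReal cl Z A (pr v)‖ ^ 2 = (s * δ v) ^ 2 := by
        rw [Complex.sq_norm, Complex.normSq_apply]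
        change (L v).re * (L v).re + (L v).im * (L v).im = _
        rw [h1, h4]
        ring
      rw [h6] at h5
      rw [h4]
      have h7 : 0 < s * δ v ^ 2 := by positivity
      have h8 : C * s ≤ C * T := mul_le_mul_of_nonneg_left hsT hC.le
      nlinarith [mul_le_mul_of_nonneg_right h8 h7.le]

end TiltedForm

/-! ### Filtrations recorded by the list of their quotients. -/

section Flags

variable {D : Type u} [Category.{v} D] [Preadditive D] [HasZeroObject D] [HasShift D ℤ]
  [∀ n : ℤ, (shiftFunctor D n).Additive] [Pretriangulated D]

/-- `E` has a filtration with successive quotients the objects of the list. -/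
inductive Flag : List D → D → Prop
  | nil {E : D} (h : IsZero E) : Flag [] E
  | snoc {l : List D} {X E G : D} (hX : Flag l X) (h : HasTri X E G) : Flag (l ++ [G]) E

theorem Flag.sum {M : Type*} [AddCommGroup M] (f : K0 D →+ M) {l : List D} {E : D}
    (h : Flag l E) : f (K0.of E) = (l.map fun G => f (K0.of G)).sum := by
  induction h with
  | nil h => simp [K0.of_isZero h]
  | snoc _ h ih => simp [h.of_eq, ih]

theorem Flag.mem {P : ObjectProperty D} (h0 : ∀ X, IsZero X → P X)
    (hext : ∀ X Y Z, HasTri X Y Z → P X → P Z → P Y) {l : List D} {E : D} (h : Flag l E)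
    (hl : ∀ G ∈ l, P G) : P E := by
  induction h with
  | nil h => exact h0 _ h
  | snoc _ h ih =>
    exact hext _ _ _ h (ih fun G hG => hl G (by simp [hG])) (hl _ (by simp))

theorem Flag.exists_last {l : List D} {G E : D} (h : Flag (l ++ [G]) E) :
    ∃ X, Flag l X ∧ HasTri X E G := by
  generalize hl : l ++ [G] = l' at h
  cases h with
  | nil h => simp at hl
  | snoc hX h =>
    obtain ⟨rfl, h1⟩ := List.append_inj' hl rfl
    obtain rfl : G = _ := by simpa using h1
    exact ⟨_, hX, h⟩

variable [IsTriangulated D]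

/-- This turns a cut of the list of classes into a triangle, to which semistability can be applied.
-/
theorem Flag.split (l₂ : List D) : ∀ {l₁ : List D} {E : D}, Flag (l₁ ++ l₂) E →
    ∃ X Y, HasTri X E Y ∧ Flag l₁ X ∧ Flag l₂ Y := by
  induction l₂ using List.reverseRecOn with
  | nil =>
    intro l₁ E h
    rw [List.append_nil] at h
    exact ⟨E, 0, HasTri.of_isZero_right (isZero_zero D), h, .nil (isZero_zero D)⟩
  | append_singleton l₂ G ih =>
    intro l₁ E h
    rw [← List.append_assoc] at h
    obtain ⟨X', h1, h2⟩ := h.exists_last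
    obtain ⟨X, Y, h3, h4, h5⟩ := ih h1
    obtain ⟨W, h6, h7⟩ := h2.octahedron h3
    exact ⟨X, W, h6, h4, .snoc h5 h7⟩

end Flags

/-! ### HN factors in the tilted heart, with pieces in `C` absorbed. -/

section GoodFactors

variable {D : Type u} [Category.{v} D] [Preadditive D] [HasZeroObject D] [HasShift D ℤ]
  [∀ n : ℤ, (shiftFunctor D n).Additive] [Pretriangulated D] [IsTriangulated D]
  {Γ : Type w} [AddCommGroup Γ] {cl : K0 D →+ Γ} {Z : Γ →+ ℂ}
  {A : ObjectProperty D} {ΔR ΔI : Γ →+ ℚ}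

/-- `z` lies on the open ray of phase `ψ`. -/
def OnRay (z : ℂ) (ψ : ℝ) : Prop :=
  ∃ m : ℝ, 0 < m ∧ z.re = m * Real.cos (Real.pi * ψ) ∧ z.im = m * Real.sin (Real.pi * ψ)

theorem OnRay.cross_nonneg {z w : ℂ} {ψ φ : ℝ} (hz : OnRay z ψ) (hw : OnRay w φ) (h1 : φ ≤ ψ)
    (h2 : ψ ≤ φ + 1) : 0 ≤ w.im * -z.re - z.im * -w.re := by
  obtain ⟨m, hm, h3, h4⟩ := hz
  obtain ⟨n, hn, h5, h6⟩ := hw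
  have h7 : 0 ≤ Real.sin (Real.pi * (ψ - φ)) := Real.sin_nonneg_of_nonneg_of_le_pi
    (mul_nonneg Real.pi_pos.le (by linarith)) (by nlinarith [Real.pi_pos])
  rw [mul_sub, Real.sin_sub] at h7
  rw [h3, h4, h5, h6]
  have : n * Real.sin (Real.pi * φ) * -(m * Real.cos (Real.pi * ψ)) -
      m * Real.sin (Real.pi * ψ) * -(n * Real.cos (Real.pi * φ)) =
      m * n * (Real.sin (Real.pi * ψ) * Real.cos (Real.pi * φ) -
        Real.cos (Real.pi * ψ) * Real.sin (Real.pi * φ)) := by ring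
  rw [this]
  positivity

theorem OnRay.neg {z : ℂ} {ψ : ℝ} (h : OnRay z ψ) : OnRay (-z) (ψ + 1) := by
  obtain ⟨m, hm, h1, h2⟩ := h
  refine ⟨m, hm, ?_, ?_⟩
  · rw [Complex.neg_re, h1, mul_add, mul_one, Real.cos_add_pi]; ring
  · rw [Complex.neg_im, h2, mul_add, mul_one, Real.sin_add_pi]; ring

theorem OnRay.re_neg {z : ℂ} {ψ : ℝ} (h : OnRay z ψ) (h1 : 1 / 2 < ψ) (h2 : ψ < 3 / 2) :
    z.re < 0 := by
  obtain ⟨m, hm, h3, -⟩ := h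
  rw [h3]
  exact mul_neg_of_pos_of_neg hm (Real.cos_neg_of_pi_div_two_lt_of_lt
    (by nlinarith [Real.pi_pos]) (by nlinarith [Real.pi_pos]))

theorem OnRay.im_nonpos {z : ℂ} {ψ : ℝ} (h : OnRay z ψ) (h1 : 1 ≤ ψ) (h2 : ψ ≤ 2) :
    z.im ≤ 0 := by
  obtain ⟨m, hm, -, h3⟩ := h
  rw [h3, show Real.pi * ψ = Real.pi * (ψ - 1) + Real.pi by ring, Real.sin_add_pi]
  have := Real.sin_nonneg_of_nonneg_of_le_pi (x := Real.pi * (ψ - 1))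
    (mul_nonneg Real.pi_pos.le (by linarith)) (by nlinarith [Real.pi_pos])
  nlinarith

theorem IsVeryWeakPreStability.onRay (h : IsVeryWeakPreStability cl Z A) {φ : ℝ}
    (hφ : φ ∈ Set.Ioo (0 : ℝ) 1) {E : D} (hE : phase cl Z A φ E) (h0 : ¬ IsZero E) :
    OnRay (Z (cl (K0.of E))) φ := by
  obtain ⟨-, -, -, him, heq⟩ := h.of_phase hφ hE h0
  have hsin := sin_pi_mul_pos hφ.1 hφ.2
  refine ⟨(Z (cl (K0.of E))).im / Real.sin (Real.pi * φ), by positivity, ?_, ?_⟩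
  · rw [div_mul_eq_mul_div, eq_div_iff hsin.ne', heq]
  · field_simp

variable (cl Z A ΔR ΔI) in
/-- The properties of the quotients in the filtrations used in the proof of the support
property for the tilted stability conditions. -/
structure GoodFactor (Q : QuadraticForm ℝ (ℝ ⊗[ℤ] (Γ ⧸ Γ₀ cl Z A))) (lo : ℝ) (G : D) : Prop where
  mem : tiltHeart cl Z A G
  ray : ∃ ψ, lo ≤ ψ ∧ ψ < 3 / 2 ∧ OnRay (Z (cl (K0.of G))) ψ
  form_nonneg : 0 ≤ Q (1 ⊗ₜ (cl (K0.of G) : Γ ⧸ Γ₀ cl Z A))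
  bg_nonneg : 0 ≤ (Z (cl (K0.of G))).re * (ΔR (cl (K0.of G)) : ℝ) +
    (Z (cl (K0.of G))).im * (ΔI (cl (K0.of G)) : ℝ)

variable {Q : QuadraticForm ℝ (ℝ ⊗[ℤ] (Γ ⧸ Γ₀ cl Z A))}

theorem GoodFactor.anti {lo lo' : ℝ} (hlo : lo' ≤ lo) {G : D}
    (h : GoodFactor cl Z A ΔR ΔI Q lo G) : GoodFactor cl Z A ΔR ΔI Q lo' G := by
  obtain ⟨h1, ⟨ψ, h2, h3⟩, h4, h5⟩ := h
  exact ⟨h1, ⟨ψ, hlo.trans h2, h3⟩, h4, h5⟩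

theorem form_neg_mk (x : Γ) : Q (1 ⊗ₜ ((-x : Γ) : Γ ⧸ Γ₀ cl Z A)) = Q (1 ⊗ₜ (x : Γ ⧸ Γ₀ cl Z A)) := by
  rw [QuotientAddGroup.mk_neg, TensorProduct.tmul_neg, QuadraticMap.map_neg]

theorem form_nonneg_of_phase (h : IsVeryWeakPreStability cl Z A)
    (hQ : ∀ E : A.FullSubcategory, IsSemistable cl Z A E →
      0 ≤ Q (1 ⊗ₜ (cl (K0.of E.obj) : Γ ⧸ Γ₀ cl Z A)))
    {φ : ℝ} (hφ : φ ∈ Set.Ioc (0 : ℝ) 1) {E : D} (hE : phase cl Z A φ E) :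
    0 ≤ Q (1 ⊗ₜ (cl (K0.of E) : Γ ⧸ Γ₀ cl Z A)) := by
  rcases (phase_iff_basicPhase h.isBoundedHeart hφ E).1 hE with h0 | ⟨hA, hs, -⟩
  · simp [K0.of_isZero h0]
  · exact hQ ⟨E, hA⟩ hs

theorem form_nonneg_of_phase' (h : IsVeryWeakPreStability cl Z A)
    (hQ : ∀ E : A.FullSubcategory, IsSemistable cl Z A E →
      0 ≤ Q (1 ⊗ₜ (cl (K0.of E.obj) : Γ ⧸ Γ₀ cl Z A)))
    {φ : ℝ} (hφ : φ ∈ Set.Ioc (0 : ℝ) 2) {E : D} (hE : phase cl Z A φ E) :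
    0 ≤ Q (1 ⊗ₜ (cl (K0.of E) : Γ ⧸ Γ₀ cl Z A)) := by
  by_cases h1 : φ ≤ 1
  · exact form_nonneg_of_phase h hQ ⟨hφ.1, h1⟩ hE
  · have h2 := form_nonneg_of_phase h hQ ⟨by linarith, by linarith [hφ.2]⟩ (h.phase_shift_neg hE)
    rwa [K0.of_shift_neg_one, map_neg, form_neg_mk] at h2

theorem IsBGInequality.nonneg_of_phase' (hBG : IsBGInequality cl Z A ΔR ΔI)
    (h : IsVeryWeakPreStability cl Z A) {φ : ℝ} {E : D} (hφ : φ ∈ Set.Ioo (0 : ℝ) 2)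
    (hE : phase cl Z A φ E) :
    0 ≤ (Z (cl (K0.of E))).re * (ΔR (cl (K0.of E)) : ℝ) +
      (Z (cl (K0.of E))).im * (ΔI (cl (K0.of E)) : ℝ) := by
  rcases lt_trichotomy φ 1 with h1 | rfl | h1
  · exact hBG.nonneg_of_phase h ⟨hφ.1, h1⟩ hE
  · rcases (phase_iff_basicPhase h.isBoundedHeart ⟨one_pos, le_rfl⟩ E).1 hE with h0 | ⟨hA, hs, -⟩
    · simp [K0.of_isZero h0]
    · exact hBG.nonneg ⟨E, hA⟩ hs
  · have h2 := hBG.nonneg_of_phase h ⟨by linarith, by linarith [hφ.2]⟩ (h.phase_shift_neg hE)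
    rw [K0.of_shift_neg_one, map_neg, map_neg, map_neg, map_neg, Complex.neg_re, Complex.neg_im] at h2
    push_cast at h2
    linarith

theorem IsVeryWeakPreStability.onRay_of_re_neg (h : IsVeryWeakPreStability cl Z A)
    {φ : ℝ} (hφ : φ ∈ Set.Ioc (1 / 2 : ℝ) (3 / 2)) {E : D} (hE : phase cl Z A φ E)
    (hre : (Z (cl (K0.of E))).re < 0) : OnRay (Z (cl (K0.of E))) φ := by
  have h0 : ¬ IsZero E := fun h0 => by simp [K0.of_isZero h0] at hre
  rcases lt_trichotomy φ 1 with h1 | rfl | h1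
  · exact h.onRay ⟨by linarith [hφ.1], h1⟩ hE h0
  · refine ⟨-(Z (cl (K0.of E))).re, by linarith, by simp, ?_⟩
    rw [((h.phase_one_iff E).1 hE).2]
    simp
  · have h2 := (h.onRay ⟨by linarith, by linarith [hφ.2]⟩ (h.phase_shift_neg hE)
      fun h => h0 (isZero_of_shift h)).neg
    rwa [K0.of_shift_neg_one, map_neg, map_neg, neg_neg, sub_add_cancel] at h2

theorem GoodFactor.of_phase (h : IsVeryWeakPreStability cl Z A)
    (hBG : IsBGInequality cl Z A ΔR ΔI)
    (hQ : ∀ E : A.FullSubcategory, IsSemistable cl Z A E →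
      0 ≤ Q (1 ⊗ₜ (cl (K0.of E.obj) : Γ ⧸ Γ₀ cl Z A)))
    {φ : ℝ} (hφ : φ ∈ Set.Ioc (1 / 2 : ℝ) (3 / 2)) {E : D} (hE : phase cl Z A φ E)
    (hre : (Z (cl (K0.of E))).re < 0) : GoodFactor cl Z A ΔR ΔI Q φ E := by
  refine ⟨.of_mem _ ⟨φ, hφ, hE⟩, ⟨φ, le_rfl, ?_, h.onRay_of_re_neg hφ hE hre⟩,
    form_nonneg_of_phase' h hQ ⟨by linarith [hφ.1], by linarith [hφ.2]⟩ hE,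
    hBG.nonneg_of_phase' h ⟨by linarith [hφ.1], by linarith [hφ.2]⟩ hE⟩
  refine lt_of_le_of_ne hφ.2 fun h1 => ?_
  subst h1
  exact hre.ne (h.re_eq_zero_of_phase_three_half hE)

theorem mk_eq_zero_of_kernelCat {E : D} (hE : kernelCat cl Z A E) :
    ((cl (K0.of E) : Γ) : Γ ⧸ Γ₀ cl Z A) = 0 := by
  rw [QuotientAddGroup.eq_zero_iff]
  exact ⟨1, one_ne_zero, by rw [one_smul]; exact AddSubgroup.subset_closure ⟨E, hE, rfl⟩⟩

/-- Adding `K` changes neither `Z`, nor `Δ_R`, nor the class modulo `Γ₀`, and it lowers `Δ_I`. As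
the ray has phase in `[1, 3/2)`, `Im Z ≤ 0` and the BG expression can only grow. -/
theorem GoodFactor.extend (h : IsVeryWeakPreStability cl Z A)
    (hBG : IsBGInequality cl Z A ΔR ΔI) {lo : ℝ} (hlo : 1 ≤ lo) {G W K : D}
    (hG : GoodFactor cl Z A ΔR ΔI Q lo G) (htri : HasTri G W K) (hK : kernelCat cl Z A K) :
    GoodFactor cl Z A ΔR ΔI Q lo W ∧ Z (cl (K0.of W)) = Z (cl (K0.of G)) := by
  have hZ : Z (cl (K0.of W)) = Z (cl (K0.of G)) := by
    rw [htri.of_eq, map_add, map_add, hK.2, add_zero]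
  obtain ⟨h1, ⟨ψ, h2, h3, h4⟩, h5, h6⟩ := hG
  refine ⟨⟨Slicing.interval.ext (S := h.slicing) htri h1 (h.tiltHeart_of_kernelCat hK),
    ⟨ψ, h2, h3, hZ ▸ h4⟩, ?_, ?_⟩, hZ⟩
  · rw [htri.of_eq, map_add, QuotientAddGroup.mk_add, mk_eq_zero_of_kernelCat hK, add_zero]
    exact h5
  · have h7 := h4.im_nonpos (hlo.trans h2) (by linarith)
    have h8 : (ΔI (cl (K0.of K)) : ℝ) ≤ 0 := by exact_mod_cast hBG.ΔI_nonpos K hK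
    have h9 : ΔR (cl (K0.of W)) = ΔR (cl (K0.of G)) := by
      rw [htri.of_eq, map_add, map_add, hBG.ΔR_eq_zero K hK, add_zero]
    have h10 : ΔI (cl (K0.of W)) = ΔI (cl (K0.of G)) + ΔI (cl (K0.of K)) := by
      rw [htri.of_eq, map_add, map_add]
    rw [hZ, h9, h10]
    push_cast
    nlinarith [mul_nonneg_of_nonpos_of_nonpos h7 h8]

/-- The wall-crossing needs `Re Z < 0` for every quotient, and this can fail for phase `3/2` or for
a factor in `C`. Torsion-freeness excludes both at the top of the filtration. Any later factor in
`C` has phase `1` and is absorbed into the preceding quotient, whose phase is larger. -/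
theorem Tower.exists_flag (h : IsVeryWeakPreStability cl Z A)
    (hBG : IsBGInequality cl Z A ΔR ΔI)
    (hQ : ∀ E : A.FullSubcategory, IsSemistable cl Z A E →
      0 ≤ Q (1 ⊗ₜ (cl (K0.of E.obj) : Γ ⧸ Γ₀ cl Z A)))
    {lo hi : ℝ} {E : D} (ht : Tower (phase cl Z A) lo hi E) (hlo : 1 / 2 < lo) (hhi : hi ≤ 3 / 2)
    (htf : ∀ X, tiltHeart cl Z A X → (Z (cl (K0.of X))).re = 0 → ∀ f : X ⟶ E, f = 0) :
    ∃ l : List D, l ≠ [] ∧ Flag l E ∧ (∀ G ∈ l, GoodFactor cl Z A ΔR ΔI Q lo G) ∧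
      l.Pairwise fun G G' => 0 ≤ (Z (cl (K0.of G'))).im * -(Z (cl (K0.of G))).re -
        (Z (cl (K0.of G))).im * -(Z (cl (K0.of G'))).re := by
  induction ht with
  | @base φ E hE h0 =>
    have hφ : φ ∈ Set.Ioc (1 / 2 : ℝ) (3 / 2) := ⟨hlo, hhi⟩
    have hEA : tiltHeart cl Z A E := .of_mem _ ⟨φ, hφ, hE⟩
    have hne : (Z (cl (K0.of E))).re ≠ 0 := fun hre =>
      h0 ((IsZero.iff_id_eq_zero _).2 (htf E hEA hre _))
    have hre : (Z (cl (K0.of E))).re < 0 := by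
      rcases h.tilt_generator hφ hE with h1 | h1 | h1
      · exact h1
      · exact absurd (by rw [h1.2]; rfl) hne
      · exact absurd h1.2.2.1 hne
    refine ⟨[E], by simp, .snoc (l := []) (.nil (isZero_zero D))
      (HasTri.of_isZero_left (isZero_zero D)), ?_, List.pairwise_singleton _ _⟩
    intro G hG
    rw [List.mem_singleton.1 hG]
    exact GoodFactor.of_phase h hBG hQ hφ hE hre
  | @step X Y G htri lo hi φ hX hG h0 hlt ih =>
    have hle := hX.le
    have hφ : φ ∈ Set.Ioc (1 / 2 : ℝ) (3 / 2) := ⟨hlo, by linarith⟩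
    obtain ⟨l, hl0, hl, hgood, hpw⟩ := ih (by linarith) hhi (by
      -- A map to `X` that dies in `E` factors through `G[-1]`, of phase below `1/2`, so it is zero
      -- on the tilted heart. Hence `X` inherits torsion-freeness.
      intro T hT hre k
      obtain ⟨f, g, δ, hdist⟩ := htri
      obtain ⟨a, b, rfl⟩ := HasTri.exists_mid_of_hom_left hdist k (htf T hT hre _)
      have ha : a = 0 := Slicing.interval.hom_eq_zero (S := h.slicing) (J := {φ - 1}) (by
        rintro ψ hψ χ rfl
        linarith [hψ.1]) hT (.of_mem _ ⟨_, rfl, h.phase_shift_neg hG⟩) a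
      rw [ha, zero_comp])
    by_cases hre : (Z (cl (K0.of G))).re < 0
    · have hgG := GoodFactor.of_phase (Q := Q) h hBG hQ hφ hG hre
      refine ⟨l ++ [G], by simp, .snoc hl htri, ?_, List.pairwise_append.2
        ⟨hpw, List.pairwise_singleton _ _, ?_⟩⟩
      · intro G' hG'
        rcases List.mem_append.1 hG' with hG' | hG'
        · exact (hgood G' hG').anti hlt.le
        · rw [List.mem_singleton.1 hG']
          exact hgG
      · intro G' hG' G'' hG''
        rw [List.mem_singleton.1 hG'']
        obtain ⟨ψ, h1, h2, h3⟩ := (hgood G' hG').ray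
        exact h3.cross_nonneg (h.onRay_of_re_neg hφ hG hre) (by linarith) (by linarith)
    · have hK : kernelCat cl Z A G := by
        rcases h.tilt_generator hφ hG with h1 | h1 | h1
        · exact absurd h1 hre
        · exact h1
        · linarith [h1.1]
      have hφ1 : φ = 1 := (Tower.unique (S := h.slicing) (.base hG h0)
        (.base (h.phase_one_of_kernelCat hK) h0)).1
      obtain ⟨l', G', rfl⟩ : ∃ l' G', l = l' ++ [G'] :=
        ⟨_, _, (List.dropLast_append_getLast hl0).symm⟩
      obtain ⟨X', hX', hXG⟩ := hl.exists_last
      obtain ⟨W, h1, h2⟩ := htri.octahedron hXG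
      obtain ⟨h3, h4⟩ := (hgood G' (by simp)).extend h hBG (by linarith) h2 hK
      refine ⟨l' ++ [W], by simp, .snoc hX' h1, ?_, ?_⟩
      · intro G'' hG''
        rcases List.mem_append.1 hG'' with hG'' | hG''
        · exact (hgood G'' (by simp [hG''])).anti hlt.le
        · rw [List.mem_singleton.1 hG'']
          exact h3.anti hlt.le
      · rw [List.pairwise_append] at hpw ⊢
        refine ⟨hpw.1, List.pairwise_singleton _ _, fun a ha b hb => ?_⟩
        rw [List.mem_singleton.1 hb, h4]
        exact hpw.2.2 a ha G' (by simp)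

end GoodFactors

/-! ### The support property for the tilted pairs. -/

section TiltedSupport

variable {D : Type u} [Category.{v} D] [Preadditive D] [HasZeroObject D] [HasShift D ℤ]
  [∀ n : ℤ, (shiftFunctor D n).Additive] [Pretriangulated D] [IsTriangulated D]
  {Γ : Type w} [AddCommGroup Γ] {cl : K0 D →+ Γ} {Z : Γ →+ ℂ}
  {A : ObjectProperty D} {ΔR ΔI : Γ →+ ℚ} {N : AddSubgroup Γ}
  {q : QuadraticForm ℝ (ℝ ⊗[ℤ] (Γ ⧸ N))} {L : ℝ ⊗[ℤ] (Γ ⧸ N) →ₗ[ℝ] ℂ}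
  {δ : ℝ ⊗[ℤ] (Γ ⧸ N) →ₗ[ℝ] ℝ} {Q : QuadraticForm ℝ (ℝ ⊗[ℤ] (Γ ⧸ Γ₀ cl Z A))}

theorem tilt_form_nonneg_of_re_eq_zero (h : IsVeryWeakPreStability cl Z A)
    (hBG : IsBGInequality cl Z A ΔR ΔI)
    (hQ : ∀ E : A.FullSubcategory, IsSemistable cl Z A E →
      0 ≤ Q (1 ⊗ₜ (cl (K0.of E.obj) : Γ ⧸ Γ₀ cl Z A)))
    {E : D} (hE : tiltHeart cl Z A E) (hre : (Z (cl (K0.of E))).re = 0) :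
    0 ≤ Q (1 ⊗ₜ (cl (K0.of E) : Γ ⧸ Γ₀ cl Z A)) ∧
      0 ≤ (Z (cl (K0.of E))).re * (ΔR (cl (K0.of E)) : ℝ) +
        (Z (cl (K0.of E))).im * (ΔI (cl (K0.of E)) : ℝ) := by
  obtain ⟨X, Y, htri, hX, hY⟩ := h.exists_hasTri_of_re_eq_zero hE hre
  constructor
  · rw [htri.of_eq, map_add, QuotientAddGroup.mk_add, mk_eq_zero_of_kernelCat hY, add_zero]
    exact form_nonneg_of_phase' h hQ ⟨by norm_num, by norm_num⟩ hX
  · have h1 := hBG.nonneg_of_phase' h ⟨by norm_num, by norm_num⟩ hX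
    rw [h.re_eq_zero_of_phase_three_half hX, zero_mul, zero_add] at h1
    have h2 : (Z (cl (K0.of X))).im ≤ 0 := by
      by_cases h0 : IsZero X
      · simp [K0.of_isZero h0]
      · have h3 := h.phase_shift_neg hX
        obtain ⟨-, -, -, him, -⟩ := h.of_phase ⟨by norm_num, by norm_num⟩ h3
          fun h => h0 (isZero_of_shift h)
        rw [K0.of_shift_neg_one, map_neg, map_neg, Complex.neg_im] at him
        linarith
    have h3 : (ΔI (cl (K0.of Y)) : ℝ) ≤ 0 := by exact_mod_cast hBG.ΔI_nonpos Y hY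
    rw [hre, zero_mul, zero_add, htri.of_eq, map_add, map_add, map_add, hY.2, add_zero]
    push_cast
    nlinarith [mul_nonneg_of_nonpos_of_nonpos h2 h3]

/-- If `Re Z(E) ≠ 0`, semistability makes `E` torsion-free, and its flag of good factors has
decreasing slopes at time `0`. Each initial part of the flag is a subobject in the tilted heart, so
semistability at time `t` is exactly the condition on cuts in `quadraticForm_sum_nonneg`. -/
theorem tilt_form_nonneg [Module.Finite ℤ Γ] (h : IsVeryWeakPreStability cl Z A)
    (hBG : IsBGInequality cl Z A ΔR ΔI) (hgood : IsGood cl Z A ΔI)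
    (hQ : ∀ E : A.FullSubcategory, IsSemistable cl Z A E →
      0 ≤ Q (1 ⊗ₜ (cl (K0.of E.obj) : Γ ⧸ Γ₀ cl Z A)))
    {M t : ℝ} (hM : 0 < M) (ht : 0 < t)
    (hL : ∀ x : Γ, L (1 ⊗ₜ (x : Γ ⧸ N)) = Z x) (hδ : ∀ x : Γ, δ (1 ⊗ₜ (x : Γ ⧸ N)) = ΔI x)
    (hq : ∀ x : Γ, q (1 ⊗ₜ (x : Γ ⧸ N)) = Q (1 ⊗ₜ (x : Γ ⧸ Γ₀ cl Z A)) +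
        M * ((Z x).re * ΔR x + (Z x).im * ΔI x))
    (hneg : ∀ s ∈ Set.Icc 0 t, ∀ v, (L v).re = 0 → (L v).im + s * δ v = 0 → q v ≤ 0)
    {E : (tiltHeart cl Z A).FullSubcategory}
    (hE : IsSemistable cl (tiltCharge Z ΔI t) (tiltHeart cl Z A) E) :
    0 ≤ q (1 ⊗ₜ (cl (K0.of E.obj) : Γ ⧸ N)) := by
  have h' := isVeryWeakPreStability_tilt h hBG hgood ht
  letI := h'.isBoundedHeart.abelian
  have hqof : ∀ x : Γ, 0 ≤ Q (1 ⊗ₜ (x : Γ ⧸ Γ₀ cl Z A)) →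
      0 ≤ (Z x).re * ΔR x + (Z x).im * ΔI x → 0 ≤ q (1 ⊗ₜ (x : Γ ⧸ N)) := fun x h1 h2 => by
    rw [hq]
    positivity
  by_cases hre : (Z (cl (K0.of E.obj))).re = 0
  · obtain ⟨h1, h2⟩ := tilt_form_nonneg_of_re_eq_zero h hBG hQ E.property hre
    exact hqof _ h1 h2
  have h0 : ¬ IsZero E.obj := fun h0 => hre (by simp [K0.of_isZero h0])
  obtain ⟨lo, hi, htow⟩ := h.slicing.exists_tower h0
  obtain ⟨h1, h2⟩ := Slicing.interval.tower_mem (S := h.slicing) Set.ordConnected_Ioc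
    E.property htow
  have htf := SS.torsionFree (h'.isBoundedHeart.isWeakCharge h'.upper) hE (fun h1 => hre (by
    have h2 := cslope_eq_top.1 h1
    rw [heartCharge, tiltCharge_im] at h2
    linarith))
  obtain ⟨l, hl0, hl, hgf, hpw⟩ := Tower.exists_flag (Q := Q) h hBG hQ htow h1.1 h2.2
    fun X hX hXre f => by
      have := htf ⟨X, hX⟩ (by rw [heartCharge, tiltCharge_im, hXre, neg_zero])
        (ObjectProperty.homMk f)
      exact congrArg InducedCategory.Hom.hom this
  let f : K0 D →+ ℝ ⊗[ℤ] (Γ ⧸ N) :=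
    ((TensorProduct.mk ℤ ℝ (Γ ⧸ N) 1).toAddMonoidHom.comp (QuotientAddGroup.mk' N)).comp cl
  have hf : ∀ X : D, f (K0.of X) = 1 ⊗ₜ (cl (K0.of X) : Γ ⧸ N) := fun X => rfl
  rw [← hf, hl.sum f]
  have hRpos : ∀ G ∈ l, (Z (cl (K0.of G))).re < 0 := fun G hG => by
    obtain ⟨ψ, h3, h4, h5⟩ := (hgf G hG).ray
    exact h5.re_neg (h1.1.trans_le h3) h4
  have hflag : ∀ (m : List D) (X : D), (∀ G ∈ m, G ∈ l) → m ≠ [] → Flag m X →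
      tiltHeart cl Z A X ∧ (Z (cl (K0.of X))).re < 0 := by
    intro m X hm hm0 hX
    refine ⟨hX.mem (fun _ => Slicing.interval.of_isZero (S := h.slicing))
      (fun _ _ _ => Slicing.interval.ext (S := h.slicing)) fun G hG => (hgf G (hm G hG)).mem, ?_⟩
    have h3 := hX.sum ((-Complex.reAddGroupHom).comp (Z.comp cl))
    have h4 := List.sum_pos (m.map fun G => ((-Complex.reAddGroupHom).comp (Z.comp cl)) (K0.of G))
      (by
        intro x hx
        obtain ⟨G, hG, rfl⟩ := List.mem_map.1 hx
        exact neg_pos.2 (hRpos G (hm G hG))) (by simpa using hm0)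
    rw [← h3] at h4
    exact neg_pos.1 h4
  refine quadraticForm_sum_nonneg (R := -(Complex.reLm ∘ₗ L)) (I := Complex.imLm ∘ₗ L) (δ := δ)
    (s := t) _ 0 _ rfl ht.le ?_ ?_ ?_ ?_
  · intro s hs x hx1 hx2
    exact hneg s hs x (neg_eq_zero.1 hx1) hx2
  · intro x hx
    obtain ⟨G, hG, rfl⟩ := List.mem_map.1 hx
    refine ⟨?_, hqof _ (hgf G hG).form_nonneg (hgf G hG).bg_nonneg⟩
    change 0 < -(L _).re
    rw [hf, hL]
    exact neg_pos.2 (hRpos G hG)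
  · rw [List.pairwise_map]
    refine hpw.imp fun {G G'} h3 => ?_
    change 0 ≤ ((L _).im + 0 * δ _) * -(L _).re - ((L _).im + 0 * δ _) * -(L _).re
    rw [hf, hf, hL, hL, zero_mul, zero_mul, add_zero, add_zero]
    exact h3
  · intro l₁ l₂ hll h3 h4
    obtain ⟨m₁, m₂, rfl, rfl, rfl⟩ := List.map_eq_append_iff.1 hll
    obtain ⟨X, Y, ⟨a, b, c, hT⟩, hX, hY⟩ := Flag.split m₂ hl
    obtain ⟨hXA, hXre⟩ := hflag m₁ X (fun G hG => by simp [hG]) (by simpa using h3) hX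
    obtain ⟨hYA, hYre⟩ := hflag m₂ Y (fun G hG => by simp [hG]) (by simpa using h4) hY
    obtain ⟨w, hw⟩ := h'.isBoundedHeart.shortExact_of_triangle (X := ⟨X, hXA⟩) (Y := E)
      (Z := ⟨Y, hYA⟩) (ObjectProperty.homMk a) (ObjectProperty.homMk b) c hT
    have h5 := hE ⟨X, hXA⟩ ⟨Y, hYA⟩ _ _ w hw (fun h0 => by simp [K0.of_isZero (isZero_of_fullSubcategory h0)] at hXre)
    have h6 := (cslope_le_cslope_iff (by rw [tiltCharge_im]; linarith)
      (by rw [tiltCharge_im]; linarith)).1 h5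
    rw [tiltCharge_im, tiltCharge_im, tiltCharge_re, tiltCharge_re] at h6
    rw [← hX.sum f, ← hY.sum f]
    change ((L _).im + t * δ _) * -(L _).re - ((L _).im + t * δ _) * -(L _).re ≤ 0
    rw [hf, hf, hL, hL, hδ, hδ]
    exact sub_nonpos.2 h6

/-- For the support property `T = t` would suffice; the uniformity in `t ≤ T` is what continuity
needs. -/
theorem exists_uniform_tilt_form [Module.Finite ℤ Γ] (h : IsVeryWeakStability cl Z A)
    (hBG : IsBGInequality cl Z A ΔR ΔI) (hgood : IsGood cl Z A ΔI)
    (hN : N = Γ₀ cl Z A ⊓ ΔI.ker) {T : ℝ} (hT : 0 < T) :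
    ∃ (q : QuadraticForm ℝ (ℝ ⊗[ℤ] (Γ ⧸ N))) (L : ℝ ⊗[ℤ] (Γ ⧸ N) →ₗ[ℝ] ℂ)
      (δ : ℝ ⊗[ℤ] (Γ ⧸ N) →ₗ[ℝ] ℝ),
      (∀ x : Γ, L (1 ⊗ₜ (x : Γ ⧸ N)) = Z x) ∧ (∀ x : Γ, δ (1 ⊗ₜ (x : Γ ⧸ N)) = ΔI x) ∧
      (∀ s, 0 < s → s ≤ T → ∀ v, (L v).re = 0 → (L v).im + s * δ v = 0 → v ≠ 0 → q v < 0) ∧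
      ∀ t, 0 < t → t ≤ T → ∀ E : (tiltHeart cl Z A).FullSubcategory,
        IsSemistable cl (tiltCharge Z ΔI t) (tiltHeart cl Z A) E →
          0 ≤ q (1 ⊗ₜ (cl (K0.of E.obj) : Γ ⧸ N)) := by
  obtain ⟨Q, hQ, hQneg⟩ := h.support
  obtain ⟨q, L, δ, M, hM, hL, hδ, hq, hle, hlt⟩ := exists_tilt_quadraticForm hBG hQneg hN hT
  refine ⟨q, L, δ, hL, hδ, hlt, fun t ht htT E hE =>
    tilt_form_nonneg h.toIsVeryWeakPreStability hBG hgood hQ hM ht hL hδ hq ?_ hE⟩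
  intro s hs v h1 h2
  rcases hs.1.eq_or_lt with rfl | hs0
  · exact hle v (Complex.ext h1 (by simpa using h2))
  · by_cases h0 : v = 0
    · rw [h0, QuadraticMap.map_zero]
    · exact (hlt s hs0 (hs.2.trans htT) v h1 h2 h0).le

theorem Γ₀_tilt (h : IsVeryWeakPreStability cl Z A) (hBG : IsBGInequality cl Z A ΔR ΔI)
    (hgood : IsGood cl Z A ΔI) {t : ℝ} (ht : 0 < t) :
    Γ₀ cl (tiltCharge Z ΔI t) (tiltHeart cl Z A) = Γ₀ cl Z A ⊓ ΔI.ker := by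
  rw [Γ₀, hBG.kernelCat_tilt h ht, hgood.saturated]

/-- The tilted pairs are very weak stability conditions. -/
theorem isVeryWeakStability_tilt [Module.Finite ℤ Γ] (h : IsVeryWeakStability cl Z A)
    (hBG : IsBGInequality cl Z A ΔR ΔI) (hgood : IsGood cl Z A ΔI) {t : ℝ} (ht : 0 < t) :
    IsVeryWeakStability cl (tiltCharge Z ΔI t) (tiltHeart cl Z A) := by
  refine ⟨isVeryWeakPreStability_tilt h.toIsVeryWeakPreStability hBG hgood ht, ?_⟩
  obtain ⟨q, L, δ, hL, hδ, hneg, hq⟩ := exists_uniform_tilt_form h hBG hgood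
    (Γ₀_tilt h.toIsVeryWeakPreStability hBG hgood ht) ht
  refine ⟨q, hq t ht le_rfl, fun v hv h0 => ?_⟩
  have hZ : ∀ v, ZbarReal cl (tiltCharge Z ΔI t) (tiltHeart cl Z A) v =
      -Complex.I * L v + t * δ v := by
    intro v
    induction v using TensorProduct.induction_on with
    | zero => simp
    | add x y hx hy => rw [map_add, hx, hy, map_add, map_add]; push_cast; ring
    | tmul r x =>
      induction x using QuotientAddGroup.induction_on with
      | H x =>
        have h1 : (r ⊗ₜ[ℤ] (x : Γ ⧸ Γ₀ cl (tiltCharge Z ΔI t) (tiltHeart cl Z A))) =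
            r • ((1 : ℝ) ⊗ₜ[ℤ] (x : Γ ⧸ Γ₀ cl (tiltCharge Z ΔI t) (tiltHeart cl Z A))) := by
          rw [TensorProduct.smul_tmul', smul_eq_mul, mul_one]
        rw [h1, map_smul, map_smul, map_smul, hL, hδ, ZbarReal, LinearMap.liftBaseChange_tmul,
          one_smul]
        change r • (tiltCharge Z ΔI t x) = _
        change r • (-Complex.I * Z x + (t : ℂ) * (ΔI x : ℂ)) = _
        simp only [Complex.real_smul, smul_eq_mul]
        push_cast
        ring
  rw [hZ] at hv
  have h1 := congrArg Complex.re hv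
  have h2 := congrArg Complex.im hv
  simp at h1 h2
  exact hneg t ht le_rfl v h2 h1 h0

end TiltedSupport

/-! ### Phases of nearby complex numbers. -/

section PhaseEstimates

theorem onRay_of_cslope {z : ℂ} (hz : InUpper z) (h0 : z ≠ 0) {φ : ℝ}
    (hφ : φ ∈ Set.Ioc (0 : ℝ) 1) (h : cslope z = phaseSlope φ) : OnRay z φ := by
  rcases hφ.2.eq_or_lt with rfl | h1
  · have him : z.im = 0 := cslope_eq_top.1 (h.trans (if_pos rfl))
    have hre : z.re < 0 := lt_of_le_of_ne (hz.re_nonpos him) fun h => h0 (Complex.ext h him)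
    exact ⟨-z.re, by linarith, by simp, by simp [him]⟩
  · have hsin := sin_pi_mul_pos hφ.1 h1
    rw [phaseSlope, if_neg h1.ne] at h
    have him : z.im ≠ 0 := fun h2 => WithTop.coe_ne_top (h.symm.trans (cslope_eq_top.2 h2))
    have him' : 0 < z.im := lt_of_le_of_ne hz.im_nonneg him.symm
    rw [cslope_of_im_ne him, WithTop.coe_inj, div_eq_div_iff him hsin.ne'] at h
    refine ⟨z.im / Real.sin (Real.pi * φ), by positivity, ?_, by field_simp⟩
    rw [div_mul_eq_mul_div, eq_div_iff hsin.ne']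
    linarith

/-- By the law of cosines and completing the square in `n`: a ray at angle at least `π ε` from `z`
stays at distance at least `‖z‖ sin (π ε)` from it. -/
theorem OnRay.sin_mul_norm_le {z w : ℂ} {φ ψ ε : ℝ} (hz : OnRay z φ) (hw : OnRay w ψ)
    (hε0 : 0 < ε) (hε1 : ε ≤ 1 / 2) (h : ε ≤ |φ - ψ|) (h' : |φ - ψ| ≤ 1) :
    Real.sin (Real.pi * ε) * ‖z‖ ≤ ‖w - z‖ := by
  obtain ⟨m, hm, h1, h2⟩ := hz
  obtain ⟨n, hn, h3, h4⟩ := hw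
  have hpi := Real.pi_pos
  have hcos : Real.cos (Real.pi * (φ - ψ)) ≤ Real.cos (Real.pi * ε) := by
    rw [← Real.cos_abs (Real.pi * (φ - ψ)), abs_mul, abs_of_pos hpi]
    exact Real.cos_le_cos_of_nonneg_of_le_pi (by positivity) (by nlinarith)
      (mul_le_mul_of_nonneg_left h hpi.le)
  have hsq : ‖w - z‖ ^ 2 = m ^ 2 + n ^ 2 - 2 * (m * n) * Real.cos (Real.pi * (φ - ψ)) := by
    rw [Complex.sq_norm, Complex.normSq_apply, Complex.sub_re, Complex.sub_im, h1, h2, h3, h4,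
      mul_sub Real.pi, Real.cos_sub]
    linear_combination m ^ 2 * Real.sin_sq_add_cos_sq (Real.pi * φ) +
      n ^ 2 * Real.sin_sq_add_cos_sq (Real.pi * ψ)
  have hz : ‖z‖ ^ 2 = m ^ 2 := by
    rw [Complex.sq_norm, Complex.normSq_apply, h1, h2]
    linear_combination m ^ 2 * Real.sin_sq_add_cos_sq (Real.pi * φ)
  refine le_of_sq_le_sq ?_ (norm_nonneg _)
  rw [mul_pow, hz, hsq]
  have h5 := mul_le_mul_of_nonneg_left hcos (mul_pos hm hn).le
  have h6 := Real.sin_sq_add_cos_sq (Real.pi * ε)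
  have h7 : Real.sin (Real.pi * ε) ^ 2 * m ^ 2 = m ^ 2 - m ^ 2 * Real.cos (Real.pi * ε) ^ 2 := by
    linear_combination m ^ 2 * h6
  rw [h7]
  nlinarith [sq_nonneg (n - m * Real.cos (Real.pi * ε))]

theorem abs_phase_sub_lt {z w : ℂ} (hz : InUpper z) (hw : InUpper w) {φ ψ ε η : ℝ}
    (hφ : φ ∈ Set.Ioc (0 : ℝ) 1) (hψ : ψ ∈ Set.Ioc (0 : ℝ) 1) (h1 : cslope z = phaseSlope φ)
    (h2 : cslope w = phaseSlope ψ) (hε0 : 0 < ε) (hε1 : ε ≤ 1 / 2) (h : ‖w - z‖ ≤ η * ‖z‖)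
    (hη : η < Real.sin (Real.pi * ε)) : |φ - ψ| < ε := by
  have hη1 : η < 1 := hη.trans_le (Real.sin_le_one _)
  -- Objects of charge zero have slope `∞`, hence phase `1` for both charges.
  have hone : ∀ χ : ℝ, χ ∈ Set.Ioc (0 : ℝ) 1 → cslope 0 = phaseSlope χ → χ = 1 := by
    intro χ hχ h3
    rw [cslope_eq_top.2 Complex.zero_im] at h3
    unfold phaseSlope at h3
    by_contra hne
    rw [if_neg hne] at h3
    exact WithTop.coe_ne_top h3.symm
  by_cases hz0 : z = 0
  · have hw0 : w = 0 := by simpa [hz0] using h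
    subst hz0 hw0
    rw [hone φ hφ h1, hone ψ hψ h2, sub_self, abs_zero]
    exact hε0
  · have hzpos := norm_pos_iff.2 hz0
    have hw0 : w ≠ 0 := by
      rintro rfl
      rw [zero_sub, norm_neg] at h
      nlinarith
    by_contra! hle
    have h3 := (onRay_of_cslope hz hz0 hφ h1).sin_mul_norm_le (onRay_of_cslope hw hw0 hψ h2) hε0 hε1
      hle (abs_le.2 ⟨by linarith [hφ.1, hψ.2], by linarith [hφ.2, hψ.1]⟩)
    nlinarith

end PhaseEstimates

/-! ### Comparison of slicings with a common heart. -/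

section Distance

variable {D : Type u} [Category.{v} D] [Preadditive D] [HasZeroObject D] [HasShift D ℤ]
  [∀ n : ℤ, (shiftFunctor D n).Additive] [Pretriangulated D]

theorem Slicing.interval.change {S₁ S₂ : Slicing D} {ε : ℝ}
    (h : ∀ φ E, S₁.P φ E → S₂.interval (Set.Icc (φ - ε) (φ + ε)) E) {a b : ℝ} {E : D}
    (hE : S₁.interval (Set.Icc a b) E) : S₂.interval (Set.Icc (a - ε) (b + ε)) E := by
  induction hE with
  | of_isZero E h0 => exact .of_isZero h0
  | of_mem E hE =>
    obtain ⟨φ, hφ, hE⟩ := hE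
    exact (h φ E hE).mono fun ψ hψ => ⟨by linarith [hφ.1, hψ.1], by linarith [hφ.2, hψ.2]⟩
  | ext T hT _ _ h1 h3 => exact .ext ⟨_, _, _, hT⟩ h1 h3

theorem Slicing.dist_le {S₁ S₂ : Slicing D} {ε : ℝ}
    (h : ∀ φ E, S₁.P φ E → S₂.interval (Set.Icc (φ - ε) (φ + ε)) E)
    (h' : ∀ φ E, S₂.P φ E → S₁.interval (Set.Icc (φ - ε) (φ + ε)) E) :
    S₁.dist S₂ ≤ ENNReal.ofReal ε := by
  refine iSup_le fun E => iSup_le fun h0 => iSup_le fun F₁ => iSup_le fun F₂ =>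
    ENNReal.ofReal_le_ofReal ?_
  have h1 := F₁.tower S₁.of_iso
  have h2 := F₂.tower S₂.of_iso
  obtain ⟨h3, h4⟩ := (Slicing.interval.change h h1.interval).tower_mem Set.ordConnected_Icc h2
  obtain ⟨h5, h6⟩ := (Slicing.interval.change h' h2.interval).tower_mem Set.ordConnected_Icc h1
  exact max_le (abs_le.2 ⟨by linarith [h4.2], by linarith [h6.2]⟩)
    (abs_le.2 ⟨by linarith [h5.1], by linarith [h3.1]⟩)

variable [IsTriangulated D] {S : Slicing D}

theorem Tower.exists_top {lo hi : ℝ} {E : D} (h : Tower S.P lo hi E) :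
    ∃ X Y, HasTri X E Y ∧ S.P hi X ∧ ¬ IsZero X ∧ S.interval (Set.Icc lo hi) Y := by
  obtain ⟨X, Y, htri, hX, hY⟩ := h.truncation (isUpperSet_Ici hi)
  refine ⟨X, Y, htri, (hX.mono fun φ hφ => le_antisymm hφ.1.2 hφ.2 : S.interval {hi} X).singleton,
    fun h0 => ?_, hY.mono fun φ hφ => hφ.1⟩
  obtain ⟨e⟩ := htri.iso_of_isZero_left h0
  obtain ⟨-, φ, hφ, hle⟩ := (hY.of_iso e.symm).exists_le h
  exact hφ.2 hle

theorem Tower.exists_bot {lo hi : ℝ} {E : D} (h : Tower S.P lo hi E) :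
    ∃ X Y, HasTri X E Y ∧ S.P lo Y ∧ ¬ IsZero Y ∧ S.interval (Set.Icc lo hi) X := by
  obtain ⟨X, Y, htri, hX, hY⟩ := h.truncation (isUpperSet_Ioi lo)
  refine ⟨X, Y, htri, (hY.mono fun φ hφ => le_antisymm (not_lt.1 hφ.2) hφ.1.1 :
    S.interval {lo} Y).singleton, fun h0 => ?_, hX.mono fun φ hφ => hφ.1⟩
  obtain ⟨e⟩ := htri.iso_of_isZero_right h0
  obtain ⟨⟨φ, hφ, hle⟩, -⟩ := (hX.of_iso e).exists_le h
  exact not_lt.2 hle hφ.2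

variable {Γ : Type w} [AddCommGroup Γ] {cl : K0 D →+ Γ} {Z₁ Z₂ : Γ →+ ℂ} {B : ObjectProperty D}

theorem phaseSlope_le_iff {φ ψ : ℝ} (hφ : φ ∈ Set.Ioc (0 : ℝ) 1) (hψ : ψ ∈ Set.Ioc (0 : ℝ) 1) :
    phaseSlope φ ≤ phaseSlope ψ ↔ φ ≤ ψ := by
  rw [← not_lt, ← not_lt, phaseSlope_lt_iff hψ hφ]

/-- Two stability conditions on the same heart whose phases of semistable objects are close. -/
theorem IsVeryWeakPreStability.interval_of_close (h₁ : IsVeryWeakPreStability cl Z₁ B)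
    (h₂ : IsVeryWeakPreStability cl Z₂ B) {ε : ℝ}
    (hclose : ∀ X : B.FullSubcategory, SS (heartCharge cl Z₂ B) X → ∀ φ ∈ Set.Ioc (0 : ℝ) 1,
      ∀ ψ ∈ Set.Ioc (0 : ℝ) 1, cslope (heartCharge cl Z₂ B X) = phaseSlope φ →
      cslope (heartCharge cl Z₁ B X) = phaseSlope ψ → |φ - ψ| ≤ ε) {φ : ℝ} {E : D}
    (hE : phase cl Z₁ B φ E) : h₂.slicing.interval (Set.Icc (φ - ε) (φ + ε)) E := by
  suffices ∀ φ ∈ Set.Ioc (0 : ℝ) 1, ∀ E, phase cl Z₁ B φ E →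
      h₂.slicing.interval (Set.Icc (φ - ε) (φ + ε)) E by
    have h1 := sub_ceil_mem φ
    set n := ⌈φ⌉ - 1
    have h2 := this _ h1 (E⟦-n⟧) (by
      have := (phase_shift_iff h₁.isBoundedHeart φ (-n) E).2 hE
      rwa [Int.cast_neg, ← sub_eq_add_neg] at this)
    have h3 := Slicing.interval.shift (S := h₂.slicing) (J := Set.Icc (φ - ε) (φ + ε)) n
      (fun ψ hψ => ⟨by linarith [hψ.1], by linarith [hψ.2]⟩) h2
    exact h3.of_iso (shiftNegShift E n)
  letI := h₁.isBoundedHeart.abelian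
  have hW := h₁.isBoundedHeart.isWeakCharge h₁.upper
  intro φ hφ E hE
  by_cases h0 : IsZero E
  · exact .of_isZero h0
  obtain ⟨hB, hss, hsl⟩ := ((phase_iff_basicPhase h₁.isBoundedHeart hφ E).1 hE).slope_eq h0
  obtain ⟨lo, hi, ht⟩ := h₂.slicing.exists_tower h0
  obtain ⟨hlo, hhi⟩ := Slicing.interval.tower_mem Set.ordConnected_Ioc ((h₂.heart_iff E).1 hB) ht
  have hin : ∀ {X}, h₂.slicing.interval (Set.Icc lo hi) X → B X := fun hX =>
    (h₂.heart_iff _).2 (hX.mono fun ψ hψ => ⟨hlo.1.trans_le hψ.1, hψ.2.trans hhi.2⟩)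
  have key : ∀ {X : D} {χ : ℝ}, χ ∈ Set.Ioc (0 : ℝ) 1 → h₂.slicing.P χ X → ¬ IsZero X →
      ∃ (hX : B X) (ψ : ℝ), ψ ∈ Set.Ioc (0 : ℝ) 1 ∧
        cslope (heartCharge cl Z₁ B ⟨X, hX⟩) = phaseSlope ψ ∧ |χ - ψ| ≤ ε := by
    intro X χ hχ hX hX0
    obtain ⟨hXB, h1, h2⟩ := ((phase_iff_basicPhase h₂.isBoundedHeart hχ X).1 hX).slope_eq hX0
    obtain ⟨ψ, hψ, h3⟩ := exists_phaseSlope_eq (cslope (heartCharge cl Z₁ B ⟨X, hXB⟩))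
    exact ⟨hXB, ψ, hψ, h3.symm, hclose _ h1 χ hχ ψ hψ h2 h3.symm⟩
  refine ht.interval.mono fun χ hχ => ⟨?_, ?_⟩
  -- The lowest factor for `Z₂` is a quotient of `E`, so its `Z₁`-slope is at least that of `E`,
  -- while its two phases differ by at most `ε`. The highest factor, a subobject, is treated dually.
  · obtain ⟨X, Y, ⟨a, b, c, hT⟩, hY, hY0, hX⟩ := ht.exists_bot
    obtain ⟨hYB, ψ, hψ, h1, h2⟩ := key hlo hY hY0
    obtain ⟨w, hw⟩ := h₁.isBoundedHeart.shortExact_of_triangle (X := ⟨X, hin hX⟩) (Y := ⟨E, hB⟩)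
      (Z := ⟨Y, hYB⟩) (ObjectProperty.homMk a) (ObjectProperty.homMk b) c hT
    have := hw.epi_g
    have h3 := SS.le_of_epi hW hss (ObjectProperty.homMk b : (⟨E, hB⟩ : B.FullSubcategory) ⟶ ⟨Y, hYB⟩)
    rw [hsl, h1, phaseSlope_le_iff hφ hψ] at h3
    linarith [(abs_le.1 h2).1, hχ.1]
  · obtain ⟨X, Y, ⟨a, b, c, hT⟩, hX, hX0, hY⟩ := ht.exists_top
    obtain ⟨hXB, ψ, hψ, h1, h2⟩ := key hhi hX hX0
    obtain ⟨w, hw⟩ := h₁.isBoundedHeart.shortExact_of_triangle (X := ⟨X, hXB⟩) (Y := ⟨E, hB⟩)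
      (Z := ⟨Y, hin hY⟩) (ObjectProperty.homMk a) (ObjectProperty.homMk b) c hT
    have := hw.mono_f
    have h3 := SS.le_of_mono hW hss (ObjectProperty.homMk a : (⟨X, hXB⟩ : B.FullSubcategory) ⟶ ⟨E, hB⟩)
      fun h0 => hX0 (isZero_of_fullSubcategory h0)
    rw [hsl, h1, phaseSlope_le_iff hψ hφ] at h3
    linarith [(abs_le.1 h2).2, hχ.2]

end Distance

/-! ### Continuity of the slicing along the path. -/

section Continuity

variable {D : Type u} [Category.{v} D] [Preadditive D] [HasZeroObject D] [HasShift D ℤ]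
  [∀ n : ℤ, (shiftFunctor D n).Additive] [Pretriangulated D] [IsTriangulated D]
  {Γ : Type w} [AddCommGroup Γ] [Module.Finite ℤ Γ] {cl : K0 D →+ Γ} {Z : Γ →+ ℂ}
  {A : ObjectProperty D} {ΔR ΔI : Γ →+ ℚ}

/-- The difference of the charges is `(t - s) Δ_I`. The uniform form for `T = s + 1` is negative
definite on the kernel of `Z_s†` and nonnegative on objects semistable at any `t' ≤ s + 1`, so `Δ_I`
is bounded by `Z_s†` on all of these. -/
theorem exists_tilt_bound (h : IsVeryWeakStability cl Z A) (hBG : IsBGInequality cl Z A ΔR ΔI)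
    (hgood : IsGood cl Z A ΔI) {s : ℝ} (hs : 0 < s) :
    ∃ C : ℝ, 0 < C ∧ ∀ t', 0 < t' → t' ≤ s + 1 → ∀ E : (tiltHeart cl Z A).FullSubcategory,
      IsSemistable cl (tiltCharge Z ΔI t') (tiltHeart cl Z A) E → ∀ t : ℝ,
        ‖tiltCharge Z ΔI t (cl (K0.of E.obj)) - tiltCharge Z ΔI s (cl (K0.of E.obj))‖ ≤
          |t - s| * C * ‖tiltCharge Z ΔI s (cl (K0.of E.obj))‖ := by
  obtain ⟨q, L, δ, hL, hδ, hneg, hq⟩ := exists_uniform_tilt_form h hBG hgood rfl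
    (show 0 < s + 1 by linarith)
  have := moduleFinite_quotient (Γ₀ cl Z A ⊓ ΔI.ker)
  let L' : ℝ ⊗[ℤ] (Γ ⧸ (Γ₀ cl Z A ⊓ ΔI.ker)) →ₗ[ℝ] ℂ :=
    (-Complex.I) • L + s • (Complex.ofRealCLM.toLinearMap ∘ₗ δ)
  have hL' : ∀ v, L' v = -Complex.I * L v + s * δ v := fun v => by
    change (-Complex.I) • L v + s • ((δ v : ℝ) : ℂ) = _
    rw [smul_eq_mul, Complex.real_smul]
  obtain ⟨C, hC, hbd⟩ := exists_abs_le_norm q L' (fun v hv h0 => by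
    rw [hL'] at hv
    have h1 := congrArg Complex.re hv
    have h2 := congrArg Complex.im hv
    simp at h1 h2
    exact hneg s hs (by linarith) v h2 h1 h0) δ
  refine ⟨C, hC, fun t' ht hts E hE t => ?_⟩
  have h1 := hbd _ (hq t' ht hts E hE)
  rw [hL', hL, hδ] at h1
  have h2 : tiltCharge Z ΔI t (cl (K0.of E.obj)) - tiltCharge Z ΔI s (cl (K0.of E.obj)) =
      ((t - s : ℝ) : ℂ) * ((ΔI (cl (K0.of E.obj)) : ℝ) : ℂ) := by
    change (-Complex.I * Z _ + (t : ℂ) * (ΔI _ : ℂ)) - (-Complex.I * Z _ + (s : ℂ) * (ΔI _ : ℂ)) = _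
    push_cast
    ring
  rw [h2, norm_mul, Complex.norm_real, Complex.norm_real, mul_assoc]
  refine mul_le_mul_of_nonneg_left ?_ (norm_nonneg _)
  exact h1

theorem exists_tilt_dist_le (h : IsVeryWeakStability cl Z A) (hBG : IsBGInequality cl Z A ΔR ΔI)
    (hgood : IsGood cl Z A ΔI) {s ε : ℝ} (hs : 0 < s) (hε0 : 0 < ε) (hε1 : ε ≤ 1 / 2) :
    ∃ d : ℝ, 0 < d ∧ ∀ (t : ℝ)
      (h₁ : IsVeryWeakPreStability cl (tiltCharge Z ΔI s) (tiltHeart cl Z A))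
      (h₂ : IsVeryWeakPreStability cl (tiltCharge Z ΔI t) (tiltHeart cl Z A)),
      0 < t → |t - s| < d → h₁.slicing.dist h₂.slicing ≤ ENNReal.ofReal ε := by
  obtain ⟨C, hC, hbd⟩ := exists_tilt_bound h hBG hgood hs
  have hsin : 0 < Real.sin (Real.pi * ε) := sin_pi_mul_pos hε0 (by linarith)
  -- The `1` keeps `t` in the range of the uniform bound, so that it applies to objects semistable
  -- at `s` and at `t`. The other term makes the relative change of charge smaller than `sin (π ε)`.
  refine ⟨min 1 (Real.sin (Real.pi * ε) / C), by positivity, fun t h₁ h₂ ht hts => ?_⟩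
  have hts1 : t ≤ s + 1 := by linarith [(abs_lt.1 (hts.trans_le (min_le_left _ _))).2]
  have hη : |t - s| * C < Real.sin (Real.pi * ε) :=
    (lt_div_iff₀ hC).1 (hts.trans_le (min_le_right _ _))
  refine Slicing.dist_le (fun φ E hE => h₁.interval_of_close h₂ ?_ hE)
    fun φ E hE => h₂.interval_of_close h₁ ?_ hE
  · intro X hX φ hφ ψ hψ h3 h4
    rw [abs_sub_comm]
    exact (abs_phase_sub_lt (h₁.upper _ X.property) (h₂.upper _ X.property) hψ hφ h4 h3 hε0 hε1
      (hbd t ht hts1 X hX t) hη).le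
  · intro X hX φ hφ ψ hψ h3 h4
    exact (abs_phase_sub_lt (h₁.upper _ X.property) (h₂.upper _ X.property) hφ hψ h3 h4 hε0 hε1
      (hbd s hs (by linarith) X hX t) hη).le

end Continuity

/-! ### The path of tilted stability conditions. -/

section MainTheorem

variable {D : Type u} [Category.{v} D] [Preadditive D] [HasZeroObject D] [HasShift D ℤ]
  [∀ n : ℤ, (shiftFunctor D n).Additive] [Pretriangulated D] [IsTriangulated D]
  {Γ : Type w} [AddCommGroup Γ] [Module.Finite ℤ Γ] {cl : K0 D →+ Γ} {Z : Γ →+ ℂ}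
  {A : ObjectProperty D} {ΔR ΔI : Γ →+ ℚ}

/-- The path of tilted very weak stability conditions. -/
noncomputable def tiltPath (h : IsVeryWeakStability cl Z A) (hBG : IsBGInequality cl Z A ΔR ΔI)
    (hgood : IsGood cl Z A ΔI) (t : Set.Ioi (0 : ℝ)) : Stab cl where
  Z := tiltCharge Z ΔI t
  A := tiltHeart cl Z A
  isVeryWeakStability := isVeryWeakStability_tilt h hBG hgood t.2
  slicing := (isVeryWeakStability_tilt h hBG hgood t.2).toIsVeryWeakPreStability.slicing
  slicing_eq := rfl

theorem continuous_tiltPath (h : IsVeryWeakStability cl Z A) (hBG : IsBGInequality cl Z A ΔR ΔI)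
    (hgood : IsGood cl Z A ΔI) : Continuous (tiltPath h hBG hgood) := by
  refine continuous_induced_rng.2 (Continuous.prodMk ?_ ?_)
  · refine continuous_pi fun x => ?_
    change Continuous fun t : Set.Ioi (0 : ℝ) => -Complex.I * Z x + ((t : ℝ) : ℂ) * (ΔI x : ℂ)
    fun_prop
  · refine continuous_def.2 fun U hU => Metric.isOpen_iff.2 fun s hs => ?_
    obtain ⟨ε, hε, hεU⟩ := hU _ hs
    obtain ⟨r, hr0, hr⟩ := ENNReal.lt_iff_exists_nnreal_btwn.1 hε
    have hr0' : (0 : ℝ) < r := by exact_mod_cast hr0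
    obtain ⟨d, hd, hdist⟩ := exists_tilt_dist_le h hBG hgood (s := s) (ε := min r (1 / 2)) s.2
      (by positivity) (min_le_right _ _)
    refine ⟨d, hd, fun t ht => hεU _ ?_⟩
    have hle := hdist t
      (isVeryWeakStability_tilt h hBG hgood s.2).toIsVeryWeakPreStability
      (isVeryWeakStability_tilt h hBG hgood t.2).toIsVeryWeakPreStability t.2 ht
    refine lt_of_le_of_lt (hle.trans ?_) hr
    rw [← ENNReal.ofReal_coe_nnreal]
    exact ENNReal.ofReal_le_ofReal (min_le_left _ _)

end MainTheorem

end VeryWeakStab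

theorem mainTheorem5
    {D : Type u} [Category.{v} D] [Preadditive D] [HasZeroObject D] [HasShift D ℤ]
    [∀ n : ℤ, (shiftFunctor D n).Additive] [Pretriangulated D] [IsTriangulated D]
    {Γ : Type w} [AddCommGroup Γ] [Module.Free ℤ Γ] [Module.Finite ℤ Γ]
    (cl : VeryWeakStab.K0 D →+ Γ) (Z : Γ →+ ℂ) (A : ObjectProperty D) (ΔR ΔI : Γ →+ ℚ)
    (hZA : VeryWeakStab.IsVeryWeakStability cl Z A)
    (hBG : VeryWeakStab.IsBGInequality cl Z A ΔR ΔI)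
    (hgood : VeryWeakStab.IsGood cl Z A ΔI) :
    (∀ t : ℝ, 0 < t → VeryWeakStab.IsVeryWeakStability cl
      (VeryWeakStab.tiltCharge Z ΔI t) (VeryWeakStab.tiltHeart cl Z A)) ∧
    ∃ σ : Set.Ioi (0 : ℝ) → VeryWeakStab.Stab cl,
      (∀ t : Set.Ioi (0 : ℝ), (σ t).Z = VeryWeakStab.tiltCharge Z ΔI t ∧
        (σ t).A = VeryWeakStab.tiltHeart cl Z A) ∧
      Continuous σ := by
  exact ⟨fun t ht => VeryWeakStab.isVeryWeakStability_tilt hZA hBG hgood ht,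
    VeryWeakStab.tiltPath hZA hBG hgood, fun t => ⟨rfl, rfl⟩,
    VeryWeakStab.continuous_tiltPath hZA hBG hgood⟩
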